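/- Let $p$ be a prime and let $k\ge 0$ be an even integer. **The group.** Let $B$ be a definite quaternion algebra over $\mathbb Q$ of discriminant $N^-$ prime to $p$, let $R\subset B$ be an Eichler $\mathbb Z$-order of level $N^+$ with $N^+$ prime to $pN^-$, and let $\iota\colon B\otimes_{\mathbb Q}\mathbb Q_p\cong \mathrm M_2(\mathbb Q_p)$ be a splitting with $\iota(R\otimes\mathbb Z_p)=\mathrm M_2(\mathbb Z_p)$. Let $\Gamma\subset\mathrm{SL}_2(\mathbb Q_p)$ be the image under $\iota$ of the group of elements of reduced norm $1$ in $R[1/p]$. **Cocycles.** Let $\mathcal P_k\subset\mathbb Q_p[x]$ be the space of polynomials of degree at most $k$, with the right action $(f\cdot_k g)(x)=\det(g)^{-k/2}(cx+d)^kf\bigl(\tfrac{ax+b}{cx+d}\bigr)$ of $g=\left(\begin{smallmatrix}a&b\\c&d\end{smallmatrix}\right)\in\mathrm{GL}_2(\mathbb Q_p)$, and let $V_k$ be its dual, with the left action $(g\cdot_k\lambda)(P)=\lambda(P\cdot_kg)$ and the right action $(\lambda\cdot_kg)(P)=\lambda(P\cdot_kg^{-1})$. Let $\mathcal T$ be the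 Bruhat–Tits tree of $\mathrm{GL}_2(\mathbb Q_p)$, and let $e_0$ be its oriented edge with source $v_1=\left(\begin{smallmatrix}0&1\\p&0\end{smallmatrix}\right)[\mathbb Z_p^2]$ and target $v_0=[\mathbb Z_p^2]$. Let $c$ be a $\Gamma$-invariant $V_k$-valued harmonic cocycle: a function from the oriented edges of $\mathcal T$ to $V_k$ such that $c(\bar e)=-c(e)$ for the opposite edge $\bar e$ of $e$, $\sum_{s(e)=v}c(e)=0$ for every vertex $v$ (the sum being over the edges with source $v$), and $c(\gamma e)=\gamma\cdot_kc(e)$ for $\gamma\in\Gamma$. Put $\varphi_c(g)=g^{-1}\cdot_kc(ge_0)$ for $g\in\mathrm{GL}_2(\mathbb Q_p)$. **The measure.** Let $A_k^{\mathrm{loc}}$ be the space of $\mathbb Q_p$-valued functions on $\mathbb P^1(\mathbb Q_p)$ that are locally analytic except possibly for a pole of order at most $k$ at $\infty$. A measure on it is a continuous linear functional $\mu\colon A_k^{\mathrm{loc}}\to\mathbb Q_p$, and $\int_Uf\,d\mu=\mu(f\chi_U)$. For $e=ge_0$ write $U_e=g\mathbb Z_p\subset\mathbb P^1(\mathbb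 Q_p)$. Let $\mu_c$ be the measure attached to $c$ (Amice–Vélu, Vishik), i.e. the measure characterized by $\int_{U_e}P\,d\mu_c=c(e)(P)$ for all $P\in\mathcal P_k$ and all $e$, together with the existence of a constant $C\ge0$ such that $\bigl|\int_{U_e}x^n\,d\mu_c\bigr|_p\le C\rho^{-n+k/2}$ with $\rho=\sup_{z\in U_e}|1/z|_p$ whenever $\infty\in U_e$, $0\notin U_e$, $n\in\mathbb Z$, $n\le k$, and $\bigl|\int_{U_e}(x-a)^n\,d\mu_c\bigr|_p\le C\rho^{n-k/2}$ with $\rho=\sup_{z,z'\in U_e}|z-z'|_p$ whenever $a\in U_e\subset\mathbb Q_p$, $n\ge0$. Its moments are $m(\mu_c,g,i)=\int_{g\mathbb Z_p}(x^i\cdot_kg^{-1})\,d\mu_c$. **Automorphic forms.** Let $\mathbb T$ be the Tate algebra of power series $\sum a_nx^n$ over $\mathbb Q_p$ with $a_n\to0$, with the norm $\sup|a_n|$, and let $\mathbb D_k$ be its continuous dual. For $\tau=u\sigma$ with $u\in\mathbb Q_p^\times$, $\sigma=\left(\begin{smallmatrix}a&b\\c&d\end{smallmatrix}\right)\in\mathrm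 M_2(\mathbb Z_p)$, $\det\sigma\ne0$, $p\mid c$, $a\in\mathbb Z_p^\times$, let $(\tau\cdot_kf)(x)=\det(\sigma)^{-k/2}(-cx+a)^kf\bigl(\tfrac{dx-b}{-cx+a}\bigr)$ for $f\in\mathbb T$ and $(\omega\cdot_k\tau)(f)=\omega(\tau\cdot_kf)$ for $\omega\in\mathbb D_k$. Let $\Gamma_0(p\mathbb Z_p)\subset\mathrm{GL}_2(\mathbb Z_p)$ be the group of matrices with lower left entry divisible by $p$. Let $\mathcal A_k'(\Gamma,\mathbb Z_p)$ be the set of maps $\Phi\colon\mathrm{GL}_2(\mathbb Q_p)\to\mathbb D_k$ such that, for all $g$, - $\Phi(u\gamma g\sigma)=\Phi(g)\cdot_k\sigma$ for $u\in\mathbb Q_p^\times$, $\gamma\in\Gamma$, $\sigma\in\Gamma_0(p\mathbb Z_p)$; - $\Phi(g)(x^i)\in\mathbb Z_p$ for all $i\ge0$, and $\Phi(g)(x^i)\in p^{k/2-i}\mathbb Z_p$ for $0\le i\le k/2$. The operator $\widetilde{U_p}$ is $(\widetilde{U_p}\Phi)(g)=\sum_{j=0}^{p-1}\Phi(g\alpha_j)\cdot_k\alpha_j^{-1}$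 with $\alpha_j=\left(\begin{smallmatrix}p&j\\0&1\end{smallmatrix}\right)$. **Statement.** Let $\Phi_0\in\mathcal A_k'(\Gamma,\mathbb Z_p)$ be an arbitrary lift of $\varphi_c$, i.e. $\Phi_0(g)|_{\mathcal P_k}=\varphi_c(g)$ for all $g\in\mathrm{GL}_2(\mathbb Q_p)$. Then the measure $\mu_c$ exists and is unique, and for all $n\ge1$, all $i\in\{1,\dots,n\}$ and all $g\in\mathrm{GL}_2(\mathbb Q_p)$, $$\bigl((\widetilde{U_p})^n\Phi_0\bigr)(g)(x^{k+i})\equiv m(\mu_c,g,k+i)\pmod{p^{\,n-i+1}\mathbb Z_p}.$$ -/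

import Mathlib

open scoped Matrix Polynomial

namespace PadicForms

open Filter Topology

variable (p : ℕ) [Fact p.Prime]

/-- `GL₂(ℚ_p)`. -/
abbrev GL2 : Type := GL (Fin 2) ℚ_[p]

/-- The matrix `α_j = (p j; 0 1)`. -/
noncomputable def alpha (j : ℕ) : GL2 p :=
  Matrix.GeneralLinearGroup.mkOfDetNeZero !![(p : ℚ_[p]), (j : ℚ_[p]); 0, 1]
    (by simp [(Fact.out : p.Prime).ne_zero])

/-- The matrix `g₀ = (0 1; p 0)`. -/
noncomputable def gZero : GL2 p :=
  Matrix.GeneralLinearGroup.mkOfDetNeZero !![0, 1; (p : ℚ_[p]), 0]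
    (by simp [(Fact.out : p.Prime).ne_zero])

/-! ### The Bruhat-Tits tree -/

/-- `ℤ_p`-lattices in `ℚ_p²`. -/
def Lattice : Type :=
  {L : Submodule ℤ_[p] (Fin 2 → ℚ_[p]) // Submodule.IsLattice ℚ_[p] L}

variable {p}

/-- The linear automorphism of `ℚ_p²` given by `g`, viewed over `ℤ_p`. -/
noncomputable def glLin (g : GL2 p) : (Fin 2 → ℚ_[p]) →ₗ[ℤ_[p]] (Fin 2 → ℚ_[p]) :=
  (Matrix.mulVecLin (g : Matrix (Fin 2) (Fin 2) ℚ_[p])).restrictScalars ℤ_[p]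

theorem glLin_one : glLin (1 : GL2 p) = LinearMap.id := by
  ext v : 1
  simp [glLin]

theorem glLin_mul (g h : GL2 p) : glLin (g * h) = (glLin g).comp (glLin h) := by
  refine LinearMap.ext fun v => ?_
  simp [glLin]

theorem isLattice_map (g : GL2 p) {L : Submodule ℤ_[p] (Fin 2 → ℚ_[p])}
    (hL : Submodule.IsLattice ℚ_[p] L) : Submodule.IsLattice ℚ_[p] (L.map (glLin g)) where
  fg := hL.fg.map _
  span_eq_top := by
    have h1 : ((L.map (glLin g) : Submodule ℤ_[p] (Fin 2 → ℚ_[p])) : Set (Fin 2 → ℚ_[p]))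
        = Matrix.mulVecLin (g : Matrix (Fin 2) (Fin 2) ℚ_[p]) '' (L : Set (Fin 2 → ℚ_[p])) := rfl
    rw [h1, Submodule.span_image, hL.span_eq_top, Submodule.map_top, LinearMap.range_eq_top]
    intro v
    refine ⟨Matrix.mulVec ((g⁻¹ : GL2 p) : Matrix (Fin 2) (Fin 2) ℚ_[p]) v, ?_⟩
    rw [Matrix.mulVecLin_apply, Matrix.mulVec_mulVec, ← Units.val_mul, mul_inv_cancel]
    simp

/-- The action `g L = {g v | v ∈ L}` on lattices. -/
noncomputable instance : MulAction (GL2 p) (Lattice p) where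
  smul g L := ⟨L.1.map (glLin g), isLattice_map g L.2⟩
  one_smul L := Subtype.ext (by
    change L.1.map (glLin 1) = L.1
    rw [glLin_one, Submodule.map_id])
  mul_smul g h L := Subtype.ext (by
    change L.1.map (glLin (g * h)) = (L.1.map (glLin h)).map (glLin g)
    rw [glLin_mul, Submodule.map_comp])

theorem Lattice.coe_smul (g : GL2 p) (L : Lattice p) : (g • L).1 = L.1.map (glLin g) := rfl

/-- Scalar matrices. -/
noncomputable abbrev scalarGL (u : ℚ_[p]ˣ) : GL2 p := Matrix.GeneralLinearGroup.scalar (Fin 2) u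

/-- Homothety of lattices: `L' = u L` for some `u ∈ ℚ_p^×`. -/
noncomputable def homothety (p : ℕ) [Fact p.Prime] : Setoid (Lattice p) where
  r L L' := ∃ u : ℚ_[p]ˣ, L' = scalarGL u • L
  iseqv :=
    { refl := fun L => ⟨1, by simp [scalarGL]⟩
      symm := by
        rintro L _ ⟨u, rfl⟩
        exact ⟨u⁻¹, by simp [scalarGL]⟩
      trans := by
        rintro L _ _ ⟨u, rfl⟩ ⟨v, rfl⟩
        exact ⟨v * u, by simp [scalarGL, mul_smul]⟩ }

/-- Vertices of the tree: homothety classes of lattices. -/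
def Vertex (p : ℕ) [Fact p.Prime] : Type := Quotient (homothety p)

/-- The homothety class `[L]`. -/
noncomputable def Lattice.cls (L : Lattice p) : Vertex p := Quotient.mk (homothety p) L

/-- The action `g [L] = [g L]` on vertices. -/
noncomputable instance : SMul (GL2 p) (Vertex p) where
  smul g := Quotient.map (fun L => g • L) (by
    rintro L _ ⟨u, rfl⟩
    refine ⟨u, ?_⟩
    rw [← mul_smul, ← mul_smul, Matrix.GeneralLinearGroup.scalar_commute])

theorem smul_cls (g : GL2 p) (L : Lattice p) : g • L.cls = (g • L).cls := rfl

/-- The lattice `p L`. -/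
noncomputable def pSmul (L : Lattice p) : Lattice p :=
  scalarGL (Units.mk0 (p : ℚ_[p]) (by exact_mod_cast (Fact.out : p.Prime).ne_zero)) • L

/-- Two vertices are adjacent if they have representatives with `p L ⊊ L' ⊊ L`. -/
def Adj (v w : Vertex p) : Prop :=
  ∃ L L' : Lattice p, L.cls = v ∧ L'.cls = w ∧ (pSmul L).1 < L'.1 ∧ L'.1 < L.1

theorem glLin_injective (g : GL2 p) : Function.Injective (glLin g) := by
  intro v w h
  have := congrArg (glLin g⁻¹) h
  simpa [← LinearMap.comp_apply, ← glLin_mul, glLin_one] using this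

theorem smul_lt_smul (g : GL2 p) {L L' : Lattice p} (h : L.1 < L'.1) : (g • L).1 < (g • L').1 :=
  Submodule.map_strictMono_of_injective (glLin_injective g) h

theorem pSmul_smul (g : GL2 p) (L : Lattice p) : pSmul (g • L) = g • pSmul L := by
  rw [pSmul, pSmul, ← mul_smul, ← mul_smul, Matrix.GeneralLinearGroup.scalar_commute]

theorem cls_pSmul (L : Lattice p) : (pSmul L).cls = L.cls :=
  (Quotient.sound ⟨_, rfl⟩ : L.cls = (pSmul L).cls).symm

theorem Adj.symm {v w : Vertex p} (h : Adj v w) : Adj w v := by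
  obtain ⟨L, L', rfl, rfl, h1, h2⟩ := h
  exact ⟨L', pSmul L, rfl, cls_pSmul L, smul_lt_smul _ h2, h1⟩

theorem Adj.smul (g : GL2 p) {v w : Vertex p} (h : Adj v w) : Adj (g • v) (g • w) := by
  obtain ⟨L, L', rfl, rfl, h1, h2⟩ := h
  refine ⟨g • L, g • L', rfl, rfl, ?_, smul_lt_smul _ h2⟩
  rw [pSmul_smul]
  exact smul_lt_smul _ h1

/-- Oriented edges of the tree. -/
@[ext]
structure Edge (p : ℕ) [Fact p.Prime] where
  source : Vertex p
  target : Vertex p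
  adj : Adj source target

/-- The opposite edge. -/
def Edge.opp (e : Edge p) : Edge p := ⟨e.target, e.source, e.adj.symm⟩

noncomputable instance : SMul (GL2 p) (Edge p) where
  smul g e := ⟨g • e.source, g • e.target, e.adj.smul g⟩

/-- The standard lattice `ℤ_p²`. -/
noncomputable def stdLattice (p : ℕ) [Fact p.Prime] : Lattice p :=
  ⟨Submodule.span ℤ_[p] (Set.range (Pi.basisFun ℚ_[p] (Fin 2))),
    { fg := Submodule.fg_span (Set.finite_range _)
      span_eq_top := by
        rw [Submodule.span_span_of_tower, (Pi.basisFun ℚ_[p] (Fin 2)).span_eq] }⟩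

theorem mem_stdLattice {v : Fin 2 → ℚ_[p]} : v ∈ (stdLattice p).1 ↔ ∀ i, ‖v i‖ ≤ 1 := by
  rw [stdLattice, Module.Basis.mem_span_iff_repr_mem]
  constructor
  · intro h i
    obtain ⟨z, hz⟩ := h i
    have : (z : ℚ_[p]) = v i := by simpa using hz
    rw [← this]
    exact z.2
  · intro h i
    exact ⟨⟨v i, h i⟩, by simp; rfl⟩

/-- `v₀ = [ℤ_p²]` and `v₁ = g₀ v₀` are adjacent. -/
theorem adj_std : Adj (gZero p • (stdLattice p).cls) (stdLattice p).cls := by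
  have hp1 : ‖(p : ℚ_[p])‖ < 1 := Padic.norm_p_lt_one
  have key : ∀ (g : GL2 p) (w : Fin 2 → ℚ_[p]), w ∈ (g • stdLattice p).1 ↔
      ∃ v : Fin 2 → ℚ_[p], (∀ i, ‖v i‖ ≤ 1) ∧ (g : Matrix _ _ ℚ_[p]) *ᵥ v = w := by
    intro g w
    rw [Lattice.coe_smul, Submodule.mem_map]
    simp only [mem_stdLattice]
    rfl
  have hlt : ∀ x : ℚ_[p], ‖x‖ ≤ 1 → (p : ℚ_[p]) * x ≠ 1 := by
    intro x hx h
    have h2 : ‖(p : ℚ_[p]) * x‖ < 1 := by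
      rw [norm_mul]
      exact mul_lt_one_of_nonneg_of_lt_one_left (norm_nonneg _) hp1 hx
    rw [h, norm_one] at h2
    exact lt_irrefl _ h2
  have hle : ∀ x : ℚ_[p], ‖x‖ ≤ 1 → ‖(p : ℚ_[p]) * x‖ ≤ 1 := by
    intro x hx
    rw [norm_mul]
    exact mul_le_one₀ hp1.le (norm_nonneg _) hx
  refine Adj.symm ⟨stdLattice p, gZero p • stdLattice p, rfl, rfl, ?_, ?_⟩
  · rw [SetLike.lt_iff_le_and_exists]
    constructor
    · intro w hw
      obtain ⟨v, hv, rfl⟩ := (key _ _).1 hw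
      refine (key _ _).2 ⟨![v 1, p * v 0], ?_, ?_⟩
      · intro i
        fin_cases i
        · exact hv 1
        · exact hle _ (hv 0)
      · ext i
        fin_cases i <;>
          simp [gZero, scalarGL, mul_comm]
    · refine ⟨![1, 0], (key _ _).2 ⟨![0, 1], ?_, ?_⟩, ?_⟩
      · intro i
        fin_cases i <;> simp
      · ext i
        fin_cases i <;> simp [gZero]
      · intro h
        obtain ⟨v, hv, h⟩ := (key _ _).1 h
        refine hlt _ (hv 0) ?_
        have := congrFun h 0
        simpa [scalarGL] using this
  · rw [SetLike.lt_iff_le_and_exists]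
    constructor
    · intro w hw
      obtain ⟨v, hv, rfl⟩ := (key _ _).1 hw
      refine mem_stdLattice.2 fun i => ?_
      fin_cases i
      · simpa [gZero, Matrix.vecHead, Matrix.vecTail] using hv 1
      · simpa [gZero, Matrix.vecHead, Matrix.vecTail] using hle _ (hv 0)
    · refine ⟨![0, 1], mem_stdLattice.2 fun i => ?_, fun h => ?_⟩
      · fin_cases i <;> simp
      · obtain ⟨v, hv, h⟩ := (key _ _).1 h
        refine hlt _ (hv 0) ?_
        have := congrFun h 1
        simpa [gZero, Matrix.vecHead, Matrix.vecTail] using this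

/-- The standard edge `e₀` with source `v₁ = g₀ v₀` and target `v₀ = [ℤ_p²]`. -/
noncomputable def stdEdge (p : ℕ) [Fact p.Prime] : Edge p := ⟨_, _, adj_std⟩



/-! ### Quaternion algebras, Eichler orders and the group `Γ` -/

section Quaternion

open scoped TensorProduct

/-- `B` is a definite quaternion algebra over `ℚ`: central simple of dimension `4` with
`ℝ ⊗ B` isomorphic to Hamilton's quaternions. -/
structure IsDefiniteQuaternionAlgebra (B : Type*) [Ring B] [Algebra ℚ B] : Prop where
  central : Algebra.IsCentral ℚ B
  simple : IsSimpleRing B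
  finrank_eq : Module.finrank ℚ B = 4
  definite : Nonempty ((ℝ ⊗[ℚ] B) ≃ₐ[ℝ] Quaternion ℝ)

/-- The quaternion algebra `B` splits at the prime `ℓ`. -/
def SplitsAt (B : Type*) [Ring B] [Algebra ℚ B] (l : ℕ) [Fact l.Prime] : Prop :=
  Nonempty ((ℚ_[l] ⊗[ℚ] B) ≃ₐ[ℚ_[l]] Matrix (Fin 2) (Fin 2) ℚ_[l])

/-- `N` is the discriminant of `B`, i.e. the product of the primes at which `B` does not split. -/
def HasDiscriminant (B : Type*) [Ring B] [Algebra ℚ B] (N : ℕ) : Prop :=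
  Squarefree N ∧ ∀ (l : ℕ) [Fact l.Prime], l ∣ N ↔ ¬ SplitsAt B l

/-- A `ℤ`-order of `B`: a subring that is a `ℤ`-lattice. -/
def IsOrder {B : Type*} [Ring B] [Algebra ℚ B] (R : Subring B) : Prop :=
  R.toAddSubgroup.FG ∧ Submodule.span ℚ (R : Set B) = ⊤

/-- A maximal `ℤ`-order of `B`. -/
def IsMaxOrder {B : Type*} [Ring B] [Algebra ℚ B] (R : Subring B) : Prop :=
  IsOrder R ∧ ∀ R' : Subring B, IsOrder R' → R ≤ R' → R' = R

/-- An Eichler order of level `N`: the intersection of two maximal orders, of index `N` in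
them. -/
def IsEichlerOrder {B : Type*} [Ring B] [Algebra ℚ B] (R : Subring B) (N : ℕ) : Prop :=
  ∃ O₁ O₂ : Subring B, IsMaxOrder O₁ ∧ IsMaxOrder O₂ ∧ R = O₁ ⊓ O₂ ∧
    R.toAddSubgroup.relIndex O₁.toAddSubgroup = N ∧
    R.toAddSubgroup.relIndex O₂.toAddSubgroup = N

/-- The ring `R[1/p]`. -/
noncomputable def invertP (p : ℕ) {B : Type*} [Ring B] [Algebra ℚ B] (R : Subring B) : Subring B :=
  R ⊔ Subring.closure {algebraMap ℚ B (p : ℚ)⁻¹}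

/-- The map `B → B_p ≃ M₂(ℚ_p)` given by a splitting of `B` at `p`. -/
noncomputable def splitMap {p : ℕ} [Fact p.Prime] {B : Type*} [Ring B] [Algebra ℚ B]
    (ι : (ℚ_[p] ⊗[ℚ] B) ≃ₐ[ℚ_[p]] Matrix (Fin 2) (Fin 2) ℚ_[p]) :
    B →+* Matrix (Fin 2) (Fin 2) ℚ_[p] :=
  (ι : (ℚ_[p] ⊗[ℚ] B) →+* Matrix (Fin 2) (Fin 2) ℚ_[p]).comp
    ((Algebra.TensorProduct.includeRight : B →ₐ[ℚ] (ℚ_[p] ⊗[ℚ] B)) : B →+* (ℚ_[p] ⊗[ℚ] B))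

/-- The splitting `ι` satisfies `ι(R_p) = M₂(ℤ_p)`, where `R_p = ℤ_p R ⊆ B_p`. -/
def IsIntegralSplitting {p : ℕ} [Fact p.Prime] {B : Type*} [Ring B] [Algebra ℚ B] (R : Subring B)
    (ι : (ℚ_[p] ⊗[ℚ] B) ≃ₐ[ℚ_[p]] Matrix (Fin 2) (Fin 2) ℚ_[p]) : Prop :=
  ∀ M : Matrix (Fin 2) (Fin 2) ℚ_[p],
    M ∈ Submodule.span ℤ_[p] (splitMap ι '' (R : Set B)) ↔ ∀ i j, ‖M i j‖ ≤ 1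

/-- The group `Γ = R[1/p]^×_1` of units of reduced norm `1`, viewed in `GL₂(ℚ_p)` through `ι`;
the reduced norm of `b` is `det (ι b)`. -/
noncomputable def arithGroup {p : ℕ} [Fact p.Prime] {B : Type*} [Ring B] [Algebra ℚ B]
    (R : Subring B) (ι : (ℚ_[p] ⊗[ℚ] B) ≃ₐ[ℚ_[p]] Matrix (Fin 2) (Fin 2) ℚ_[p]) :
    Subgroup (GL2 p) :=
  (Units.map ((splitMap ι).comp (invertP p R).subtype).toMonoidHom).range ⊓
    (Matrix.GeneralLinearGroup.det : GL2 p →* ℚ_[p]ˣ).ker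

end Quaternion

/-! ### The coefficient module `V_k` and harmonic cocycles -/

section Poly

variable (p) (k : ℕ)

/-- The space `P_k` of polynomials of degree at most `k`. -/
abbrev PolyLE : Type := Polynomial.degreeLE ℚ_[p] (k : WithBot ℕ)

/-- The dual `V_k` of `P_k`. -/
abbrev Vk : Type := Module.Dual ℚ_[p] (PolyLE p k)

variable {p}

theorem natDegree_homog_le (a b c d : ℚ_[p]) (i : ℕ) (hi : i ≤ k) :
    ((Polynomial.C a * Polynomial.X + Polynomial.C b) ^ i *
      (Polynomial.C c * Polynomial.X + Polynomial.C d) ^ (k - i)).degree ≤ (k : WithBot ℕ) := by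
  refine Polynomial.degree_le_of_natDegree_le ?_
  calc _ ≤ i * 1 + (k - i) * 1 := Polynomial.natDegree_mul_le_of_le
            (Polynomial.natDegree_pow_le_of_le _ Polynomial.natDegree_linear_le)
            (Polynomial.natDegree_pow_le_of_le _ Polynomial.natDegree_linear_le)
    _ = k := by omega

/-- The right action on `P_k`: for `g = (a b; c d)`,
`(P ·ₖ g)(x) = det(g)^{-k/2} (cx + d)^k P((ax + b)/(cx + d))
  = det(g)^{-k/2} ∑ᵢ Pᵢ (ax + b)^i (cx + d)^{k - i}`. -/
noncomputable def polySlash (g : GL2 p) : PolyLE p k →ₗ[ℚ_[p]] PolyLE p k where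
  toFun P := ⟨(g.1.det ^ (k / 2))⁻¹ •
      ∑ i ∈ Finset.range (k + 1), (P : ℚ_[p][X]).coeff i •
        ((Polynomial.C (g 0 0) * Polynomial.X + Polynomial.C (g 0 1)) ^ i *
          (Polynomial.C (g 1 0) * Polynomial.X + Polynomial.C (g 1 1)) ^ (k - i)),
    Submodule.smul_mem _ _ (Submodule.sum_mem _ fun i hi => Submodule.smul_mem _ _
      (Polynomial.mem_degreeLE.2 (natDegree_homog_le k _ _ _ _ i
        (Nat.lt_succ_iff.1 (Finset.mem_range.1 hi)))))⟩
  map_add' P Q := by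
    ext1
    simp [add_smul, Finset.sum_add_distrib]
  map_smul' r P := by
    ext1
    simp [mul_smul, Finset.smul_sum, smul_comm r]

/-- The left action of `GL₂(ℚ_p)` on `V_k`. -/
noncomputable def vkLeft (g : GL2 p) (l : Vk p k) : Vk p k := l.comp (polySlash k g)

/-- The right action of `GL₂(ℚ_p)` on `V_k`, dual to the left action `g ·ₖ P = P ·ₖ g⁻¹` on `P_k`. -/
noncomputable def vkRight (l : Vk p k) (g : GL2 p) : Vk p k := l.comp (polySlash k g⁻¹)

/-- The monomial `x^i` in `P_k`, for `i ≤ k`. -/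
noncomputable def monoLE (i : Fin (k + 1)) : PolyLE p k :=
  ⟨Polynomial.X ^ (i : ℕ), Polynomial.mem_degreeLE.2 ((Polynomial.degree_X_pow_le _).trans
    (by exact_mod_cast Nat.lt_succ_iff.1 i.2))⟩

/-- `Γ`-invariant `V_k`-valued harmonic cocycles on the tree, i.e. elements of `C_h(Γ, V_k)`. -/
structure IsHarmonicCocycle (Γ : Subgroup (GL2 p)) (c : Edge p → Vk p k) : Prop where
  opp : ∀ e, c e.opp = - c e
  harmonic : ∀ v : Vertex p, ∑ᶠ (e : Edge p) (_ : e.source = v), c e = 0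
  invariant : ∀ γ ∈ Γ, ∀ e, c (γ • e) = vkLeft k γ (c e)

end Poly

/-! ### The Tate algebra and rigid analytic distributions -/

section Tate

variable (p)

/-- The Tate algebra in one variable over `ℚ_p`: power series `∑ aₙ xⁿ` with `aₙ → 0`, given by
their coefficient sequences, with the norm `sup |aₙ|`. -/
abbrev Tate : Type := ZeroAtInftyContinuousMap ℕ ℚ_[p]

variable {p}

/-- A sequence tending to zero as an element of the Tate algebra. -/
noncomputable def tateMk (a : ℕ → ℚ_[p]) (ha : Tendsto a atTop (𝓝 0)) : Tate p where
  toFun := a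
  continuous_toFun := continuous_of_discreteTopology
  zero_at_infty' := by rwa [cocompact_eq_cofinite, Nat.cofinite_eq_atTop]

theorem tate_tendsto (f : Tate p) : Tendsto (fun n => f n) atTop (𝓝 0) := by
  have := f.zero_at_infty'
  rwa [cocompact_eq_cofinite, Nat.cofinite_eq_atTop] at this

theorem tate_norm_le (f : Tate p) (n : ℕ) : ‖f n‖ ≤ ‖f‖ := by
  simpa using f.toBCF.norm_coe_le_norm n

/-- The inclusion of polynomials into the Tate algebra. -/
noncomputable def polyToTate : ℚ_[p][X] →ₗ[ℚ_[p]] Tate p where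
  toFun P := tateMk P.coeff (tendsto_const_nhds.congr' (by
    filter_upwards [eventually_gt_atTop P.natDegree] with n hn
    exact (Polynomial.coeff_eq_zero_of_natDegree_lt hn).symm))
  map_add' P Q := by ext n; simp [tateMk]
  map_smul' r P := by ext n; simp [tateMk]

/-- The monomial `x^i` in the Tate algebra. -/
noncomputable def tateX (i : ℕ) : Tate p := polyToTate (Polynomial.X ^ i)

/-- The value at `x` (`|x| ≤ 1`) of an element of the Tate algebra. -/
noncomputable def tateEval (f : Tate p) (x : ℚ_[p]) : ℚ_[p] := ∑' n, f n * x ^ n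

variable (p) in
/-- The monoid `Σ₀(p)`. -/
def sigmaZero : Set (GL2 p) :=
  {σ | (∀ i j, ‖σ i j‖ ≤ 1) ∧ ‖σ 1 0‖ < 1 ∧ ‖σ 0 0‖ = 1}

variable (p) in
/-- The monoid `ℚ_p^× Σ₀(p)`. -/
def scaledSigmaZero : Set (GL2 p) :=
  {τ | ∃ u : ℚ_[p]ˣ, ∃ σ ∈ sigmaZero p, τ = scalarGL u * σ}

variable (p) in
/-- The group `Γ₀(pℤ_p)`, viewed in `GL₂(ℚ_p)`. -/
def gammaZero : Set (GL2 p) :=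
  {σ | (∀ i j, ‖σ i j‖ ≤ 1) ∧ ‖σ.1.det‖ = 1 ∧ ‖σ 1 0‖ < 1}

theorem gammaZero_subset : gammaZero p ⊆ scaledSigmaZero p := by
  rintro σ ⟨h1, h2, h3⟩
  refine ⟨1, σ, ⟨h1, h3, le_antisymm (h1 _ _) ?_⟩, by simp [scalarGL]⟩
  by_contra! h
  rw [Matrix.det_fin_two] at h2
  have ha : ‖σ 0 0 * σ 1 1‖ < 1 := by
    rw [norm_mul]
    exact mul_lt_one_of_nonneg_of_lt_one_left (norm_nonneg _) h (h1 _ _)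
  have hb : ‖σ 0 1 * σ 1 0‖ < 1 := by
    rw [norm_mul]
    exact mul_lt_one_of_nonneg_of_lt_one_right (h1 _ _) (norm_nonneg _) h3
  have h4 := IsUltrametricDist.norm_add_le_max (σ 0 0 * σ 1 1) (-(σ 0 1 * σ 1 0))
  rw [norm_neg, ← sub_eq_add_neg] at h4
  exact (h4.trans_lt (max_lt ha hb)).ne h2

theorem scalarGL_mul_apply (u : ℚ_[p]ˣ) (σ : GL2 p) (i j : Fin 2) :
    (scalarGL u * σ) i j = u * σ i j := by
  simp [scalarGL, Matrix.scalar_apply]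

theorem alpha_inv_mem (j : ℕ) : (alpha p j)⁻¹ ∈ scaledSigmaZero p := by
  have hp0 : (p : ℚ_[p]) ≠ 0 := by exact_mod_cast (Fact.out : p.Prime).ne_zero
  have hj : ‖(j : ℚ_[p])‖ ≤ 1 := by exact_mod_cast Padic.norm_int_le_one (p := p) j
  refine ⟨(Units.mk0 (p : ℚ_[p]) hp0)⁻¹,
    Matrix.GeneralLinearGroup.mkOfDetNeZero !![1, -(j : ℚ_[p]); 0, (p : ℚ_[p])]
    (by simpa using hp0), ⟨?_, ?_, ?_⟩, ?_⟩
  · intro i j'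
    fin_cases i <;> fin_cases j' <;> simp [hj]
    exact inv_le_one_of_one_le₀ (by exact_mod_cast (Fact.out : p.Prime).one_lt.le)
  · simp
  · simp
  · rw [inv_eq_iff_mul_eq_one]
    ext i j'
    rw [Matrix.GeneralLinearGroup.coe_mul, Matrix.mul_apply, Fin.sum_univ_two]
    simp only [scalarGL_mul_apply]
    fin_cases i <;> fin_cases j' <;> simp [alpha, hp0]

/-- Power series with coefficients in `ℤ_p` tending to zero. -/
def IntRes (φ : PowerSeries ℚ_[p]) : Prop :=
  (∀ m, ‖PowerSeries.coeff m φ‖ ≤ 1) ∧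
    Tendsto (fun m => PowerSeries.coeff m φ) atTop (𝓝 0)

theorem intRes_iff (φ : PowerSeries ℚ_[p]) : IntRes φ ↔
    (∀ m, ‖PowerSeries.coeff m φ‖ ≤ 1) ∧ PowerSeries.IsRestricted 1 φ := by
  rw [IntRes, PowerSeries.isRestricted_iff']
  simp [tendsto_zero_iff_norm_tendsto_zero (f := fun m => PowerSeries.coeff m φ)]

theorem IntRes.mul {φ ψ : PowerSeries ℚ_[p]} (hφ : IntRes φ) (hψ : IntRes ψ) :
    IntRes (φ * ψ) := by
  rw [intRes_iff] at *
  refine ⟨fun m => ?_, PowerSeries.isRestricted.mul 1 hφ.2 hψ.2⟩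
  rw [PowerSeries.coeff_mul]
  refine IsUltrametricDist.norm_sum_le_of_forall_le_of_nonneg zero_le_one fun x _ => ?_
  rw [norm_mul]
  exact mul_le_one₀ (hφ.1 _) (norm_nonneg _) (hψ.1 _)

theorem IntRes.pow {φ : PowerSeries ℚ_[p]} (hφ : IntRes φ) (n : ℕ) : IntRes (φ ^ n) := by
  induction n with
  | zero =>
    rw [pow_zero, intRes_iff]
    refine ⟨fun m => ?_, PowerSeries.isRestricted_one 1⟩
    rw [PowerSeries.coeff_one]
    split_ifs <;> simp
  | succ n ih => rw [pow_succ]; exact ih.mul hφ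

theorem intRes_linear {a b : ℚ_[p]} (ha : ‖a‖ ≤ 1) (hb : ‖b‖ ≤ 1) :
    IntRes (PowerSeries.C a * PowerSeries.X + PowerSeries.C b) := by
  constructor
  · intro m
    rcases m with _ | m
    · simpa using hb
    · rcases m with _ | m
      · simpa using ha
      · simp
  · refine tendsto_const_nhds.congr' ?_
    filter_upwards [eventually_gt_atTop 1] with m hm
    obtain ⟨m, rfl⟩ := Nat.exists_eq_add_of_lt hm
    simp [PowerSeries.coeff_C]

theorem intRes_geom {c : ℚ_[p]} (hc : ‖c‖ < 1) : IntRes (1 - PowerSeries.C c * PowerSeries.X)⁻¹ := by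
  have h : (1 - PowerSeries.C c * PowerSeries.X)⁻¹ = PowerSeries.mk fun m => c ^ m := by
    rw [PowerSeries.inv_eq_iff_mul_eq_one (by simp)]
    ext m
    rcases m with _ | m
    · simp [mul_sub]
    · rw [mul_sub, mul_one, ← mul_assoc, map_sub, PowerSeries.coeff_succ_mul_X]
      simp [PowerSeries.coeff_one, pow_succ]
  rw [h]
  constructor
  · intro m
    rw [PowerSeries.coeff_mk, norm_pow]
    exact pow_le_one₀ (norm_nonneg _) hc.le
  · simpa using tendsto_pow_atTop_nhds_zero_of_norm_lt_one hc

/-- For `τ = (a b; c d)`, the power series expansion of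
`τ ·ₖ xⁿ = det(τ)^{-k/2} (-cx + a)^k ((dx - b)/(-cx + a))^n`. -/
noncomputable def actMono (k : ℕ) (τ : GL2 p) (n : ℕ) : PowerSeries ℚ_[p] :=
  PowerSeries.C ((τ.1.det ^ (k / 2))⁻¹) *
    (PowerSeries.C (τ 0 0) - PowerSeries.C (τ 1 0) * PowerSeries.X) ^ k *
    ((PowerSeries.C (τ 1 1) * PowerSeries.X - PowerSeries.C (τ 0 1)) *
      (PowerSeries.C (τ 0 0) - PowerSeries.C (τ 1 0) * PowerSeries.X)⁻¹) ^ n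

theorem actMono_eq (k : ℕ) {τ : GL2 p} (hτ : τ ∈ scaledSigmaZero p) :
    ∃ r : ℚ_[p], ∀ n, ∃ φ : PowerSeries ℚ_[p], IntRes φ ∧ actMono k τ n = PowerSeries.C r * φ := by
  obtain ⟨u, σ, ⟨h1, h2, h3⟩, rfl⟩ := hτ
  set a := (scalarGL u * σ) 0 0 with ha
  have hσ : σ 0 0 ≠ 0 := fun h => by simp [h] at h3
  have ha0 : a ≠ 0 := by
    rw [ha, scalarGL_mul_apply]
    exact mul_ne_zero u.ne_zero hσ
  have hq : ∀ i j, (scalarGL u * σ) i j = a * (σ i j / σ 0 0) := by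
    intro i j
    rw [ha, scalarGL_mul_apply, scalarGL_mul_apply]
    field_simp
  have hn : ∀ i j, ‖σ i j / σ 0 0‖ = ‖σ i j‖ := by
    intro i j
    rw [norm_div, h3, div_one]
  refine ⟨((scalarGL u * σ).1.det ^ (k / 2))⁻¹ * a ^ k, fun n => ?_⟩
  set c' := σ 1 0 / σ 0 0 with hc'
  have e1 : PowerSeries.C a - PowerSeries.C ((scalarGL u * σ) 1 0) * PowerSeries.X
      = PowerSeries.C a * (1 - PowerSeries.C c' * PowerSeries.X) := by
    rw [hq 1 0, map_mul]
    ring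
  have e2 : PowerSeries.C ((scalarGL u * σ) 1 1) * PowerSeries.X
        - PowerSeries.C ((scalarGL u * σ) 0 1)
      = PowerSeries.C a * (PowerSeries.C (σ 1 1 / σ 0 0) * PowerSeries.X
        + PowerSeries.C (-(σ 0 1 / σ 0 0))) := by
    rw [hq 1 1, hq 0 1, map_mul, map_mul, map_neg]
    ring
  refine ⟨(PowerSeries.C (-c') * PowerSeries.X + PowerSeries.C 1) ^ k *
    ((PowerSeries.C (σ 1 1 / σ 0 0) * PowerSeries.X + PowerSeries.C (-(σ 0 1 / σ 0 0))) *
      (1 - PowerSeries.C c' * PowerSeries.X)⁻¹) ^ n, ?_, ?_⟩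
  · refine ((intRes_linear ?_ ?_).pow k).mul
      (((intRes_linear ?_ ?_).mul (intRes_geom ?_)).pow n)
    · rw [norm_neg, hn]; exact h1 _ _
    · simp
    · rw [hn]; exact h1 _ _
    · rw [norm_neg, hn]; exact h1 _ _
    · rw [hn]; exact h2
  · have e3 : PowerSeries.C a * (PowerSeries.C a)⁻¹ = 1 := by
      rw [PowerSeries.mul_inv_cancel _ (by simpa using ha0)]
    have e5 : 1 - PowerSeries.C c' * PowerSeries.X
        = PowerSeries.C (-c') * PowerSeries.X + PowerSeries.C 1 := by
      rw [map_neg, map_one]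
      ring
    rw [actMono, ← ha, e1, e2, PowerSeries.mul_inv_rev, map_mul, map_pow, ← e5]
    have e4 : ∀ L G : PowerSeries ℚ_[p],
        PowerSeries.C a * L * (G * (PowerSeries.C a)⁻¹) = L * G := fun L G => by
      linear_combination (L * G) * e3
    rw [e4, mul_pow]
    ring

theorem actMono_bound (k : ℕ) {τ : GL2 p} (hτ : τ ∈ scaledSigmaZero p) :
    ∃ C : ℝ, 0 ≤ C ∧ (∀ n m, ‖PowerSeries.coeff m (actMono k τ n)‖ ≤ C) ∧
      ∀ n, Tendsto (fun m => PowerSeries.coeff m (actMono k τ n)) atTop (𝓝 0) := by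
  obtain ⟨r, hr⟩ := actMono_eq k hτ
  refine ⟨‖r‖, norm_nonneg _, fun n m => ?_, fun n => ?_⟩
  · obtain ⟨φ, h1, h2⟩ := hr n
    rw [h2, PowerSeries.coeff_C_mul, norm_mul]
    exact mul_le_of_le_one_right (norm_nonneg _) (h1.1 m)
  · obtain ⟨φ, h1, h2⟩ := hr n
    simp only [h2, PowerSeries.coeff_C_mul]
    simpa using h1.2.const_mul r

theorem actSum_summable (k : ℕ) {τ : GL2 p} (hτ : τ ∈ scaledSigmaZero p) (f : Tate p) (m : ℕ) :
    Summable fun n => f n * PowerSeries.coeff m (actMono k τ n) := by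
  obtain ⟨C, hC, h1, -⟩ := actMono_bound k hτ
  refine NonarchimedeanAddGroup.summable_of_tendsto_cofinite_zero ?_
  rw [Nat.cofinite_eq_atTop]
  refine squeeze_zero_norm (a := fun n => ‖f n‖ * C) (fun n => ?_) ?_
  · rw [norm_mul]
    exact mul_le_mul_of_nonneg_left (h1 _ _) (norm_nonneg _)
  · simpa using (tate_tendsto f).norm.mul_const C

theorem actSum_tendsto (k : ℕ) {τ : GL2 p} (hτ : τ ∈ scaledSigmaZero p) (f : Tate p) :
    Tendsto (fun m => ∑' n, f n * PowerSeries.coeff m (actMono k τ n)) atTop (𝓝 0) := by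
  obtain ⟨C, hC, h1, h2⟩ := actMono_bound k hτ
  rw [Metric.tendsto_atTop]
  intro ε hε
  have h3 : Tendsto (fun n => ‖f n‖ * C) atTop (𝓝 0) := by
    simpa using (tate_tendsto f).norm.mul_const C
  obtain ⟨N, hN⟩ := Filter.eventually_atTop.1 (h3.eventually (gt_mem_nhds (half_pos hε)))
  have h4 : ∀ n ∈ Finset.range N, ∀ᶠ m in atTop,
      ‖f n * PowerSeries.coeff m (actMono k τ n)‖ < ε / 2 := by
    intro n _
    have h5 : Tendsto (fun m => ‖f n * PowerSeries.coeff m (actMono k τ n)‖) atTop (𝓝 0) := by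
      simpa using ((h2 n).const_mul (f n)).norm
    exact h5.eventually (gt_mem_nhds (half_pos hε))
  obtain ⟨M, hM⟩ := Filter.eventually_atTop.1 ((Finset.eventually_all _).2 h4)
  refine ⟨M, fun m hm => ?_⟩
  rw [dist_zero_right]
  refine lt_of_le_of_lt (IsUltrametricDist.norm_tsum_le_of_forall_le_of_nonneg (half_pos hε).le
    fun n => ?_) (half_lt_self hε)
  by_cases hn : n < N
  · exact (hM m hm n (Finset.mem_range.2 hn)).le
  · rw [norm_mul]
    exact (mul_le_mul_of_nonneg_left (h1 _ _) (norm_nonneg _)).trans (hN n (not_lt.1 hn)).le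

/-- The continuous left action of `ℚ_p^× Σ₀(p)` on the Tate algebra: for `τ = u (a b; c d)`,
`(τ ·ₖ f)(x) = det^{-k/2} (-cx + a)^k f((dx - b)/(-cx + a))`, i.e. `τ ·ₖ ∑ aₙ xⁿ = ∑ aₙ (τ ·ₖ xⁿ)`.
As `k` is even, the right hand side does not change when `τ` is multiplied by a scalar. -/
noncomputable def tateAct (k : ℕ) (τ : scaledSigmaZero p) : Tate p →L[ℚ_[p]] Tate p :=
  LinearMap.mkContinuousOfExistsBound
    { toFun := fun f => tateMk (fun m => ∑' n, f n * PowerSeries.coeff m (actMono k τ.1 n))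
        (actSum_tendsto k τ.2 f)
      map_add' := fun f g => by
        ext m
        simp only [tateMk, ZeroAtInftyContinuousMap.coe_mk,
          ZeroAtInftyContinuousMap.add_apply, add_mul]
        exact (actSum_summable k τ.2 f m).tsum_add (actSum_summable k τ.2 g m)
      map_smul' := fun r f => by
        ext m
        simp only [tateMk, ZeroAtInftyContinuousMap.coe_mk,
          ZeroAtInftyContinuousMap.smul_apply, smul_eq_mul, mul_assoc, RingHom.id_apply]
        exact tsum_mul_left }
    (by
      obtain ⟨C, hC, h1, -⟩ := actMono_bound k τ.2
      refine ⟨C, fun f => ?_⟩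
      rw [← ZeroAtInftyContinuousMap.norm_toBCF_eq_norm]
      refine (BoundedContinuousFunction.norm_le (by positivity)).2 fun m => ?_
      refine IsUltrametricDist.norm_tsum_le_of_forall_le_of_nonneg (by positivity) fun n => ?_
      rw [norm_mul, mul_comm]
      exact mul_le_mul (h1 _ _) (tate_norm_le f n) (norm_nonneg _) hC)

variable (p) in
/-- The space `D_k` of rigid analytic distributions: the continuous dual of the Tate algebra. -/
abbrev Dist : Type := Tate p →L[ℚ_[p]] ℚ_[p]

/-- The right action of `ℚ_p^× Σ₀(p)` on `D_k`, dual to the weight `k` action on the Tate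
algebra. -/
noncomputable def distAct (k : ℕ) (ω : Dist p) (τ : scaledSigmaZero p) : Dist p :=
  ω.comp (tateAct k τ)

/-- The map `π : D_k → V_k`, restriction of distributions to polynomials. -/
noncomputable def distToVk (k : ℕ) (ω : Dist p) : Vk p k :=
  ω.toLinearMap.comp (polyToTate.comp (Polynomial.degreeLE ℚ_[p] (k : WithBot ℕ)).subtype)

end Tate

/-! ### Automorphic forms -/

section Forms

/-- `Φ : GL₂(ℚ_p) → V` is a `Γ`-invariant automorphic form with values in `V`: it is left
`ℚ_p^× Γ`-invariant and right `Γ₀(pℤ_p)`-equivariant for the given right action on `V`. -/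
structure IsAutomorphic (Γ : Subgroup (GL2 p)) {V : Type*} (act : V → gammaZero p → V)
    (Φ : GL2 p → V) : Prop where
  left_inv : ∀ (u : ℚ_[p]ˣ), ∀ γ ∈ Γ, ∀ g, Φ (scalarGL u * γ * g) = Φ g
  right_equiv : ∀ (g : GL2 p) (σ : gammaZero p), Φ (g * σ) = act (Φ g) σ

/-- `x ∈ p^m ℤ_p`. -/
def InPow (m : ℕ) (x : ℚ_[p]) : Prop := ∃ z : ℤ_[p], x = (p : ℚ_[p]) ^ m * z

/-- The lattice `V_k(ℤ_p)`. -/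
def vkInt (k : ℕ) : Set (Vk p k) := {l | ∀ i, InPow 0 (l (monoLE k i))}

/-- The lattice `V_k'(ℤ_p)`. -/
def vkInt' (k : ℕ) : Set (Vk p k) :=
  {l | l ∈ vkInt k ∧ ∀ i : Fin (k + 1), (i : ℕ) ≤ k / 2 → InPow (k / 2 - i) (l (monoLE k i))}

/-- The lattice `D_k(ℤ_p)`. -/
def distInt : Set (Dist p) := {ω | ∀ i, InPow 0 (ω (tateX i))}

/-- The space `𝔸_k(Γ) = 𝔸(Γ, V_k)`. -/
def formsVk (Γ : Subgroup (GL2 p)) (k : ℕ) : Set (GL2 p → Vk p k) :=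
  {φ | IsAutomorphic Γ (fun l σ => vkRight k l σ.1) φ}

/-- The space `𝔸_k'(Γ, ℤ_p) = 𝔸(Γ, V_k'(ℤ_p))`. -/
def formsVkInt' (Γ : Subgroup (GL2 p)) (k : ℕ) : Set (GL2 p → Vk p k) :=
  {φ | φ ∈ formsVk Γ k ∧ ∀ g, φ g ∈ vkInt' k}

/-- The space `𝒜_k(Γ) = 𝔸(Γ, D_k)` of rigid analytic automorphic forms. -/
def forms (Γ : Subgroup (GL2 p)) (k : ℕ) : Set (GL2 p → Dist p) :=
  {Φ | IsAutomorphic Γ (fun ω σ => distAct k ω ⟨σ.1, gammaZero_subset σ.2⟩) Φ}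

/-- The space `𝒜_k(Γ, ℤ_p) = 𝔸(Γ, D_k(ℤ_p))`. -/
def formsInt (Γ : Subgroup (GL2 p)) (k : ℕ) : Set (GL2 p → Dist p) :=
  {Φ | Φ ∈ forms Γ k ∧ ∀ g, Φ g ∈ distInt}

/-- The specialization map `ρ`, induced by `π : D_k → V_k`. -/
noncomputable def specialize (k : ℕ) (Φ : GL2 p → Dist p) : GL2 p → Vk p k :=
  fun g => distToVk k (Φ g)

/-- The space `𝒜_k'(Γ, ℤ_p)` of forms in `𝒜_k(Γ, ℤ_p)` whose specialization lies in
`𝔸_k'(Γ, ℤ_p)`. -/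
def formsInt' (Γ : Subgroup (GL2 p)) (k : ℕ) : Set (GL2 p → Dist p) :=
  {Φ | specialize k Φ ∈ formsVkInt' Γ k ∧ Φ ∈ formsInt Γ k}

/-- The operator `(U_p Φ)(g) = p^{k/2} ∑_{j = 0}^{p - 1} Φ(g α_j) ·ₖ α_j⁻¹`. -/
noncomputable def upOp (k : ℕ) (Φ : GL2 p → Dist p) : GL2 p → Dist p := fun g =>
  (p : ℚ_[p]) ^ (k / 2) •
    ∑ j ∈ Finset.range p, distAct k (Φ (g * alpha p j)) ⟨(alpha p j)⁻¹, alpha_inv_mem j⟩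

/-- The operator `Ũ_p = p^{-k/2} U_p`. -/
noncomputable def upTilde (k : ℕ) (Φ : GL2 p → Dist p) : GL2 p → Dist p :=
  ((p : ℚ_[p]) ^ (k / 2))⁻¹ • upOp k Φ

/-- The automorphic form `φ_c(g) = g⁻¹ ·ₖ c(g e₀)` attached to a cocycle `c`, i.e. the form with
`c(g e₀) = g ·ₖ φ_c(g)`. -/
noncomputable def cocycleForm (k : ℕ) (c : Edge p → Vk p k) : GL2 p → Vk p k :=
  fun g => vkLeft k g⁻¹ (c (g • stdEdge p))

end Forms

/-! ### Locally analytic functions, measures and moments -/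

section Measures

open scoped Classical in
/-- The compact open ball `g ℤ_p` in `ℙ¹(ℚ_p) = ℚ_p ∪ {∞}`; it is the ball `U_e` attached to the
edge `e = g e₀`. -/
noncomputable def ball (g : GL2 p) : Set (OnePoint ℚ_[p]) :=
  (fun x => g • x) '' ((fun z : ℤ_[p] => ((z : ℚ_[p]) : OnePoint ℚ_[p])) '' Set.univ)

/-- The part of a subset of `ℙ¹(ℚ_p)` in `ℚ_p`. -/
def affinePart (U : Set (OnePoint ℚ_[p])) : Set ℚ_[p] := {x | (x : OnePoint ℚ_[p]) ∈ U}

variable (p) in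
/-- The space `A_k^loc` of `ℚ_p`-valued functions on `ℙ¹(ℚ_p)` that are locally analytic except
possibly for a pole of order at most `k` at `∞`. Such a function is given by its restriction to
`ℚ_p`, which determines it; the condition at `∞` is that `x^k f(1/x)` extends to a function that is
analytic at `x = 0`. -/
noncomputable def locAnalytic (k : ℕ) : Submodule ℚ_[p] (ℚ_[p] → ℚ_[p]) where
  carrier := {f | (∀ a, AnalyticAt ℚ_[p] f a) ∧
    ∃ h : ℚ_[p] → ℚ_[p], AnalyticAt ℚ_[p] h 0 ∧ ∀ᶠ x in 𝓝[≠] 0, h x = x ^ k * f x⁻¹}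
  add_mem' := by
    rintro f f' ⟨h1, h, h2, h3⟩ ⟨h1', h', h2', h3'⟩
    refine ⟨fun a => (h1 a).add (h1' a), h + h', h2.add h2', ?_⟩
    filter_upwards [h3, h3'] with x e e'
    simp [e, e', mul_add]
  zero_mem' := ⟨fun a => analyticAt_const, 0, analyticAt_const, by simp⟩
  smul_mem' := by
    rintro r f ⟨h1, h, h2, h3⟩
    refine ⟨fun a => analyticAt_const.mul (h1 a), fun x => r * h x, analyticAt_const.mul h2, ?_⟩
    filter_upwards [h3] with x e
    simp only [e, Pi.smul_apply, smul_eq_mul]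
    ring

open scoped Classical in
/-- `∫_U f dμ = μ(f χ_U)` for a linear functional `μ` on `A_k^loc`, a compact open `U ⊆ ℙ¹(ℚ_p)`
and a function `f` such that `f χ_U` (the extension of `f` by zero outside `U`) lies in
`A_k^loc`. -/
noncomputable def integralOn {k : ℕ} (μ : locAnalytic p k →ₗ[ℚ_[p]] ℚ_[p])
    (U : Set (OnePoint ℚ_[p])) (f : ℚ_[p] → ℚ_[p]) : ℚ_[p] :=
  if h : (affinePart U).indicator f ∈ locAnalytic p k then μ ⟨_, h⟩ else 0

/-- The right action on functions: for `g = (a b; c d)`,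
`(f ·ₖ g)(x) = det(g)^{-k/2} (cx + d)^k f((ax + b)/(cx + d))`. -/
noncomputable def slash (k : ℕ) (f : ℚ_[p] → ℚ_[p]) (g : GL2 p) : ℚ_[p] → ℚ_[p] := fun x =>
  (g.1.det ^ (k / 2))⁻¹ * (g 1 0 * x + g 1 1) ^ k *
    f ((g 0 0 * x + g 0 1) / (g 1 0 * x + g 1 1))

/-- `x ∈ g ℤ_p` if and only if `g⁻¹ x ∈ ℤ_p`. -/
theorem mem_affinePart_ball (g : GL2 p) (x : ℚ_[p]) : x ∈ affinePart (ball g) ↔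
    (g⁻¹ 1 0 * x + g⁻¹ 1 1 ≠ 0 ∧ ‖(g⁻¹ 0 0 * x + g⁻¹ 0 1) / (g⁻¹ 1 0 * x + g⁻¹ 1 1)‖ ≤ 1) := by
  classical
  have h : x ∈ affinePart (ball g) ↔ ∃ z : ℤ_[p], g⁻¹ • (x : OnePoint ℚ_[p]) = ((z : ℚ_[p]) : OnePoint ℚ_[p]) := by
    simp only [affinePart, ball, Set.mem_ofPred_eq, Set.image_univ, Set.mem_image, Set.mem_range,
      exists_exists_eq_and]
    constructor
    · rintro ⟨z, hz⟩
      refine ⟨z, ?_⟩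
      rw [inv_smul_eq_iff]; convert hz.symm
    · rintro ⟨z, hz⟩
      refine ⟨z, ?_⟩
      rw [inv_smul_eq_iff] at hz; convert hz.symm
  rw [h, OnePoint.smul_some_eq_ite]
  split_ifs with h0
  · exact ⟨fun ⟨z, hz⟩ => absurd hz (OnePoint.infty_ne_coe _), fun h => absurd h0 h.1⟩
  · simp only [ne_eq, h0, not_false_iff, true_and, OnePoint.coe_eq_coe]
    constructor
    · rintro ⟨z, hz⟩; rw [hz]; exact z.2
    · intro hz; exact ⟨⟨_, hz⟩, rfl⟩

open scoped Classical in
theorem analyticAt_slash_aux (k : ℕ) (f : ℚ_[p] → ℚ_[p]) (hf : ∀ y, AnalyticAt ℚ_[p] f y) (hf0 : ∀ y, 1 < ‖y‖ → f y = 0)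
    (a b c d : ℚ_[p]) (hd : a * d - b * c ≠ 0) (x0 : ℚ_[p]) :
    AnalyticAt ℚ_[p] (fun x => if c * x + d ≠ 0 then (c * x + d) ^ k * f ((a * x + b) / (c * x + d)) else 0) x0 := by
  have hl : ∀ r s : ℚ_[p], AnalyticAt ℚ_[p] (fun x => r * x + s) x0 := fun r s =>
    (analyticAt_const.mul analyticAt_id).add analyticAt_const
  by_cases h0 : c * x0 + d = 0
  · have hab : a * x0 + b ≠ 0 := by
      intro h
      by_cases hc : c = 0
      · subst hc; simp at h0; subst h0; simp at hd
      · apply hd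
        apply mul_left_cancel₀ hc
        linear_combination (c * a) * h0 - c ^ 2 * h
    refine (analyticAt_const (v := (0:ℚ_[p]))).congr ?_
    have hc1 : Tendsto (fun x => ‖c * x + d‖) (𝓝 x0) (𝓝 0) := by
      have := (hl c d).continuousAt.norm.tendsto
      simpa [h0] using this
    have hc2 : Tendsto (fun x => ‖a * x + b‖) (𝓝 x0) (𝓝 ‖a * x0 + b‖) := (hl a b).continuousAt.norm.tendsto
    filter_upwards [hc1.eventually_lt hc2 (norm_pos_iff.2 hab)] with x hx
    split_ifs with h
    · rw [hf0, mul_zero]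
      rw [norm_div, one_lt_div (norm_pos_iff.2 h)]; exact hx
    · rfl
  · have := ((hl c d).pow k).mul (AnalyticAt.fun_comp (hf _) ((hl a b).div (hl c d) h0))
    refine this.congr ?_
    filter_upwards [(hl c d).continuousAt.eventually_ne h0] with x hx
    simp only [ne_eq, hx, not_false_iff, if_true]; rfl

/-- The function `(x^i ·ₖ g⁻¹) χ_{g ℤ_p}` lies in `A_k^loc`. -/
theorem moment_mem (k i : ℕ) (g : GL2 p) :
    (affinePart (ball g)).indicator (slash k (fun x => x ^ i) g⁻¹) ∈ locAnalytic p k := by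
  classical
  set f : ℚ_[p] → ℚ_[p] := (Metric.closedBall 0 1).indicator fun x => x ^ i with hfdef
  have hf : ∀ y, AnalyticAt ℚ_[p] f y := by
    intro y
    by_cases hy : y ∈ Metric.closedBall (0 : ℚ_[p]) 1
    · refine (analyticAt_id.pow i).congr ?_
      filter_upwards [(IsUltrametricDist.isOpen_closedBall (0:ℚ_[p]) one_ne_zero).mem_nhds hy] with z hz
      simp [hfdef, Set.indicator_of_mem hz]
    · refine (analyticAt_const (v := 0)).congr ?_
      filter_upwards [Metric.isClosed_closedBall.isOpen_compl.mem_nhds hy] with z hz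
      simp [hfdef, Set.indicator_of_notMem hz]
  have hf0 : ∀ y, 1 < ‖y‖ → f y = 0 := by
    intro y hy
    exact Set.indicator_of_notMem (by simpa using hy) _
  have hdet : g⁻¹ 0 0 * g⁻¹ 1 1 - g⁻¹ 0 1 * g⁻¹ 1 0 ≠ 0 := by
    have := (g⁻¹).det_ne_zero
    rwa [Matrix.det_fin_two] at this
  have heq : ∀ x, (affinePart (ball g)).indicator (slash k (fun x => x ^ i) g⁻¹) x
      = ((g⁻¹).1.det ^ (k/2))⁻¹ * (if g⁻¹ 1 0 * x + g⁻¹ 1 1 ≠ 0 then (g⁻¹ 1 0 * x + g⁻¹ 1 1) ^ k *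
        f ((g⁻¹ 0 0 * x + g⁻¹ 0 1) / (g⁻¹ 1 0 * x + g⁻¹ 1 1)) else 0) := by
    intro x
    by_cases hx : x ∈ affinePart (ball g)
    · rw [Set.indicator_of_mem hx]
      obtain ⟨h1, h2⟩ := (mem_affinePart_ball g x).1 hx
      rw [if_pos h1, hfdef, Set.indicator_of_mem (by simpa using h2), slash, mul_assoc]
    · rw [Set.indicator_of_notMem hx]
      rw [mem_affinePart_ball] at hx
      split_ifs with h1
      · rw [hf0, mul_zero, mul_zero]
        by_contra! h
        exact hx ⟨h1, h⟩
      · simp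
  rw [show (affinePart (ball g)).indicator (slash k (fun x => x ^ i) g⁻¹) = _ from funext heq]
  refine ⟨fun a => analyticAt_const.mul (analyticAt_slash_aux k f hf hf0 _ _ _ _ hdet a), _,
    (analyticAt_const (v := ((g⁻¹).1.det ^ (k / 2))⁻¹)).mul
    (analyticAt_slash_aux k f hf hf0 (g⁻¹ 0 1) (g⁻¹ 0 0) (g⁻¹ 1 1) (g⁻¹ 1 0)
      (by intro h; apply hdet; linear_combination -h) 0), ?_⟩
  filter_upwards [self_mem_nhdsWithin] with x hx
  have hx : x ≠ 0 := hx
  have e : ∀ r s : ℚ_[p], r * x⁻¹ + s = (s * x + r) / x := by intro r s; field_simp; ring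
  simp only [e, Pi.mul_apply]
  generalize (g⁻¹).1 0 0 = a, (g⁻¹).1 0 1 = b, (g⁻¹).1 1 0 = c', (g⁻¹).1 1 1 = d,
    ((g⁻¹).1.det ^ (k / 2))⁻¹ = D
  by_cases h : d * x + c' = 0
  · simp only [h, zero_div, ne_eq, not_true_eq_false, if_false, mul_zero]
  · rw [if_pos h, if_pos (div_ne_zero h hx), div_div_div_cancel_right₀ hx, div_pow]
    field_simp
/-- The `i`-th `g`-moment `m(μ, g, i) = ∫_{g ℤ_p} x^i ·ₖ g⁻¹ dμ`. -/
noncomputable def moment {k : ℕ} (μ : locAnalytic p k →ₗ[ℚ_[p]] ℚ_[p]) (g : GL2 p) (i : ℕ) :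
    ℚ_[p] :=
  μ ⟨(affinePart (ball g)).indicator (slash k (fun x => x ^ i) g⁻¹), moment_mem k i g⟩

/-- A measure on `A_k^loc` is a continuous linear functional. Here `A_k^loc` carries its standard
topology, the locally convex inductive limit over the finite coverings of `ℙ¹(ℚ_p)` by balls `g ℤ_p`
of the products of the Banach spaces of functions that are analytic on the balls. Each of these
Banach spaces is the image of the Tate algebra under `f ↦ (f ·ₖ g⁻¹) χ_{g ℤ_p}`, so a linear
functional is continuous if and only if its composition with each of these maps is. -/
def IsMeasure {k : ℕ} (μ : locAnalytic p k →ₗ[ℚ_[p]] ℚ_[p]) : Prop :=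
  ∀ g : GL2 p, Continuous fun f : Tate p =>
    integralOn μ (ball g) (slash k (tateEval f) g⁻¹)

/-- `μ` is the measure `μ_c` on `A_k^loc` attached to the cocycle `c`, i.e. the extension, by the
theorem of Amice-Vélu and Vishik, of the measure on locally polynomial functions
defined by `c`: a measure with `∫_{U_e} P dμ = c(e)(P)` for `P ∈ P_k` that satisfies
the growth conditions by which this extension is characterized. -/
structure IsCocycleMeasure {k : ℕ} (c : Edge p → Vk p k)
    (μ : locAnalytic p k →ₗ[ℚ_[p]] ℚ_[p]) : Prop where
  isMeasure : IsMeasure μ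
  poly : ∀ (g : GL2 p) (P : PolyLE p k),
    integralOn μ (ball g) (fun x => (P : ℚ_[p][X]).eval x) = c (g • stdEdge p) P
  growth : ∃ C : ℝ, 0 ≤ C ∧
    (∀ g : GL2 p, OnePoint.infty ∈ ball g → ((0 : ℚ_[p]) : OnePoint ℚ_[p]) ∉ ball g →
      ∀ n : ℤ, n ≤ k → ‖integralOn μ (ball g) (fun x => x ^ n)‖ ≤
        C * (sSup ((fun z => ‖z⁻¹‖) '' affinePart (ball g))) ^ (-n + (k / 2 : ℕ))) ∧
    (∀ g : GL2 p, OnePoint.infty ∉ ball g → ∀ a ∈ affinePart (ball g), ∀ n : ℕ,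
      ‖integralOn μ (ball g) (fun x => (x - a) ^ n)‖ ≤
        C * Metric.diam (affinePart (ball g)) ^ ((n : ℤ) - (k / 2 : ℕ)))

end Measures

end PadicForms

namespace PadicForms

open Filter Topology

variable {p : ℕ} [Fact p.Prime]

/-! ### The Tate algebra -/

/-! The moments of `μ_c` are the values of an eigenform of `Ũ_p`, and that eigenform is the limit of
the iterates `Ũ_p^n Φ₀`.

The matrix `α_j` acts by `f(x) ↦ p^{-k/2} f(px + j)`, so the coefficient of `x^m` in the image is
bounded by `|p|^{m - k/2}` times the norm of `f`. A distribution that vanishes on polynomials of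
degree at most `k` only sees `m ≥ k + 1`, hence gains at least one factor `p` (`contraction`).
Harmonicity of `c` at the target of `g e₀` says precisely that `Ũ_p` preserves lifts of `φ_c`
(`cocycle_sum`, `specialize_upTilde`), so two lifts differ by such a distribution. The divisibility
condition on the low moments of `Φ₀` keeps `Ũ_p Φ₀` integral. Consecutive iterates therefore differ
by at most `|p|^n`, and `Ũ_p^n Φ₀` converges, with error at most `|p|^n`, to a bounded form `Φ`
fixed by `Ũ_p` (`exists_eigenLift`).

For existence of the measure, a function analytic on `g ℤ_p` is integrated there by applying `Φ(g)`
to its expansion, and any other locally analytic function by cutting `g ℤ_p` into the balls `g α_j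
ℤ_p`. The equation `Ũ_p Φ = Φ` makes the result independent of the subdivision, and equivariance
under `Γ₀(p)` and scalars makes it depend on the ball only. Adding the integrals over a ball and its
complement gives a functional that does not depend on the chosen ball (`ballInt_add_compl`); its
moments are `Φ(g)(x^n)`, and the bound on `Φ` is the growth condition with `C = 1`.

For uniqueness, the distributions `F ↦ ∫_{g ℤ_p} F ·ₖ g⁻¹ dμ` of any candidate `μ` satisfy the same
`Ũ_p` equation, agree with `c` in degrees at most `k`, and are uniformly bounded on suitable
families of balls by the growth conditions. The difference of two candidates is then contracted
arbitrarily often, hence zero (`dist_eq_zero_of_contraction`).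

The congruence follows from the estimate `|p|^n`; it holds modulo `p^n`, which is at least as strong
as the claim because `i ≥ 1`. -/

theorem tate_norm_le_of_forall {f : Tate p} {C : ℝ} (hC : 0 ≤ C) (h : ∀ n, ‖f n‖ ≤ C) :
    ‖f‖ ≤ C := by
  rw [← ZeroAtInftyContinuousMap.norm_toBCF_eq_norm]
  exact (BoundedContinuousFunction.norm_le hC).2 h

theorem polyToTate_apply (P : ℚ_[p][X]) (n : ℕ) : polyToTate P n = P.coeff n := rfl

theorem tateX_apply (i n : ℕ) : (tateX i : Tate p) n = if n = i then 1 else 0 := by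
  rw [tateX, polyToTate_apply, Polynomial.coeff_X_pow]

theorem tate_sum_apply {ι : Type*} (s : Finset ι) (f : ι → Tate p) (n : ℕ) :
    (∑ i ∈ s, f i) n = ∑ i ∈ s, f i n := by
  classical
  induction s using Finset.induction_on with
  | empty => simp
  | insert a s ha ih => simp [Finset.sum_insert ha, ih]

/-- The coefficients tend to zero, so all sufficiently large partial sums miss only coefficients of
small sup norm. This makes the monomials a topological basis, so that continuous maps are controlled
by their values on them. -/
theorem tate_hasSum (f : Tate p) : HasSum (fun n => f n • tateX n) f := by
  rw [HasSum, SummationFilter.unconditional_filter, Metric.tendsto_atTop]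
  intro ε hε
  have h0 : ∀ᶠ n in atTop, ‖f n‖ < ε / 2 := by
    have := (tate_tendsto f).norm
    rw [norm_zero] at this
    exact this.eventually (gt_mem_nhds (half_pos hε))
  obtain ⟨N, hN⟩ := eventually_atTop.1 h0
  refine ⟨Finset.range N, fun s hs => ?_⟩
  rw [dist_eq_norm]
  refine lt_of_le_of_lt (tate_norm_le_of_forall (half_pos hε).le fun n => ?_) (half_lt_self hε)
  rw [ZeroAtInftyContinuousMap.sub_apply, tate_sum_apply]
  simp only [ZeroAtInftyContinuousMap.smul_apply, tateX_apply, smul_eq_mul, mul_ite, mul_one,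
    mul_zero, Finset.sum_ite_eq]
  split_ifs with hn
  · simpa using (half_pos hε).le
  · rw [zero_sub, norm_neg]
    refine (hN n ?_).le
    by_contra! h
    exact hn (hs (Finset.mem_range.2 h))

theorem tate_clm_ext {E : Type*} [AddCommMonoid E] [TopologicalSpace E] [T2Space E]
    [Module ℚ_[p] E] {φ ψ : Tate p →L[ℚ_[p]] E} (h : ∀ n, φ (tateX n) = ψ (tateX n)) : φ = ψ := by
  ext f
  have h1 := (tate_hasSum f).mapL φ
  have h2 := (tate_hasSum f).mapL ψ
  simp only [map_smul, h] at h1 h2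
  exact h1.unique h2

theorem hasSum_norm_le {a : ℕ → ℚ_[p]} {x : ℚ_[p]} (h : HasSum a x) {C : ℝ} (hC : 0 ≤ C)
    (ha : ∀ n, ‖a n‖ ≤ C) : ‖x‖ ≤ C := by
  rw [← h.tsum_eq]
  exact IsUltrametricDist.norm_tsum_le_of_forall_le_of_nonneg hC ha

/-- By the ultrametric inequality the norm of a distribution is the supremum of its moments; all
later estimates are therefore made on monomials only. -/
theorem dist_norm_le_of_tateX {ω : Dist p} {C : ℝ} (h : ∀ n, ‖ω (tateX n)‖ ≤ C) (f : Tate p) :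
    ‖ω f‖ ≤ C * ‖f‖ := by
  have hC : 0 ≤ C := (norm_nonneg _).trans (h 0)
  refine hasSum_norm_le ((tate_hasSum f).mapL ω) (by positivity) fun n => ?_
  rw [map_smul, smul_eq_mul, norm_mul, mul_comm]
  exact mul_le_mul (h n) (tate_norm_le f n) (norm_nonneg _) hC

/-- A distribution that vanishes on polynomials of degree at most `k` only depends on the
coefficients of degree larger than `k`. -/
theorem dist_norm_le_of_tail {ω : Dist p} {C B : ℝ} {k : ℕ} (hω : ∀ n, ‖ω (tateX n)‖ ≤ C)
    (h0 : ∀ n ≤ k, ω (tateX n) = 0) (hB : 0 ≤ B) (f : Tate p) (hf : ∀ n, k < n → ‖f n‖ ≤ B) :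
    ‖ω f‖ ≤ C * B := by
  have hC : 0 ≤ C := (norm_nonneg _).trans (hω 0)
  refine hasSum_norm_le ((tate_hasSum f).mapL ω) (by positivity) fun n => ?_
  rw [map_smul, smul_eq_mul]
  rcases le_or_gt n k with h | h
  · rw [h0 n h]; simpa using by positivity
  · rw [norm_mul, mul_comm]
    exact mul_le_mul (hω n) (hf n h) (norm_nonneg _) hC

theorem tate_norm_tateX (n : ℕ) : ‖(tateX n : Tate p)‖ ≤ 1 := by
  refine tate_norm_le_of_forall zero_le_one fun m => ?_
  rw [tateX_apply]
  split_ifs <;> simp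

/-! ### Evaluation -/

theorem summable_of_tendsto_zero {a : ℕ → ℚ_[p]} (ha : Tendsto a atTop (𝓝 0)) : Summable a :=
  NonarchimedeanAddGroup.summable_of_tendsto_cofinite_zero (by rwa [Nat.cofinite_eq_atTop])

theorem tendsto_mul_pow {a : ℕ → ℚ_[p]} (ha : Tendsto a atTop (𝓝 0)) {x : ℚ_[p]} (hx : ‖x‖ ≤ 1) :
    Tendsto (fun n => a n * x ^ n) atTop (𝓝 0) := by
  refine squeeze_zero_norm (a := fun n => ‖a n‖) (fun n => ?_) (by simpa using ha.norm)
  rw [norm_mul, norm_pow]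
  exact mul_le_of_le_one_right (norm_nonneg _) (pow_le_one₀ (norm_nonneg _) hx)

theorem tateEval_summable (f : Tate p) {x : ℚ_[p]} (hx : ‖x‖ ≤ 1) :
    Summable fun n => f n * x ^ n :=
  summable_of_tendsto_zero (tendsto_mul_pow (tate_tendsto f) hx)

theorem tateEval_norm_le (f : Tate p) {x : ℚ_[p]} (hx : ‖x‖ ≤ 1) : ‖tateEval f x‖ ≤ ‖f‖ := by
  refine IsUltrametricDist.norm_tsum_le_of_forall_le_of_nonneg (norm_nonneg _) fun n => ?_
  rw [norm_mul, norm_pow]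
  exact (mul_le_of_le_one_right (norm_nonneg _) (pow_le_one₀ (norm_nonneg _) hx)).trans
    (tate_norm_le f n)

/-- Evaluation at a point of the closed unit disc. -/
noncomputable def tateEvalL (x : ℚ_[p]) (hx : ‖x‖ ≤ 1) : Dist p :=
  LinearMap.mkContinuous
    { toFun := fun f => tateEval f x
      map_add' := fun f g => by
        simp only [tateEval, ZeroAtInftyContinuousMap.add_apply, add_mul]
        exact (tateEval_summable f hx).tsum_add (tateEval_summable g hx)
      map_smul' := fun r f => by
        simp only [tateEval, ZeroAtInftyContinuousMap.smul_apply, smul_eq_mul, mul_assoc,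
          RingHom.id_apply]
        exact tsum_mul_left } 1
    (fun f => by simpa using tateEval_norm_le f hx)

theorem tateEvalL_apply (x : ℚ_[p]) (hx : ‖x‖ ≤ 1) (f : Tate p) :
    tateEvalL x hx f = tateEval f x := rfl

theorem tateEval_add (f g : Tate p) {x : ℚ_[p]} (hx : ‖x‖ ≤ 1) :
    tateEval (f + g) x = tateEval f x + tateEval g x := map_add (tateEvalL x hx) f g

theorem tateEval_sub (f g : Tate p) {x : ℚ_[p]} (hx : ‖x‖ ≤ 1) :
    tateEval (f - g) x = tateEval f x - tateEval g x := map_sub (tateEvalL x hx) f g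

theorem tateEval_smul (r : ℚ_[p]) (f : Tate p) (x : ℚ_[p]) :
    tateEval (r • f) x = r * tateEval f x := by
  simp only [tateEval, ZeroAtInftyContinuousMap.smul_apply, smul_eq_mul, mul_assoc]
  exact tsum_mul_left

theorem tateEval_zero (x : ℚ_[p]) : tateEval (0 : Tate p) x = 0 := by
  simp [tateEval]

theorem tateEval_polyToTate (P : ℚ_[p][X]) (x : ℚ_[p]) : tateEval (polyToTate P) x = P.eval x := by
  simp only [tateEval, polyToTate_apply]
  rw [Polynomial.eval_eq_sum_range, tsum_eq_sum]
  intro n hn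
  rw [Polynomial.coeff_eq_zero_of_natDegree_lt, zero_mul]
  simpa [Nat.lt_succ_iff] using hn

theorem tateEval_tateX (n : ℕ) (x : ℚ_[p]) : tateEval (tateX n) x = x ^ n := by
  rw [tateX, tateEval_polyToTate]; simp

/-! ### Evaluation of restricted power series -/

/-- Power series whose coefficients tend to zero. -/
def Restr (φ : PowerSeries ℚ_[p]) : Prop :=
  Tendsto (fun m => PowerSeries.coeff m φ) atTop (𝓝 0)

/-- The value of a restricted power series. -/
noncomputable def psEval (x : ℚ_[p]) (φ : PowerSeries ℚ_[p]) : ℚ_[p] :=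
  ∑' m, PowerSeries.coeff m φ * x ^ m

theorem restr_iff (φ : PowerSeries ℚ_[p]) : Restr φ ↔ PowerSeries.IsRestricted 1 φ := by
  rw [Restr, PowerSeries.isRestricted_iff']
  simp [tendsto_zero_iff_norm_tendsto_zero (f := fun m => PowerSeries.coeff m φ)]

theorem Restr.mul {φ ψ : PowerSeries ℚ_[p]} (hφ : Restr φ) (hψ : Restr ψ) : Restr (φ * ψ) := by
  rw [restr_iff] at *
  exact PowerSeries.isRestricted.mul 1 hφ hψ

theorem restr_one : Restr (1 : PowerSeries ℚ_[p]) :=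
  (restr_iff _).2 (PowerSeries.isRestricted_one 1)

theorem restr_C (a : ℚ_[p]) : Restr (PowerSeries.C a) :=
  (restr_iff _).2 (PowerSeries.isRestricted_C 1 a)

theorem Restr.pow {φ : PowerSeries ℚ_[p]} (hφ : Restr φ) (n : ℕ) : Restr (φ ^ n) := by
  induction n with
  | zero => rw [pow_zero]; exact restr_one
  | succ n ih => rw [pow_succ]; exact ih.mul hφ

/-- Cauchy product; over a nonarchimedean field summability of the two factors already gives
summability of the double family. -/
theorem psEval_mul {φ ψ : PowerSeries ℚ_[p]} (hφ : Restr φ) (hψ : Restr ψ) {x : ℚ_[p]}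
    (hx : ‖x‖ ≤ 1) : psEval x (φ * ψ) = psEval x φ * psEval x ψ := by
  set a := fun m => PowerSeries.coeff m φ * x ^ m with ha
  set b := fun m => PowerSeries.coeff m ψ * x ^ m with hb
  have h1 : Summable a := summable_of_tendsto_zero (tendsto_mul_pow hφ hx)
  have h2 : Summable b := summable_of_tendsto_zero (tendsto_mul_pow hψ hx)
  have : NonarchimedeanRing ℚ_[p] :=
    { is_nonarchimedean := NonarchimedeanAddGroup.is_nonarchimedean }
  have h3 : Summable fun ij : ℕ × ℕ => a ij.1 * b ij.2 := h1.mul_of_nonarchimedean h2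
  change ∑' m, PowerSeries.coeff m (φ * ψ) * x ^ m = (∑' m, a m) * ∑' m, b m
  rw [Summable.tsum_mul_tsum_eq_tsum_sum_antidiagonal h1 h2 h3]
  refine tsum_congr fun n => ?_
  rw [PowerSeries.coeff_mul, Finset.sum_mul]
  refine Finset.sum_congr rfl fun ij hij => ?_
  rw [← Finset.HasAntidiagonal.mem_antidiagonal.1 hij, pow_add, ha, hb]
  ring

theorem psEval_C (a x : ℚ_[p]) : psEval x (PowerSeries.C a) = a := by
  rw [psEval, tsum_eq_single 0]
  · simp
  · intro n hn
    simp [PowerSeries.coeff_C, hn]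

theorem psEval_one (x : ℚ_[p]) : psEval x (1 : PowerSeries ℚ_[p]) = 1 := by
  rw [← map_one (PowerSeries.C (R := ℚ_[p])), psEval_C]

theorem psEval_pow {φ : PowerSeries ℚ_[p]} (hφ : Restr φ) {x : ℚ_[p]} (hx : ‖x‖ ≤ 1) (n : ℕ) :
    psEval x (φ ^ n) = psEval x φ ^ n := by
  induction n with
  | zero => simp [psEval_one]
  | succ n ih => rw [pow_succ, psEval_mul (hφ.pow n) hφ hx, ih, pow_succ]

theorem psEval_linear (a b x : ℚ_[p]) :
    psEval x (PowerSeries.C a * PowerSeries.X + PowerSeries.C b) = a * x + b := by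
  rw [psEval, tsum_eq_sum (s := Finset.range 2)]
  · simp [Finset.sum_range_succ]
    ring
  · intro n hn
    obtain ⟨m, rfl⟩ : ∃ m, n = m + 2 := ⟨n - 2, by simp at hn; omega⟩
    simp [PowerSeries.coeff_succ_mul_X]

theorem restr_linear (a b : ℚ_[p]) : Restr (PowerSeries.C a * PowerSeries.X + PowerSeries.C b) := by
  refine tendsto_const_nhds.congr' ?_
  filter_upwards [eventually_gt_atTop 1] with m hm
  obtain ⟨m, rfl⟩ : ∃ l, m = l + 2 := ⟨m - 2, by omega⟩
  simp [PowerSeries.coeff_succ_mul_X]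

/-! ### The slash action -/

theorem p_ne_zero : (p : ℚ_[p]) ≠ 0 := by exact_mod_cast (Fact.out : p.Prime).ne_zero

theorem gl_mul_apply (g h : GL2 p) (i j : Fin 2) :
    (g * h) i j = g i 0 * h 0 j + g i 1 * h 1 j := by
  rw [Matrix.GeneralLinearGroup.coe_mul, Matrix.mul_apply, Fin.sum_univ_two]

theorem gl_det (g : GL2 p) : g.1.det = g 0 0 * g 1 1 - g 0 1 * g 1 0 := Matrix.det_fin_two _

theorem gl_det_ne_zero (g : GL2 p) : g 0 0 * g 1 1 - g 0 1 * g 1 0 ≠ 0 := by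
  rw [← gl_det]; exact g.det_ne_zero

theorem gl_det_mul (g h : GL2 p) : (g * h).1.det = g.1.det * h.1.det := by
  rw [Units.val_mul, Matrix.det_mul]

theorem gl_inv_apply (g : GL2 p) : g⁻¹ 0 0 = g.1.det⁻¹ * g 1 1 ∧ g⁻¹ 0 1 = -(g.1.det⁻¹ * g 0 1) ∧
    g⁻¹ 1 0 = -(g.1.det⁻¹ * g 1 0) ∧ g⁻¹ 1 1 = g.1.det⁻¹ * g 0 0 := by
  rw [Matrix.coe_units_inv, Matrix.inv_def, Matrix.adjugate_fin_two]
  simp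

theorem gl_inv_det (g : GL2 p) : (g⁻¹).1.det = g.1.det⁻¹ := by
  have := gl_det_mul g⁻¹ g
  rw [inv_mul_cancel] at this
  exact eq_inv_of_mul_eq_one_left (by rw [← this]; simp)

/-- Only the denominator of `h` has to be nonzero. The denominator of `g * h` is that of `h` times
that of `g` at the image point, so if it vanishes both sides degenerate in the same way. -/
theorem slash_slash (k : ℕ) (f : ℚ_[p] → ℚ_[p]) (g h : GL2 p) {x : ℚ_[p]}
    (hx : h 1 0 * x + h 1 1 ≠ 0) : slash k (slash k f g) h x = slash k f (g * h) x := by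
  simp only [slash, gl_det_mul, gl_mul_apply]
  set N := h 0 0 * x + h 0 1
  set D := h 1 0 * x + h 1 1
  have e1 : (g 1 0 * h 0 0 + g 1 1 * h 1 0) * x + (g 1 0 * h 0 1 + g 1 1 * h 1 1)
      = D * (g 1 0 * (N / D) + g 1 1) := by
    rw [mul_add, ← mul_assoc, mul_comm D, mul_assoc, mul_div_cancel₀ _ hx]
    ring
  have e2 : (g 0 0 * h 0 0 + g 0 1 * h 1 0) * x + (g 0 0 * h 0 1 + g 0 1 * h 1 1)
      = D * (g 0 0 * (N / D) + g 0 1) := by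
    rw [mul_add, ← mul_assoc, mul_comm D, mul_assoc, mul_div_cancel₀ _ hx]
    ring
  rw [e1, e2, mul_div_mul_left _ _ hx, mul_pow, mul_pow, mul_inv]
  ring

/-- The determinant contributes `u^{-k}` and the automorphy factor `u^k`; the two cancel exactly
because `k` is even. -/
theorem slash_scalar {k : ℕ} (hk : Even k) (f : ℚ_[p] → ℚ_[p]) (u : ℚ_[p]ˣ) (g : GL2 p) :
    slash k f (scalarGL u * g) = slash k f g := by
  funext x
  obtain ⟨l, rfl⟩ := hk
  have hl : (l + l) / 2 = l := by omega
  have hu : (u : ℚ_[p]) ≠ 0 := u.ne_zero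
  have hd : (scalarGL u * g).1.det = u ^ 2 * g.1.det := by
    rw [gl_det, gl_det]
    simp only [scalarGL_mul_apply]
    ring
  simp only [slash, hd, scalarGL_mul_apply, hl]
  have e : ∀ r s : ℚ_[p], u * r * x + u * s = u * (r * x + s) := fun r s => by ring
  rw [e, e, mul_div_mul_left _ _ hu]
  generalize f _ = y
  rw [mul_pow, mul_pow, ← pow_mul, ← two_mul, mul_inv]
  have hu' : (u : ℚ_[p]) ^ (2 * l) ≠ 0 := pow_ne_zero _ hu
  generalize (u : ℚ_[p]) ^ (2 * l) = v at *
  field_simp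

theorem slash_inv {k : ℕ} (hk : Even k) (f : ℚ_[p] → ℚ_[p]) (g : GL2 p) (x : ℚ_[p]) :
    slash k f g⁻¹ x = (g.1.det ^ (k / 2))⁻¹ * (g 0 0 - g 1 0 * x) ^ k *
      f ((g 1 1 * x - g 0 1) / (g 0 0 - g 1 0 * x)) := by
  obtain ⟨l, rfl⟩ := hk
  have hl : (l + l) / 2 = l := by omega
  obtain ⟨h1, h2, h3, h4⟩ := gl_inv_apply g
  have hd : g.1.det ≠ 0 := g.det_ne_zero
  rw [slash, gl_inv_det, h1, h2, h3, h4, hl]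
  set d := g.1.det
  have e1 : -(d⁻¹ * g 1 0) * x + d⁻¹ * g 0 0 = d⁻¹ * (g 0 0 - g 1 0 * x) := by ring
  have e2 : d⁻¹ * g 1 1 * x + -(d⁻¹ * g 0 1) = d⁻¹ * (g 1 1 * x - g 0 1) := by ring
  rw [e1, e2, mul_div_mul_left _ _ (inv_ne_zero hd)]
  generalize f _ = y
  rw [mul_pow, inv_pow, inv_pow, pow_add d]
  field_simp

theorem slash_one (k : ℕ) (f : ℚ_[p] → ℚ_[p]) : slash k f 1 = f := by
  funext x
  simp [slash]

theorem slash_add (k : ℕ) (f f' : ℚ_[p] → ℚ_[p]) (g : GL2 p) :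
    slash k (f + f') g = slash k f g + slash k f' g := by
  funext x
  simp [slash, mul_add]

theorem slash_smul (k : ℕ) (r : ℚ_[p]) (f : ℚ_[p] → ℚ_[p]) (g : GL2 p) :
    slash k (r • f) g = r • slash k f g := by
  funext x
  simp [slash]
  ring

/-! ### The action on the Tate algebra through evaluation -/

/-- Up to the scalar, `a` is a unit and `c` is divisible by `p`, so `a - cx` is a unit for every
integral `x`. Hence the inverse of an element of `Σ₀(p)` maps the closed unit disc to itself without
poles. -/
theorem scaledSigmaZero_denom {τ : GL2 p} (hτ : τ ∈ scaledSigmaZero p) {x : ℚ_[p]} (hx : ‖x‖ ≤ 1) :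
    τ 0 0 - τ 1 0 * x ≠ 0 ∧ ‖(τ 1 1 * x - τ 0 1) / (τ 0 0 - τ 1 0 * x)‖ ≤ 1 := by
  obtain ⟨u, σ, ⟨h1, h2, h3⟩, rfl⟩ := hτ
  simp only [scalarGL_mul_apply]
  have h4 : ‖σ 1 0 * x‖ < 1 := by
    rw [norm_mul]
    exact mul_lt_one_of_nonneg_of_lt_one_left (norm_nonneg _) h2 hx
  have h5 : ‖σ 0 0 - σ 1 0 * x‖ = 1 := by
    rw [sub_eq_add_neg, IsUltrametricDist.norm_add_eq_max_of_norm_ne_norm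
      (by rw [h3, norm_neg]; exact h4.ne'), h3, norm_neg, max_eq_left h4.le]
  have h6 : σ 0 0 - σ 1 0 * x ≠ 0 := by
    intro h; rw [h] at h5; simp at h5
  have hu : (u : ℚ_[p]) ≠ 0 := u.ne_zero
  rw [mul_assoc, mul_assoc, ← mul_sub, ← mul_sub, mul_div_mul_left _ _ hu]
  refine ⟨mul_ne_zero hu h6, ?_⟩
  rw [norm_div, h5, div_one]
  rw [sub_eq_add_neg]
  refine (IsUltrametricDist.norm_add_le_max _ _).trans (max_le ?_ (by rw [norm_neg]; exact h1 _ _))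
  rw [norm_mul]
  exact mul_le_one₀ (h1 _ _) (norm_nonneg _) hx

theorem scaledSigmaZero_norm_lt {τ : GL2 p} (hτ : τ ∈ scaledSigmaZero p) :
    τ 0 0 ≠ 0 ∧ ‖τ 1 0 / τ 0 0‖ < 1 := by
  obtain ⟨u, σ, ⟨h1, h2, h3⟩, rfl⟩ := hτ
  simp only [scalarGL_mul_apply]
  have hu : (u : ℚ_[p]) ≠ 0 := u.ne_zero
  rw [mul_div_mul_left _ _ hu, norm_div, h3, div_one]
  refine ⟨mul_ne_zero hu ?_, h2⟩
  intro h; rw [h] at h3; simp at h3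

theorem restr_geom {a c : ℚ_[p]} (ha : a ≠ 0) (hc : ‖c / a‖ < 1) :
    Restr (PowerSeries.C a - PowerSeries.C c * PowerSeries.X)⁻¹ := by
  have e : PowerSeries.C a - PowerSeries.C c * PowerSeries.X
      = PowerSeries.C a * (1 - PowerSeries.C (c / a) * PowerSeries.X) := by
    rw [mul_sub, ← mul_assoc, ← map_mul, mul_div_cancel₀ _ ha, mul_one]
  have e' : (PowerSeries.C a)⁻¹ = PowerSeries.C a⁻¹ := by
    rw [PowerSeries.inv_eq_iff_mul_eq_one (by simpa using ha), ← map_mul, inv_mul_cancel₀ ha,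
      map_one]
  rw [e, PowerSeries.mul_inv_rev, e']
  exact Restr.mul (intRes_geom hc).2 (restr_C _)

/-- Evaluation is multiplicative on restricted series, and the geometric series converges because
`c/a` has norm less than one; so the formal expansion has the values of the rational function it
comes from. -/
theorem psEval_actMono (k : ℕ) {τ : GL2 p} (hτ : τ ∈ scaledSigmaZero p) (n : ℕ) {x : ℚ_[p]}
    (hx : ‖x‖ ≤ 1) : psEval x (actMono k τ n) = (τ.1.det ^ (k / 2))⁻¹ * (τ 0 0 - τ 1 0 * x) ^ k *
      ((τ 1 1 * x - τ 0 1) / (τ 0 0 - τ 1 0 * x)) ^ n := by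
  obtain ⟨ha, hc⟩ := scaledSigmaZero_norm_lt hτ
  have h0 := (scaledSigmaZero_denom hτ hx).1
  have e1 : PowerSeries.C (τ 0 0) - PowerSeries.C (τ 1 0) * PowerSeries.X
      = PowerSeries.C (-(τ 1 0)) * PowerSeries.X + PowerSeries.C (τ 0 0) := by
    rw [map_neg]; ring
  have e2 : PowerSeries.C (τ 1 1) * PowerSeries.X - PowerSeries.C (τ 0 1)
      = PowerSeries.C (τ 1 1) * PowerSeries.X + PowerSeries.C (-(τ 0 1)) := by
    rw [map_neg]; ring
  have r1 : Restr (PowerSeries.C (τ 0 0) - PowerSeries.C (τ 1 0) * PowerSeries.X) := by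
    rw [e1]; exact restr_linear _ _
  have r2 : Restr (PowerSeries.C (τ 1 1) * PowerSeries.X - PowerSeries.C (τ 0 1)) := by
    rw [e2]; exact restr_linear _ _
  have r3 := restr_geom ha hc
  have v1 : psEval x (PowerSeries.C (τ 0 0) - PowerSeries.C (τ 1 0) * PowerSeries.X)
      = τ 0 0 - τ 1 0 * x := by
    rw [e1, psEval_linear]; ring
  have v2 : psEval x (PowerSeries.C (τ 1 1) * PowerSeries.X - PowerSeries.C (τ 0 1))
      = τ 1 1 * x - τ 0 1 := by
    rw [e2, psEval_linear]; ring
  have v3 : psEval x (PowerSeries.C (τ 0 0) - PowerSeries.C (τ 1 0) * PowerSeries.X)⁻¹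
      = (τ 0 0 - τ 1 0 * x)⁻¹ := by
    refine eq_inv_of_mul_eq_one_left ?_
    rw [← v1, ← psEval_mul r3 r1 hx, PowerSeries.inv_mul_cancel _ (by simpa using ha), psEval_one]
  rw [actMono, psEval_mul ((restr_C _).mul (r1.pow k)) ((r2.mul r3).pow n) hx,
    psEval_mul (restr_C _) (r1.pow k) hx, psEval_pow r1 hx, psEval_pow (r2.mul r3) hx,
    psEval_mul r2 r3 hx, psEval_C, v1, v2, v3, div_eq_mul_inv]

theorem tateAct_apply (k : ℕ) (τ : scaledSigmaZero p) (f : Tate p) (m : ℕ) :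
    tateAct k τ f m = ∑' n, f n * PowerSeries.coeff m (actMono k τ.1 n) := rfl

theorem tateAct_tateX_apply (k : ℕ) (τ : scaledSigmaZero p) (n m : ℕ) :
    tateAct k τ (tateX n) m = PowerSeries.coeff m (actMono k τ.1 n) := by
  rw [tateAct_apply, tsum_eq_single n]
  · simp [tateX_apply]
  · intro i hi
    simp [tateX_apply, hi]

/-- `τ ·ₖ f` is the expansion of the function `f ·ₖ τ⁻¹`. -/
theorem tateEval_tateAct {k : ℕ} (hk : Even k) (τ : scaledSigmaZero p) (f : Tate p) {x : ℚ_[p]}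
    (hx : ‖x‖ ≤ 1) : tateEval (tateAct k τ f) x = slash k (tateEval f) (τ.1)⁻¹ x := by
  obtain ⟨h0, h1⟩ := scaledSigmaZero_denom τ.2 hx
  rw [slash_inv hk]
  have key : (tateEvalL x hx).comp (tateAct k τ) =
      ((τ.1.1.det ^ (k / 2))⁻¹ * (τ.1 0 0 - τ.1 1 0 * x) ^ k) • tateEvalL _ h1 := by
    refine tate_clm_ext fun n => ?_
    have : tateEval (tateAct k τ (tateX n)) x = psEval x (actMono k τ.1 n) := by
      simp only [tateEval, tateAct_tateX_apply, psEval]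
    rw [ContinuousLinearMap.comp_apply, tateEvalL_apply, this, psEval_actMono k τ.2 n hx,
      smul_apply, tateEvalL_apply, tateEval_tateX, smul_eq_mul]
  exact congrArg (fun φ : Dist p => φ f) key

/-! ### Uniqueness and analyticity -/

theorem tate_hasFPowerSeriesAt (f : Tate p) :
    HasFPowerSeriesAt (tateEval f) (FormalMultilinearSeries.ofScalars ℚ_[p] (fun n => f n)) 0 := by
  refine ⟨1, ⟨?_, one_pos, ?_⟩⟩
  · refine FormalMultilinearSeries.le_radius_of_bound (r := 1) _ ‖f‖ fun n => ?_
    rw [FormalMultilinearSeries.ofScalars_norm]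
    simpa using tate_norm_le f n
  · intro y hy
    have hy' : ‖y‖ ≤ 1 := by
      rw [Metric.mem_eball, edist_zero_right] at hy
      rw [← ofReal_norm, ENNReal.ofReal_lt_one] at hy
      exact hy.le
    have := (tateEval_summable f hy').hasSum
    rw [zero_add]
    simp only [FormalMultilinearSeries.ofScalars_apply_eq, smul_eq_mul]
    exact this

/-- The identity theorem: zeros accumulating at the origin force all Taylor coefficients there to
vanish. -/
theorem tate_eq_zero_of_eventually {f : Tate p} (h : ∀ᶠ x in 𝓝[≠] 0, tateEval f x = 0) : f = 0 := by
  have h1 := tate_hasFPowerSeriesAt f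
  have h2 : ∀ᶠ x in 𝓝 (0 : ℚ_[p]), tateEval f x = 0 := by
    have h3 : ∃ᶠ x in 𝓝[≠] (0 : ℚ_[p]), tateEval f x = 0 := h.frequently
    exact h1.analyticAt.frequently_zero_iff_eventually_zero.1 h3
  have h3 := h1.eq_zero_of_eventually h2
  rw [FormalMultilinearSeries.ofScalars_series_eq_zero] at h3
  ext n
  exact congrFun h3 n

theorem eventually_norm_le_one : ∀ᶠ x in 𝓝 (0 : ℚ_[p]), ‖x‖ ≤ 1 := by
  filter_upwards [Metric.closedBall_mem_nhds (0 : ℚ_[p]) one_pos] with x hx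
  simpa using hx

/-- Finitely many exceptional points do not meet a small punctured disc around the origin. This is
what allows poles of Möbius maps to be ignored when expansions are compared. -/
theorem tate_eq_zero_of_finite {f : Tate p} (h : {x | ‖x‖ ≤ 1 ∧ tateEval f x ≠ 0}.Finite) :
    f = 0 := by
  refine tate_eq_zero_of_eventually ?_
  have h1 : ∀ᶠ x in 𝓝[≠] (0 : ℚ_[p]), x ∉ {x | ‖x‖ ≤ 1 ∧ tateEval f x ≠ 0} := by
    have h2 : ({x | ‖x‖ ≤ 1 ∧ tateEval f x ≠ 0} \ {0})ᶜ ∈ 𝓝 (0 : ℚ_[p]) :=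
      (h.subset Set.sdiff_subset).isClosed.isOpen_compl.mem_nhds (by simp)
    rw [eventually_nhdsWithin_iff]
    filter_upwards [h2] with x hx hx0 hx1
    exact hx ⟨hx1, hx0⟩
  filter_upwards [h1, eventually_norm_le_one.filter_mono nhdsWithin_le_nhds] with x h2 h3
  by_contra h4
  exact h2 ⟨h3, h4⟩

/-! ### Affine matrices -/

/-- The matrix `(s t; 0 1)`. -/
noncomputable def aff (s : ℚ_[p]ˣ) (t : ℚ_[p]) : GL2 p :=
  Matrix.GeneralLinearGroup.mkOfDetNeZero !![(s : ℚ_[p]), t; 0, 1] (by simp)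

theorem gl_ext {g h : GL2 p} (h00 : g 0 0 = h 0 0) (h01 : g 0 1 = h 0 1) (h10 : g 1 0 = h 1 0)
    (h11 : g 1 1 = h 1 1) : g = h := by
  ext i j
  fin_cases i <;> fin_cases j <;> assumption

theorem aff_apply (s : ℚ_[p]ˣ) (t : ℚ_[p]) :
    aff s t 0 0 = s ∧ aff s t 0 1 = t ∧ aff s t 1 0 = 0 ∧ aff s t 1 1 = 1 := by
  simp [aff]

theorem aff_mul (s s' : ℚ_[p]ˣ) (t t' : ℚ_[p]) :
    aff s t * aff s' t' = aff (s * s') (s * t' + t) := by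
  apply gl_ext <;> rw [gl_mul_apply] <;> simp [aff_apply]

theorem aff_det (s : ℚ_[p]ˣ) (t : ℚ_[p]) : (aff s t).1.det = s := by
  rw [gl_det]; simp [aff_apply]

variable (p) in
/-- The unit `p` of `ℚ_p`. -/
noncomputable def pU : ℚ_[p]ˣ := Units.mk0 (p : ℚ_[p]) p_ne_zero

theorem pU_val : ((pU p : ℚ_[p]ˣ) : ℚ_[p]) = p := rfl

theorem alpha_eq (j : ℕ) : alpha p j = aff (pU p) j := by
  apply gl_ext <;> simp [alpha, aff, pU]

theorem aff_inv_mem {s : ℚ_[p]ˣ} {t : ℚ_[p]} (hs : ‖(s : ℚ_[p])‖ ≤ 1) (ht : ‖t‖ ≤ 1) :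
    (aff s t)⁻¹ ∈ scaledSigmaZero p := by
  refine ⟨s⁻¹, Matrix.GeneralLinearGroup.mkOfDetNeZero !![1, -t; 0, (s : ℚ_[p])] (by simp),
    ⟨?_, ?_, ?_⟩, ?_⟩
  · intro i j
    fin_cases i <;> fin_cases j <;> simp [hs, ht]
  · simp
  · simp
  · obtain ⟨h1, h2, h3, h4⟩ := gl_inv_apply (aff s t)
    rw [aff_det] at h1 h2 h3 h4
    apply gl_ext <;> simp only [scalarGL_mul_apply, h1, h2, h3, h4] <;> simp [aff_apply]

theorem tateEval_tateAct_aff {k : ℕ} (hk : Even k) {s : ℚ_[p]ˣ} {t : ℚ_[p]}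
    (hs : ‖(s : ℚ_[p])‖ ≤ 1) (ht : ‖t‖ ≤ 1) (f : Tate p) {x : ℚ_[p]} (hx : ‖x‖ ≤ 1) :
    tateEval (tateAct k ⟨(aff s t)⁻¹, aff_inv_mem hs ht⟩ f) x
      = ((s : ℚ_[p]) ^ (k / 2))⁻¹ * tateEval f (s * x + t) := by
  rw [tateEval_tateAct hk _ _ hx, inv_inv, slash, aff_det]
  simp [aff_apply]

/-- Recentring at a point of the unit disc stays inside the Tate algebra: the weight `0` action of a
translation supplies the expansion at `y`. -/
theorem analyticAt_tateEval (f : Tate p) {y : ℚ_[p]} (hy : ‖y‖ ≤ 1) :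
    AnalyticAt ℚ_[p] (tateEval f) y := by
  set F := tateAct 0 ⟨(aff 1 y)⁻¹, aff_inv_mem (by simp) hy⟩ f with hF
  have h1 : AnalyticAt ℚ_[p] (fun x => tateEval F (x - y)) y := by
    refine AnalyticAt.fun_comp (g := tateEval F) ?_ (analyticAt_id.sub analyticAt_const)
    simpa using (tate_hasFPowerSeriesAt F).analyticAt
  refine h1.congr ?_
  have h2 : Tendsto (fun x : ℚ_[p] => x - y) (𝓝 y) (𝓝 0) := by
    have h3 : Continuous fun x : ℚ_[p] => x - y := by fun_prop
    simpa using h3.tendsto y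
  filter_upwards [h2.eventually eventually_norm_le_one] with x hx
  rw [hF, tateEval_tateAct_aff (by simp) (by simp) hy _ hx]
  simp

/-! ### Edges of the tree with a given source -/

theorem norm_p_lt_one : ‖(p : ℚ_[p])‖ < 1 := Padic.norm_p_lt_one

theorem norm_p_pos : 0 < ‖(p : ℚ_[p])‖ := norm_pos_iff.2 p_ne_zero

theorem norm_le_norm_p {x : ℚ_[p]} (h : ‖x‖ < 1) : ‖x‖ ≤ ‖(p : ℚ_[p])‖ := by
  have := (Padic.norm_le_pow_iff_norm_lt_pow_add_one x (-1)).2 (by simpa using h)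
  simpa using this

theorem exists_eq_p_mul {x : ℚ_[p]} (h : ‖x‖ < 1) : ∃ y : ℚ_[p], ‖y‖ ≤ 1 ∧ x = p * y := by
  refine ⟨x / p, ?_, (mul_div_cancel₀ _ p_ne_zero).symm⟩
  rw [norm_div, div_le_one norm_p_pos]
  exact norm_le_norm_p h

theorem norm_nat_le_one (j : ℕ) : ‖(j : ℚ_[p])‖ ≤ 1 := by
  exact_mod_cast Padic.norm_int_le_one (p := p) j

theorem norm_add_le_one {x y : ℚ_[p]} (hx : ‖x‖ ≤ 1) (hy : ‖y‖ ≤ 1) : ‖x + y‖ ≤ 1 :=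
  (IsUltrametricDist.norm_add_le_max _ _).trans (max_le hx hy)

theorem norm_sub_le_one {x y : ℚ_[p]} (hx : ‖x‖ ≤ 1) (hy : ‖y‖ ≤ 1) : ‖x - y‖ ≤ 1 := by
  rw [sub_eq_add_neg]
  exact norm_add_le_one hx (by rwa [norm_neg])

theorem norm_mul_le_one {x y : ℚ_[p]} (hx : ‖x‖ ≤ 1) (hy : ‖y‖ ≤ 1) : ‖x * y‖ ≤ 1 := by
  rw [norm_mul]
  exact mul_le_one₀ hx (norm_nonneg _) hy

theorem norm_p_mul_lt_one {x : ℚ_[p]} (hx : ‖x‖ ≤ 1) : ‖(p : ℚ_[p]) * x‖ < 1 := by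
  rw [norm_mul]
  exact mul_lt_one_of_nonneg_of_lt_one_left (norm_nonneg _) norm_p_lt_one hx

theorem eq_of_norm_sub_lt_one {i j : ℕ} (hi : i < p) (hj : j < p)
    (h : ‖(j : ℚ_[p]) - i‖ < 1) : j = i := by
  have h1 : ‖((j - i : ℤ) : ℤ_[p])‖ < 1 := by
    rw [PadicInt.norm_def]
    push_cast
    exact h
  rw [PadicInt.norm_int_lt_one_iff_dvd] at h1
  have h2 := Int.eq_zero_of_abs_lt_dvd h1 (by rw [abs_lt]; omega)
  omega

theorem exists_residue {x : ℚ_[p]} (hx : ‖x‖ ≤ 1) : ∃ j < p, ‖x - (j : ℚ_[p])‖ < 1 := by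
  obtain ⟨n, hn, h⟩ := PadicInt.exists_mem_range (p := p) ⟨x, hx⟩
  rw [PadicInt.maximalIdeal_eq_span_p, Ideal.mem_span_singleton,
    ← PadicInt.norm_lt_one_iff_dvd] at h
  rw [PadicInt.norm_def] at h
  exact ⟨n, hn, h⟩

theorem one_smul_vertex (v : Vertex p) : (1 : GL2 p) • v = v := by
  induction v using Quotient.inductionOn with
  | h L => exact congrArg Lattice.cls (one_smul (GL2 p) L)

theorem mul_smul_vertex (g h : GL2 p) (v : Vertex p) : (g * h) • v = g • h • v := by
  induction v using Quotient.inductionOn with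
  | h L => exact congrArg Lattice.cls (mul_smul g h L)

theorem mem_smul_stdLattice (g : GL2 p) (w : Fin 2 → ℚ_[p]) : w ∈ (g • stdLattice p).1 ↔
    ∃ a b : ℚ_[p], ‖a‖ ≤ 1 ∧ ‖b‖ ≤ 1 ∧ w 0 = g 0 0 * a + g 0 1 * b ∧
      w 1 = g 1 0 * a + g 1 1 * b := by
  rw [Lattice.coe_smul, Submodule.mem_map]
  simp only [mem_stdLattice]
  constructor
  · rintro ⟨v, hv, rfl⟩
    refine ⟨v 0, v 1, hv 0, hv 1, ?_, ?_⟩ <;> simp [glLin, Matrix.mulVec_eq_sum, mul_comm]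
  · rintro ⟨a, b, ha, hb, h0, h1⟩
    refine ⟨![a, b], fun i => by fin_cases i <;> assumption, ?_⟩
    ext i
    fin_cases i <;> simp [glLin, Matrix.mulVec_eq_sum, mul_comm, h0, h1]

theorem smul_stdLattice_le {h : GL2 p} (hh : ∀ i j, ‖h i j‖ ≤ 1) :
    (h • stdLattice p).1 ≤ (stdLattice p).1 := by
  intro w hw
  obtain ⟨a, b, ha, hb, h0, h1⟩ := (mem_smul_stdLattice _ _).1 hw
  refine mem_stdLattice.2 fun i => ?_
  fin_cases i
  · change ‖w 0‖ ≤ 1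
    rw [h0]
    exact norm_add_le_one (norm_mul_le_one (hh _ _) ha) (norm_mul_le_one (hh _ _) hb)
  · change ‖w 1‖ ≤ 1
    rw [h1]
    exact norm_add_le_one (norm_mul_le_one (hh _ _) ha) (norm_mul_le_one (hh _ _) hb)

theorem smul_stdLattice_eq {h : GL2 p} (hh : ∀ i j, ‖h i j‖ ≤ 1) (hd : ‖h.1.det‖ = 1) :
    h • stdLattice p = stdLattice p := by
  obtain ⟨h1, h2, h3, h4⟩ := gl_inv_apply h
  have hh' : ∀ i j, ‖h⁻¹ i j‖ ≤ 1 := by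
    intro i j
    fin_cases i <;> fin_cases j <;> simp [-Matrix.coe_units_inv, h1, h2, h3, h4, hd, hh]
  refine Subtype.ext (le_antisymm (smul_stdLattice_le hh) ?_)
  have := Submodule.map_mono (f := glLin h) (smul_stdLattice_le hh')
  rw [← Lattice.coe_smul, ← Lattice.coe_smul, ← mul_smul, mul_inv_cancel, one_smul] at this
  exact this

/-- The columns of `h` are the images of the standard basis vectors, so they are integral. -/
theorem norm_det_le_one_of_smul {h : GL2 p} (hh : h • stdLattice p = stdLattice p) :
    ‖h.1.det‖ ≤ 1 := by
  have h1 : ∀ a b : ℚ_[p], ‖a‖ ≤ 1 → ‖b‖ ≤ 1 → ‖h 0 0 * a + h 0 1 * b‖ ≤ 1 ∧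
      ‖h 1 0 * a + h 1 1 * b‖ ≤ 1 := by
    intro a b ha hb
    have : ![h 0 0 * a + h 0 1 * b, h 1 0 * a + h 1 1 * b] ∈ (stdLattice p).1 := by
      rw [← hh, mem_smul_stdLattice]
      exact ⟨a, b, ha, hb, rfl, rfl⟩
    rw [mem_stdLattice] at this
    exact ⟨this 0, this 1⟩
  have h2 := h1 1 0 (by simp) (by simp)
  have h3 := h1 0 1 (by simp) (by simp)
  simp only [mul_one, mul_zero, add_zero, zero_add] at h2 h3
  rw [gl_det]
  exact norm_sub_le_one (norm_mul_le_one h2.1 h3.2) (norm_mul_le_one h3.1 h2.2)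

theorem norm_det_eq_of_smul {g h : GL2 p} (hh : g • stdLattice p = h • stdLattice p) :
    ‖g.1.det‖ = ‖h.1.det‖ := by
  have key : ∀ g h : GL2 p, g • stdLattice p = h • stdLattice p → ‖g.1.det‖ ≤ ‖h.1.det‖ := by
    intro g h hh
    have h1 : (h⁻¹ * g) • stdLattice p = stdLattice p := by
      rw [mul_smul, hh, inv_smul_smul]
    have h2 := norm_det_le_one_of_smul h1
    rw [gl_det_mul, gl_inv_det, norm_mul, norm_inv] at h2
    have h3 : 0 < ‖h.1.det‖ := norm_pos_iff.2 h.det_ne_zero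
    rwa [inv_mul_le_iff₀ h3, mul_one] at h2
  exact le_antisymm (key _ _ hh) (key _ _ hh.symm)

theorem alpha_apply (j : ℕ) : alpha p j 0 0 = p ∧ alpha p j 0 1 = j ∧ alpha p j 1 0 = 0 ∧
    alpha p j 1 1 = 1 := by
  simp [alpha]

theorem gZero_apply : gZero p 0 0 = 0 ∧ gZero p 0 1 = 1 ∧ gZero p 1 0 = p ∧ gZero p 1 1 = 0 := by
  simp [gZero]

/-- Homothety by `u` multiplies the determinant by `u²`, so equal determinant norms force `u` to be
a unit. -/
theorem exists_unit_of_cls_eq {g h : GL2 p} (hd : ‖g.1.det‖ = ‖h.1.det‖)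
    (hh : (g • stdLattice p).cls = (h • stdLattice p).cls) :
    ∃ u : ℚ_[p]ˣ, ‖(u : ℚ_[p])‖ = 1 ∧ g • stdLattice p = (scalarGL u * h) • stdLattice p := by
  obtain ⟨u, hu⟩ := Quotient.exact hh.symm
  rw [← mul_smul] at hu
  refine ⟨u, ?_, hu⟩
  have h1 := norm_det_eq_of_smul hu
  have h2 : (scalarGL u * h).1.det = u ^ 2 * h.1.det := by
    rw [gl_det, gl_det]
    simp only [scalarGL_mul_apply]
    ring
  rw [h2, norm_mul, norm_pow, hd] at h1
  have h3 : ‖h.1.det‖ ≠ 0 := norm_ne_zero_iff.2 h.det_ne_zero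
  have h4 : ‖(u : ℚ_[p])‖ ^ 2 = 1 := by
    field_simp at h1
    exact h1.symm
  exact (pow_eq_one_iff_of_nonneg (norm_nonneg _) two_ne_zero).1 h4

theorem mem_alpha_smul (j : ℕ) : ![(j : ℚ_[p]), 1] ∈ (alpha p j • stdLattice p).1 := by
  rw [mem_smul_stdLattice]
  obtain ⟨h1, h2, h3, h4⟩ := alpha_apply (p := p) j
  exact ⟨0, 1, by simp, by simp, by simp [h2], by simp [h4]⟩

/-- The lattice `α_j ℤ_p²` contains the vector `(j, 1)`, and this vector lies in a unit multiple of
`α_i ℤ_p²` only if `j ≡ i` modulo `p`. -/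
theorem alpha_smul_cls_injective {i j : ℕ} (hi : i < p) (hj : j < p)
    (h : alpha p j • (stdLattice p).cls = alpha p i • (stdLattice p).cls) : j = i := by
  have hd : ∀ j : ℕ, (alpha p j).1.det = p := fun j => by
    rw [alpha_eq, aff_det, pU_val]
  obtain ⟨u, hu, h⟩ := exists_unit_of_cls_eq (by rw [hd, hd]) h
  have h1 := mem_alpha_smul (p := p) j
  rw [h, mem_smul_stdLattice] at h1
  obtain ⟨a, b, ha, hb, e0, e1⟩ := h1
  obtain ⟨h1, h2, h3, h4⟩ := alpha_apply (p := p) i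
  simp only [scalarGL_mul_apply, h1, h2, h3, h4] at e0 e1
  simp only [Matrix.cons_val_zero, Matrix.cons_val_one] at e0 e1
  refine eq_of_norm_sub_lt_one hi hj ?_
  have : (j : ℚ_[p]) - i = p * (u * a) := by
    linear_combination e0 - i * e1
  rw [this]
  exact norm_p_mul_lt_one (norm_mul_le_one hu.le ha)

/-- Vectors of `g₀ ℤ_p²` have second coordinate divisible by `p`, unlike `(j, 1)`. -/
theorem gZero_smul_cls_ne (j : ℕ) :
    gZero p • (stdLattice p).cls ≠ alpha p j • (stdLattice p).cls := by
  intro h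
  obtain ⟨h1, h2, h3, h4⟩ := gZero_apply (p := p)
  obtain ⟨u, hu, h⟩ := exists_unit_of_cls_eq (by
    rw [gl_det (gZero p), h1, h2, h3, h4, alpha_eq, aff_det, pU_val]; simp) h.symm
  have h5 := mem_alpha_smul (p := p) j
  rw [h, mem_smul_stdLattice] at h5
  obtain ⟨a, b, ha, hb, e0, e1⟩ := h5
  simp only [scalarGL_mul_apply, h1, h2, h3, h4] at e0 e1
  simp only [Matrix.cons_val_zero, Matrix.cons_val_one] at e0 e1
  have h6 : ‖(p : ℚ_[p]) * (u * a)‖ < 1 := norm_p_mul_lt_one (norm_mul_le_one hu.le ha)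
  rw [show (p : ℚ_[p]) * (u * a) = 1 by linear_combination -e1, norm_one] at h6
  exact lt_irrefl _ h6

theorem submodule_smul_mem (M : Submodule ℤ_[p] (Fin 2 → ℚ_[p])) {c : ℚ_[p]} (hc : ‖c‖ ≤ 1)
    {v : Fin 2 → ℚ_[p]} (hv : v ∈ M) : c • v ∈ M := M.smul_mem (⟨c, hc⟩ : ℤ_[p]) hv

theorem mem_pSmul_stdLattice {w : Fin 2 → ℚ_[p]} (h0 : ‖w 0‖ < 1) (h1 : ‖w 1‖ < 1) :
    w ∈ (pSmul (stdLattice p)).1 := by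
  obtain ⟨a, ha, h0⟩ := exists_eq_p_mul h0
  obtain ⟨b, hb, h1⟩ := exists_eq_p_mul h1
  have e : ∀ i j, scalarGL (pU p) i j = p * (1 : GL2 p) i j := fun i j => by
    rw [← mul_one (scalarGL (pU p)), scalarGL_mul_apply, pU_val]
  refine (mem_smul_stdLattice (scalarGL (pU p)) _).2 ⟨a, b, ha, hb, ?_, ?_⟩ <;>
  simp only [e] <;> simp [h0, h1]

/-- The lattices between `p ℤ_p²` and `ℤ_p²`. -/
theorem lattice_between {M : Lattice p} (h1 : (pSmul (stdLattice p)).1 < M.1)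
    (h2 : M.1 < (stdLattice p).1) :
    M = gZero p • stdLattice p ∨ ∃ j < p, M = alpha p j • stdLattice p := by
  have hint : ∀ v ∈ M.1, ∀ i, ‖v i‖ ≤ 1 := fun v hv => mem_stdLattice.1 (h2.le hv)
  have hsmall : ∀ a b : ℚ_[p], ‖a‖ < 1 → ‖b‖ < 1 → ![a, b] ∈ M.1 := fun a b ha hb =>
    h1.le (mem_pSmul_stdLattice ha hb)
  have hspan : ∀ w a b, (∀ i, ‖w i‖ ≤ 1) → ![(a : ℚ_[p]), 1] ∈ M.1 → ![b, 0] ∈ M.1 →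
      w 0 - a * w 1 = b → w ∈ M.1 := by
    intro w a b hw ha hb e
    have : w = w 1 • ![(a : ℚ_[p]), 1] + ![b, 0] := by
      ext i
      fin_cases i
      · simp [← e]; ring
      · simp
    rw [this]
    exact add_mem (submodule_smul_mem _ (hw 1) ha) hb
  have hone : ∀ u : ℚ_[p], ‖u‖ = 1 → ![u, 0] ∈ M.1 → ∀ b : ℚ_[p], ‖b‖ ≤ 1 → ![b, 0] ∈ M.1 := by
    intro u hu hM b hb
    have hu0 : u ≠ 0 := by rintro rfl; simp at hu
    have : ![b, 0] = (b / u) • ![u, 0] := by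
      ext i; fin_cases i
      · simp [hu0]
      · simp
    rw [this]
    exact submodule_smul_mem _ (by rw [norm_div, hu, div_one]; exact hb) hM
  -- The reduction of `M` modulo `p` is a line in `𝔽_p²`: it is spanned by some `(j, 1)` if a second
  -- coordinate is a unit, and by `(1, 0)` otherwise.
  by_cases hA : ∃ v ∈ M.1, ‖v 1‖ = 1
  · right
    obtain ⟨v, hv, hv1⟩ := hA
    have hv0 : v 1 ≠ 0 := by intro h; rw [h] at hv1; simp at hv1
    have ht : ‖v 0 / v 1‖ ≤ 1 := by rw [norm_div, hv1, div_one]; exact hint v hv 0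
    obtain ⟨j, hj, hj2⟩ := exists_residue ht
    obtain ⟨a1, a2, a3, a4⟩ := alpha_apply (p := p) j
    have hj1 : ![(j : ℚ_[p]), 1] ∈ M.1 := by
      have : ![(j : ℚ_[p]), 1] = (v 1)⁻¹ • v - ![v 0 / v 1 - j, 0] := by
        ext i; fin_cases i
        · simp; field_simp; ring
        · simp [hv0]
      rw [this]
      exact sub_mem (submodule_smul_mem _ (by rw [norm_inv, hv1, inv_one]) hv)
        (hsmall _ _ hj2 (by simp))
    refine ⟨j, hj, Subtype.ext (le_antisymm ?_ ?_)⟩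
    · intro w hw
      have hw1 := hint w hw
      have hle : ‖w 0 - j * w 1‖ ≤ 1 :=
        norm_sub_le_one (hw1 0) (norm_mul_le_one (norm_nat_le_one j) (hw1 1))
      -- If this were a unit, `M` would contain `(1, 0)` as well as `(j, 1)`, hence all of `ℤ_p²`,
      -- against strictness.
      have hlt : ‖w 0 - j * w 1‖ < 1 := by
        refine lt_of_le_of_ne hle fun h => not_le_of_gt h2 fun x hx => ?_
        have hb : ![w 0 - j * w 1, 0] ∈ M.1 := by
          have : ![w 0 - j * w 1, 0] = w - w 1 • ![(j : ℚ_[p]), 1] := by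
            ext i; fin_cases i
            · simp; ring
            · simp
          rw [this]
          exact sub_mem hw (submodule_smul_mem _ (hw1 1) hj1)
        have hx := mem_stdLattice.1 hx
        exact hspan x j _ hx hj1 (hone _ h hb _
          (norm_sub_le_one (hx 0) (norm_mul_le_one (norm_nat_le_one j) (hx 1)))) rfl
      obtain ⟨y, hy, hy2⟩ := exists_eq_p_mul hlt
      refine (mem_smul_stdLattice _ _).2 ⟨y, w 1, hy, hw1 1, ?_, ?_⟩
      · rw [a1, a2, ← hy2]; ring
      · rw [a3, a4]; ring
    · intro w hw
      obtain ⟨a, b, ha, hb, e0, e1⟩ := (mem_smul_stdLattice _ _).1 hw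
      rw [a1, a2] at e0
      rw [a3, a4] at e1
      have e1 : w 1 = b := by rw [e1]; ring
      refine hspan w j (p * a) ?_ hj1 (hsmall _ _ (norm_p_mul_lt_one ha) (by simp)) ?_
      · intro i
        fin_cases i
        · change ‖w 0‖ ≤ 1
          rw [e0]
          exact norm_add_le_one (norm_p_mul_lt_one ha).le (norm_mul_le_one (norm_nat_le_one j) hb)
        · change ‖w 1‖ ≤ 1
          rw [e1]; exact hb
      · rw [e0, e1]; ring
  · left
    push Not at hA
    obtain ⟨b1, b2, b3, b4⟩ := gZero_apply (p := p)
    have hlt : ∀ v ∈ M.1, ‖v 1‖ < 1 := fun v hv => lt_of_le_of_ne (hint v hv 1) (hA v hv)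
    have hle : M.1 ≤ (gZero p • stdLattice p).1 := by
      intro w hw
      obtain ⟨y, hy, hy2⟩ := exists_eq_p_mul (hlt w hw)
      refine (mem_smul_stdLattice _ _).2 ⟨y, w 0, hy, hint w hw 0, ?_, ?_⟩
      · rw [b1, b2]; ring
      · rw [b3, b4, hy2]; ring
    refine Subtype.ext (le_antisymm hle fun w hw => ?_)
    obtain ⟨v, hv, hv2⟩ := SetLike.exists_of_lt h1
    have hv0 : ‖v 0‖ = 1 := by
      refine le_antisymm (hint v hv 0) ?_
      by_contra! h
      exact hv2 (mem_pSmul_stdLattice h (hlt v hv))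
    obtain ⟨a, b, ha, hb, e0, e1⟩ := (mem_smul_stdLattice _ _).1 hw
    have e0 : w 0 = b := by rw [e0, b1, b2]; ring
    have e1 : w 1 = p * a := by rw [e1, b3, b4]; ring
    have : w = ![w 0, 0] + ![0, w 1] := by
      ext i; fin_cases i <;> simp
    rw [this]
    refine add_mem (hone _ hv0 ?_ _ (by rw [e0]; exact hb)) (hsmall _ _ (by simp)
      (by rw [e1]; exact norm_p_mul_lt_one ha))
    have : ![v 0, 0] = v - ![0, v 1] := by
      ext i; fin_cases i <;> simp
    rw [this]
    exact sub_mem hv (hsmall _ _ (by simp) (hlt v hv))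

/-- Rescaling both representatives by one scalar turns the larger lattice into `ℤ_p²` without
changing the classes, which reduces the claim to `lattice_between`. -/
theorem adj_stdLattice_cls {w : Vertex p} (h : Adj (stdLattice p).cls w) :
    w = gZero p • (stdLattice p).cls ∨ ∃ j < p, w = alpha p j • (stdLattice p).cls := by
  obtain ⟨L, L', hL, rfl, h1, h2⟩ := h
  obtain ⟨u, hu⟩ := Quotient.exact hL
  have h3 : (scalarGL u • L').cls = L'.cls := (Quotient.sound ⟨u, rfl⟩ : L'.cls = _).symm
  rw [← h3]
  rcases lattice_between (M := scalarGL u • L') (by rw [hu, pSmul_smul]; exact smul_lt_smul _ h1)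
    (by rw [hu]; exact smul_lt_smul _ h2) with h | ⟨j, hj, h⟩
  · left; rw [h]; rfl
  · right; exact ⟨j, hj, by rw [h]; rfl⟩

/-- The product `α_j g₀` is `p` times the unimodular matrix `(j 1; 1 0)`, so `α_j e₀` starts at
`v₀`. -/
theorem alpha_gZero_smul_cls (j : ℕ) :
    alpha p j • gZero p • (stdLattice p).cls = (stdLattice p).cls := by
  obtain ⟨a1, a2, a3, a4⟩ := alpha_apply (p := p) j
  obtain ⟨b1, b2, b3, b4⟩ := gZero_apply (p := p)
  let h : GL2 p := Matrix.GeneralLinearGroup.mkOfDetNeZero !![(j : ℚ_[p]), 1; 1, 0] (by simp)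
  have h1 : alpha p j * gZero p = scalarGL (pU p) * h := by
    apply gl_ext <;> rw [gl_mul_apply, scalarGL_mul_apply, pU_val] <;>
    simp [a1, a2, a3, a4, b1, b2, b3, b4, h, mul_comm]
  have h2 : h • stdLattice p = stdLattice p := by
    refine smul_stdLattice_eq ?_ (by rw [gl_det]; simp [h])
    intro i j'
    fin_cases i <;> fin_cases j' <;> simp [h, norm_nat_le_one]
  rw [← mul_smul_vertex, h1, smul_cls, mul_smul, h2]
  exact (Quotient.sound ⟨pU p, rfl⟩ : (stdLattice p).cls = _).symm

/-- The edges with source `g v₀`. -/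
noncomputable def edgeFrom (g : GL2 p) : Option (Fin p) → Edge p
  | none => (g • stdEdge p).opp
  | some j => (g * alpha p j) • stdEdge p

theorem edgeFrom_injective (g : GL2 p) : Function.Injective (edgeFrom g) := by
  have key : ∀ v w : Vertex p, g • v = g • w → v = w := by
    intro v w h
    have := congrArg (fun v => g⁻¹ • v) h
    simpa only [← mul_smul_vertex, inv_mul_cancel, one_smul_vertex] using this
  intro a b h
  have h := congrArg Edge.target h
  rcases a with _ | i <;> rcases b with _ | j
  · rfl
  · refine absurd (key _ _ ?_) (gZero_smul_cls_ne j.1)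
    rw [← mul_smul_vertex g (alpha p j)]; exact h
  · refine absurd (key _ _ ?_) (gZero_smul_cls_ne i.1)
    rw [← mul_smul_vertex g (alpha p i)]; exact h.symm
  · congr 1
    refine Fin.ext (alpha_smul_cls_injective j.2 i.2 (key _ _ ?_))
    rw [← mul_smul_vertex, ← mul_smul_vertex]; exact h

/-- The neighbours of `v₀` are `g₀ v₀` and the `α_j v₀`; the first corresponds to the reversed edge
`e₀`, the others to the edges `α_j e₀`. Translation by `g` gives the general case. -/
theorem range_edgeFrom (g : GL2 p) :
    Set.range (edgeFrom g) = {e | e.source = g • (stdLattice p).cls} := by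
  ext e
  constructor
  · rintro ⟨a, rfl⟩
    rcases a with _ | j
    · rfl
    · change (g * alpha p j) • (gZero p • (stdLattice p).cls) = _
      rw [mul_smul_vertex, alpha_gZero_smul_cls]
  · intro he
    have he : e.source = g • (stdLattice p).cls := he
    have h1 : (g⁻¹ • e).source = (stdLattice p).cls := by
      change g⁻¹ • e.source = _
      rw [he, ← mul_smul_vertex, inv_mul_cancel, one_smul_vertex]
    have h2 : e.target = g • (g⁻¹ • e).target := by
      change _ = g • g⁻¹ • e.target
      rw [← mul_smul_vertex, mul_inv_cancel, one_smul_vertex]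
    have h3 := (g⁻¹ • e).adj
    rw [h1] at h3
    rcases adj_stdLattice_cls h3 with h | ⟨j, hj, h⟩
    · refine ⟨none, Edge.ext he.symm ?_⟩
      rw [h2, h]; rfl
    · refine ⟨some ⟨j, hj⟩, Edge.ext ?_ ?_⟩
      · rw [he]
        change (g * alpha p j) • (gZero p • (stdLattice p).cls) = _
        rw [mul_smul_vertex, alpha_gZero_smul_cls]
      · rw [h2, h, ← mul_smul_vertex]; rfl

/-- Harmonicity at `g v₀`, with antisymmetry used on the one edge `g e₀` that points towards this
vertex. It is the additivity of `c` along `g ℤ_p = ⨆ g α_j ℤ_p`. -/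
theorem cocycle_sum {k : ℕ} {Γ : Subgroup (GL2 p)} {c : Edge p → Vk p k}
    (hc : IsHarmonicCocycle k Γ c) (g : GL2 p) :
    c (g • stdEdge p) = ∑ j ∈ Finset.range p, c ((g * alpha p j) • stdEdge p) := by
  have h := hc.harmonic (g • (stdLattice p).cls)
  have h1 : ∑ᶠ (e : Edge p) (_ : e ∈ Set.range (edgeFrom g)), c e = 0 := by
    rw [range_edgeFrom]; exact h
  rw [finsum_mem_range (edgeFrom_injective g), finsum_eq_sum_of_fintype, Fintype.sum_option] at h1
  simp only [edgeFrom, hc.opp] at h1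
  rw [Finset.sum_range, ← sub_eq_zero, ← neg_eq_zero, neg_sub, sub_eq_add_neg, add_comm]
  exact h1

/-! ### Coefficients of `α_j⁻¹ ·ₖ f` -/

theorem tate_ext_of_eval {f g : Tate p} (h : ∀ x : ℚ_[p], ‖x‖ ≤ 1 → tateEval f x = tateEval g x) :
    f = g := by
  rw [← sub_eq_zero]
  refine tate_eq_zero_of_eventually ?_
  filter_upwards [eventually_norm_le_one.filter_mono nhdsWithin_le_nhds] with x hx
  rw [tateEval_sub _ _ hx, h x hx, sub_self]

theorem tateEval_tateAct_alpha {k : ℕ} (hk : Even k) (j : ℕ) (f : Tate p) {x : ℚ_[p]}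
    (hx : ‖x‖ ≤ 1) : tateEval (tateAct k ⟨(alpha p j)⁻¹, alpha_inv_mem j⟩ f) x
      = ((p : ℚ_[p]) ^ (k / 2))⁻¹ * tateEval f (p * x + j) := by
  obtain ⟨h1, h2, h3, h4⟩ := alpha_apply (p := p) j
  rw [tateEval_tateAct hk _ _ hx, inv_inv, slash, alpha_eq, aff_det, ← alpha_eq, h1, h2, h3, h4]
  simp [pU_val]

/-- In `(px + j)^n` the coefficient of `x^m` is divisible by `p^m`; the denominator comes from the
factor `det^{-k/2}`. Both the contraction and the integrality of `Ũ_p` rest on this estimate. -/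
theorem tateAct_alpha_tateX_norm_le {k : ℕ} (hk : Even k) (j n m : ℕ) :
    ‖(tateAct k ⟨(alpha p j)⁻¹, alpha_inv_mem j⟩ (tateX n) : Tate p) m‖
      ≤ ‖(p : ℚ_[p])‖ ^ m / ‖(p : ℚ_[p])‖ ^ (k / 2) := by
  have h : tateAct k ⟨(alpha p j)⁻¹, alpha_inv_mem j⟩ (tateX n) =
      polyToTate (Polynomial.C ((p : ℚ_[p]) ^ (k / 2))⁻¹ *
        (((Polynomial.X + Polynomial.C (j : ℚ_[p])) ^ n).comp
          (Polynomial.C (p : ℚ_[p]) * Polynomial.X))) := by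
    refine tate_ext_of_eval fun x hx => ?_
    rw [tateEval_tateAct_alpha hk _ _ hx, tateEval_tateX, tateEval_polyToTate]
    simp
  rw [h, polyToTate_apply, Polynomial.coeff_C_mul, Polynomial.comp_C_mul_X_coeff,
    Polynomial.coeff_X_add_C_pow, norm_mul, norm_mul, norm_inv, norm_pow, norm_pow, mul_comm,
    div_eq_mul_inv]
  refine mul_le_mul_of_nonneg_right ?_ (by positivity)
  refine mul_le_of_le_one_left (by positivity) (norm_mul_le_one ?_ (norm_nat_le_one _))
  rw [norm_pow]
  exact pow_le_one₀ (norm_nonneg _) (norm_nat_le_one _)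

theorem tateAct_alpha_norm_le {k : ℕ} (hk : Even k) (j : ℕ) (f : Tate p) (m : ℕ) :
    ‖tateAct k ⟨(alpha p j)⁻¹, alpha_inv_mem j⟩ f m‖
      ≤ ‖(p : ℚ_[p])‖ ^ m / ‖(p : ℚ_[p])‖ ^ (k / 2) * ‖f‖ := by
  rw [tateAct_apply]
  refine IsUltrametricDist.norm_tsum_le_of_forall_le_of_nonneg (by positivity) fun n => ?_
  rw [norm_mul, mul_comm, ← tateAct_tateX_apply k ⟨(alpha p j)⁻¹, alpha_inv_mem j⟩]
  exact mul_le_mul (tateAct_alpha_tateX_norm_le hk j n m) (tate_norm_le f n) (norm_nonneg _)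
    (by positivity)

/-- The operator `∑_j ω_j ·ₖ α_j⁻¹` contracts distributions that vanish on polynomials of degree
at most `k`. -/
theorem contraction {k : ℕ} (hk : Even k) {ω : ℕ → Dist p} {C : ℝ}
    (hω : ∀ j n, ‖ω j (tateX n)‖ ≤ C) (h0 : ∀ j, ∀ n ≤ k, ω j (tateX n) = 0) (f : Tate p) :
    ‖∑ j ∈ Finset.range p, ω j (tateAct k ⟨(alpha p j)⁻¹, alpha_inv_mem j⟩ f)‖
      ≤ C * ‖(p : ℚ_[p])‖ * ‖f‖ := by
  have hC : 0 ≤ C := (norm_nonneg _).trans (hω 0 0)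
  refine IsUltrametricDist.norm_sum_le_of_forall_le_of_nonneg (by positivity) fun j _ => ?_
  rw [mul_assoc]
  refine dist_norm_le_of_tail (hω j) (h0 j) (by positivity) _ fun m hm => ?_
  refine (tateAct_alpha_norm_le hk j f m).trans (mul_le_mul_of_nonneg_right ?_ (norm_nonneg _))
  -- Here `m ≥ k + 1 ≥ k/2 + 1`, so `p^{m - k/2}` is still divisible by `p`.
  rw [div_le_iff₀ (pow_pos norm_p_pos _), ← pow_succ']
  exact pow_le_pow_of_le_one norm_p_pos.le norm_p_lt_one.le (by omega)

/-! ### The operator `Ũ_p` and specialization -/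

theorem upTilde_apply (k : ℕ) (Φ : GL2 p → Dist p) (g : GL2 p) (f : Tate p) :
    upTilde k Φ g f = ∑ j ∈ Finset.range p,
      Φ (g * alpha p j) (tateAct k ⟨(alpha p j)⁻¹, alpha_inv_mem j⟩ f) := by
  have h : upTilde k Φ g = ∑ j ∈ Finset.range p,
      distAct k (Φ (g * alpha p j)) ⟨(alpha p j)⁻¹, alpha_inv_mem j⟩ := by
    rw [upTilde, Pi.smul_apply, upOp, inv_smul_smul₀ (pow_ne_zero _ p_ne_zero)]
  rw [h, sum_apply]
  rfl

theorem finite_denom (g : GL2 p) : {x : ℚ_[p] | g 1 0 * x + g 1 1 = 0}.Finite := by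
  refine Set.Subsingleton.finite fun x hx y hy => ?_
  have hx : g 1 0 * x + g 1 1 = 0 := hx
  have hy : g 1 0 * y + g 1 1 = 0 := hy
  have hc : g 1 0 ≠ 0 := by
    intro h
    rw [h] at hx
    refine gl_det_ne_zero g ?_
    rw [h]
    linear_combination g 0 0 * hx
  exact mul_left_cancel₀ hc (by linear_combination hx - hy)

theorem polySlash_eval (k : ℕ) (g : GL2 p) (P : PolyLE p k) {x : ℚ_[p]}
    (hx : g 1 0 * x + g 1 1 ≠ 0) : (polySlash k g P : ℚ_[p][X]).eval x
      = slash k (fun y => (P : ℚ_[p][X]).eval y) g x := by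
  have hP : (P : ℚ_[p][X]).natDegree < k + 1 :=
    Nat.lt_succ_iff.2 (Polynomial.natDegree_le_of_degree_le (Polynomial.mem_degreeLE.1 P.2))
  rw [slash, Polynomial.eval_eq_sum_range' hP, mul_assoc, Finset.mul_sum]
  simp only [polySlash, LinearMap.coe_mk, AddHom.coe_mk, Polynomial.eval_smul,
    Polynomial.eval_finsetSum, smul_eq_mul]
  congr 1
  refine Finset.sum_congr rfl fun i hi => ?_
  have hi : i ≤ k := Nat.lt_succ_iff.1 (Finset.mem_range.1 hi)
  obtain ⟨l, rfl⟩ := Nat.exists_eq_add_of_le hi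
  simp only [Polynomial.eval_mul, Polynomial.eval_pow, Polynomial.eval_add, Polynomial.eval_C,
    Polynomial.eval_X, Nat.add_sub_cancel_left]
  generalize g 1 0 * x + g 1 1 = D at hx ⊢
  rw [div_pow, pow_add]
  field_simp

/-- Two polynomials that agree away from the finitely many poles are equal, so the cocycle identity
for functions suffices. -/
theorem polySlash_polySlash (k : ℕ) (g h : GL2 p) (P : PolyLE p k) :
    polySlash k h (polySlash k g P) = polySlash k (g * h) P := by
  refine Subtype.ext (Polynomial.eq_of_infinite_eval_eq _ _ ?_)
  refine ((finite_denom h).union (finite_denom (g * h))).infinite_compl.mono fun x hx => ?_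
  simp only [Set.mem_compl_iff, Set.mem_union, Set.mem_ofPred_eq, not_or] at hx
  obtain ⟨h1, h2⟩ := hx
  have h3 : g 1 0 * ((h 0 0 * x + h 0 1) / (h 1 0 * x + h 1 1)) + g 1 1 ≠ 0 := by
    intro h3
    apply h2
    rw [gl_mul_apply, gl_mul_apply]
    rw [← mul_div_assoc, div_add' _ _ _ h1, div_eq_zero_iff, or_iff_left h1] at h3
    linear_combination h3
  change _ = _
  rw [polySlash_eval k _ _ h1, polySlash_eval k _ _ h2, ← slash_slash k _ _ _ h1, slash, slash,
    polySlash_eval k _ _ h3]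

theorem inv_denom {τ : GL2 p} (hτ : τ ∈ scaledSigmaZero p) {x : ℚ_[p]} (hx : ‖x‖ ≤ 1) :
    τ⁻¹ 1 0 * x + τ⁻¹ 1 1 ≠ 0 := by
  obtain ⟨-, -, h3, h4⟩ := gl_inv_apply τ
  have h5 : τ.1.det⁻¹ ≠ 0 := inv_ne_zero τ.det_ne_zero
  rw [h3, h4]
  have : -(τ.1.det⁻¹ * τ 1 0) * x + τ.1.det⁻¹ * τ 0 0 = τ.1.det⁻¹ * (τ 0 0 - τ 1 0 * x) := by ring
  rw [this]
  exact mul_ne_zero h5 (scaledSigmaZero_denom hτ hx).1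

/-- In degree at most `k` the automorphy factor clears all denominators, so the rigid analytic
action restricts to the polynomial one. This makes specialization equivariant. -/
theorem tateAct_polyToTate {k : ℕ} (hk : Even k) (τ : scaledSigmaZero p) (P : PolyLE p k) :
    tateAct k τ (polyToTate (P : ℚ_[p][X])) = polyToTate (polySlash k (τ.1)⁻¹ P : ℚ_[p][X]) := by
  refine tate_ext_of_eval fun x hx => ?_
  rw [tateEval_tateAct hk _ _ hx, tateEval_polyToTate, polySlash_eval k _ _ (inv_denom τ.2 hx)]
  congr 1
  funext y
  exact tateEval_polyToTate _ _

theorem tateAct_alpha_polyToTate {k : ℕ} (hk : Even k) (j : ℕ) (P : PolyLE p k) :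
    tateAct k ⟨(alpha p j)⁻¹, alpha_inv_mem j⟩ (polyToTate (P : ℚ_[p][X]))
      = polyToTate (polySlash k (alpha p j) P : ℚ_[p][X]) := by
  rw [tateAct_polyToTate hk, inv_inv]

theorem specialize_apply (k : ℕ) (Φ : GL2 p → Dist p) (g : GL2 p) (P : PolyLE p k) :
    specialize k Φ g P = Φ g (polyToTate (P : ℚ_[p][X])) := rfl

/-- On polynomials `Ũ_p` sums the values of `c` over the edges `g α_j e₀`, and by harmonicity that
sum is the value at `g e₀`: `φ_c` has `Ũ_p`-eigenvalue `1`. -/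
theorem specialize_upTilde {k : ℕ} (hk : Even k) {Γ : Subgroup (GL2 p)} {c : Edge p → Vk p k}
    (hc : IsHarmonicCocycle k Γ c) {Φ : GL2 p → Dist p}
    (hΦ : specialize k Φ = cocycleForm k c) : specialize k (upTilde k Φ) = cocycleForm k c := by
  funext g
  ext P : 1
  rw [specialize_apply, upTilde_apply, cocycleForm, vkLeft, LinearMap.comp_apply, cocycle_sum hc,
    LinearMap.sum_apply]
  refine Finset.sum_congr rfl fun j _ => ?_
  rw [tateAct_alpha_polyToTate hk, ← specialize_apply, hΦ, cocycleForm, vkLeft,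
    LinearMap.comp_apply, polySlash_polySlash, mul_inv_rev, mul_inv_cancel_left]

theorem eq_on_tateX_of_specialize_eq {k : ℕ} {Φ Φ' : GL2 p → Dist p}
    (h : specialize k Φ = specialize k Φ') (g : GL2 p) {n : ℕ} (hn : n ≤ k) :
    Φ g (tateX n) = Φ' g (tateX n) :=
  DFunLike.congr_fun (congrFun h g) (monoLE k ⟨n, Nat.lt_succ_iff.2 hn⟩)

theorem upTilde_sub_norm_le {k : ℕ} (hk : Even k) {Φ Φ' : GL2 p → Dist p}
    (h : specialize k Φ = specialize k Φ') {C : ℝ}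
    (hC : ∀ g n, ‖Φ g (tateX n) - Φ' g (tateX n)‖ ≤ C) (g : GL2 p) (n : ℕ) :
    ‖upTilde k Φ g (tateX n) - upTilde k Φ' g (tateX n)‖ ≤ C * ‖(p : ℚ_[p])‖ := by
  have hC0 : 0 ≤ C := (norm_nonneg _).trans (hC 1 0)
  have h1 := contraction hk (ω := fun j => Φ (g * alpha p j) - Φ' (g * alpha p j)) (C := C)
    (fun j n => hC _ _) (fun j n hn => by
      rw [sub_apply, eq_on_tateX_of_specialize_eq h _ hn, sub_self])
    (tateX n)
  simp only [sub_apply, Finset.sum_sub_distrib, ← upTilde_apply] at h1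
  exact h1.trans (mul_le_of_le_one_right (by positivity) (tate_norm_tateX n))

theorem norm_le_of_inPow {m : ℕ} {x : ℚ_[p]} (h : InPow m x) : ‖x‖ ≤ ‖(p : ℚ_[p])‖ ^ m := by
  obtain ⟨z, rfl⟩ := h
  rw [norm_mul, norm_pow]
  exact mul_le_of_le_one_right (by positivity) z.2

theorem inPow_of_norm_le {m : ℕ} {x : ℚ_[p]} (h : ‖x‖ ≤ ‖(p : ℚ_[p])‖ ^ m) : InPow m x := by
  refine ⟨⟨x / (p : ℚ_[p]) ^ m, ?_⟩, ?_⟩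
  · rw [norm_div, norm_pow]
    exact div_le_one_of_le₀ h (by positivity)
  · exact (mul_div_cancel₀ _ (pow_ne_zero _ p_ne_zero)).symm

/-- The denominator `p^{k/2}` is absorbed in two ways: for `m ≤ k/2` by the extra divisibility
`p^{k/2 - m}` of the moment together with the `p^m` of the coefficient, and for `m > k/2` by the
coefficient alone. This is the role of the lattice `V_k'(ℤ_p)`. -/
theorem upTilde_norm_le_one {k : ℕ} (hk : Even k) {Γ : Subgroup (GL2 p)} {Φ : GL2 p → Dist p}
    (hΦ : Φ ∈ formsInt' Γ k) (g : GL2 p) (n : ℕ) : ‖upTilde k Φ g (tateX n)‖ ≤ 1 := by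
  rw [upTilde_apply]
  refine IsUltrametricDist.norm_sum_le_of_forall_le_of_nonneg zero_le_one fun j _ => ?_
  refine hasSum_norm_le ((tate_hasSum _).mapL (Φ (g * alpha p j))) zero_le_one fun m => ?_
  rw [map_smul, smul_eq_mul, norm_mul]
  have h1 := tateAct_alpha_tateX_norm_le hk j n m (p := p)
  have hp := norm_p_pos (p := p)
  rcases le_or_gt m (k / 2) with hm | hm
  · have h2 := norm_le_of_inPow ((hΦ.1.2 (g * alpha p j)).2 ⟨m, by omega⟩ hm)
    refine (mul_le_mul h1 h2 (norm_nonneg _) (by positivity)).trans ?_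
    rw [div_mul_eq_mul_div, ← pow_add, Nat.add_sub_cancel' hm, div_self (by positivity)]
  · have h2 : ‖Φ (g * alpha p j) (tateX m)‖ ≤ 1 := by
      simpa using norm_le_of_inPow (hΦ.2.2 (g * alpha p j) m)
    refine mul_le_one₀ (h1.trans ?_) (norm_nonneg _) h2
    rw [div_le_one (by positivity)]
    exact pow_le_pow_of_le_one hp.le norm_p_lt_one.le hm.le

/-! ### Composition of actions -/

theorem inv_moebius_norm_le {τ : GL2 p} (hτ : τ ∈ scaledSigmaZero p) {x : ℚ_[p]} (hx : ‖x‖ ≤ 1) :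
    ‖(τ⁻¹ 0 0 * x + τ⁻¹ 0 1) / (τ⁻¹ 1 0 * x + τ⁻¹ 1 1)‖ ≤ 1 := by
  obtain ⟨h1, h2, h3, h4⟩ := gl_inv_apply τ
  have h5 : τ.1.det⁻¹ ≠ 0 := inv_ne_zero τ.det_ne_zero
  rw [h1, h2, h3, h4]
  have e1 : -(τ.1.det⁻¹ * τ 1 0) * x + τ.1.det⁻¹ * τ 0 0 = τ.1.det⁻¹ * (τ 0 0 - τ 1 0 * x) := by ring
  have e2 : τ.1.det⁻¹ * τ 1 1 * x + -(τ.1.det⁻¹ * τ 0 1) = τ.1.det⁻¹ * (τ 1 1 * x - τ 0 1) := by ring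
  rw [e1, e2, mul_div_mul_left _ _ h5]
  exact (scaledSigmaZero_denom hτ hx).2

theorem slash_congr (k : ℕ) {f f' : ℚ_[p] → ℚ_[p]} (g : GL2 p) {x : ℚ_[p]}
    (h : f ((g 0 0 * x + g 0 1) / (g 1 0 * x + g 1 1))
      = f' ((g 0 0 * x + g 0 1) / (g 1 0 * x + g 1 1))) : slash k f g x = slash k f' g x := by
  rw [slash, slash, h]

theorem tateEval_tateAct_tateAct {k : ℕ} (hk : Even k) (τ τ' : scaledSigmaZero p) (f : Tate p)
    {x : ℚ_[p]} (hx : ‖x‖ ≤ 1) : tateEval (tateAct k τ (tateAct k τ' f)) x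
      = slash k (tateEval f) (τ.1 * τ'.1)⁻¹ x := by
  rw [tateEval_tateAct hk _ _ hx, mul_inv_rev, ← slash_slash k _ _ _ (inv_denom τ.2 hx)]
  exact slash_congr k _ (tateEval_tateAct hk _ _ (inv_moebius_norm_le τ.2 hx))

/-- A composite action depends only on the product of the matrices. Comparing two factorizations
avoids having to show that the product lies in the monoid. -/
theorem tateAct_tateAct_eq {k : ℕ} (hk : Even k) {τ₁ τ₂ τ₃ τ₄ : scaledSigmaZero p}
    (h : τ₁.1 * τ₂.1 = τ₃.1 * τ₄.1) (f : Tate p) :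
    tateAct k τ₁ (tateAct k τ₂ f) = tateAct k τ₃ (tateAct k τ₄ f) :=
  tate_ext_of_eval fun x hx => by
    rw [tateEval_tateAct_tateAct hk _ _ _ hx, tateEval_tateAct_tateAct hk _ _ _ hx, h]

/-! ### The matrices `σ α_j` for `σ ∈ Γ₀(p)` -/

theorem gammaZero_diag {σ : GL2 p} (hσ : σ ∈ gammaZero p) : ‖σ 0 0‖ = 1 ∧ ‖σ 1 1‖ = 1 := by
  obtain ⟨h1, h2, h3⟩ := hσ
  have h4 : ‖σ 0 1 * σ 1 0‖ < 1 := by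
    rw [norm_mul]
    exact mul_lt_one_of_nonneg_of_lt_one_right (h1 _ _) (norm_nonneg _) h3
  have h5 : ‖σ 0 0 * σ 1 1‖ = 1 := by
    rw [gl_det] at h2
    have h6 : σ 0 0 * σ 1 1 = (σ 0 0 * σ 1 1 - σ 0 1 * σ 1 0) + σ 0 1 * σ 1 0 := by ring
    rw [h6, IsUltrametricDist.norm_add_eq_max_of_norm_ne_norm (by rw [h2]; exact h4.ne'), h2,
      max_eq_left h4.le]
  rw [norm_mul] at h5
  constructor
  · exact le_antisymm (h1 0 0) (h5 ▸ mul_le_of_le_one_right (norm_nonneg _) (h1 1 1))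
  · exact le_antisymm (h1 1 1) (h5 ▸ mul_le_of_le_one_left (norm_nonneg _) (h1 0 0))

theorem alpha_inv_apply (j : ℕ) : (alpha p j)⁻¹ 0 0 = (p : ℚ_[p])⁻¹ ∧
    (alpha p j)⁻¹ 0 1 = -((p : ℚ_[p])⁻¹ * j) ∧ (alpha p j)⁻¹ 1 0 = 0 ∧ (alpha p j)⁻¹ 1 1 = 1 := by
  obtain ⟨h1, h2, h3, h4⟩ := gl_inv_apply (alpha p j)
  obtain ⟨a1, a2, a3, a4⟩ := alpha_apply (p := p) j
  have hd : (alpha p j).1.det = p := by rw [alpha_eq, aff_det, pU_val]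
  rw [h1, h2, h3, h4, hd, a1, a2, a3, a4, inv_mul_cancel₀ p_ne_zero]
  simp

/-- The hypothesis says that `σ` sends `j` to `i` modulo `p`, with the denominator cleared. It makes
the upper right entry integral after division by `p`, while the lower left entry acquires a factor
`p` for any integral `σ`. -/
theorem alpha_inv_mul_mem {σ : GL2 p} (h1 : ∀ i j, ‖σ i j‖ ≤ 1)
    (hd : ‖σ.1.det‖ = 1) {i j : ℕ}
    (h : ‖σ 0 0 * j + σ 0 1 - i * (σ 1 0 * j + σ 1 1)‖ < 1) :
    (alpha p i)⁻¹ * (σ * alpha p j) ∈ gammaZero p := by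
  obtain ⟨a1, a2, a3, a4⟩ := alpha_apply (p := p) j
  obtain ⟨b1, b2, b3, b4⟩ := alpha_inv_apply (p := p) i
  obtain ⟨y, hy, hy2⟩ := exists_eq_p_mul h
  have hp := p_ne_zero (p := p)
  have e00 : ((alpha p i)⁻¹ * (σ * alpha p j)) 0 0 = σ 0 0 - i * σ 1 0 := by
    simp only [gl_mul_apply, a1, a3, b1, b2]
    field_simp
    ring
  have e01 : ((alpha p i)⁻¹ * (σ * alpha p j)) 0 1 = y := by
    simp only [gl_mul_apply, a2, a4, b1, b2]
    refine mul_left_cancel₀ hp ?_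
    rw [← hy2]
    field_simp
    ring
  have e10 : ((alpha p i)⁻¹ * (σ * alpha p j)) 1 0 = p * σ 1 0 := by
    simp only [gl_mul_apply, a1, a3, b3, b4]
    ring
  have e11 : ((alpha p i)⁻¹ * (σ * alpha p j)) 1 1 = σ 1 0 * j + σ 1 1 := by
    simp only [gl_mul_apply, a2, a4, b3, b4]
    ring
  have hj := norm_nat_le_one (p := p) j
  have hi := norm_nat_le_one (p := p) i
  refine ⟨?_, ?_, ?_⟩
  · intro r s
    fin_cases r <;> fin_cases s
    · exact e00 ▸ norm_sub_le_one (h1 _ _) (norm_mul_le_one hi (h1 _ _))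
    · exact e01 ▸ hy
    · exact e10 ▸ (norm_p_mul_lt_one (h1 _ _)).le
    · exact e11 ▸ norm_add_le_one (norm_mul_le_one (h1 _ _) hj) (h1 _ _)
  · rw [gl_det_mul, gl_det_mul, gl_inv_det, alpha_eq, alpha_eq, aff_det, aff_det, mul_comm,
      mul_assoc, mul_inv_cancel₀ (by simp), mul_one, hd]
  · rw [e10]
    exact norm_p_mul_lt_one (h1 _ _)

/-- An element of `Γ₀(p)` acts on `ℤ_p` by a Möbius map whose denominator is a unit, so it permutes
the residue classes modulo `p`. This permutation lets both `Ũ_p` and the subdivision of balls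
commute with `Γ₀(p)`. -/
theorem gammaZero_alpha {σ : GL2 p} (hσ : σ ∈ gammaZero p) :
    ∃ π : Fin p → Fin p, Function.Bijective π ∧
      ∀ j : Fin p, ∃ σ' ∈ gammaZero p, σ * alpha p j = alpha p (π j) * σ' := by
  obtain ⟨ha, hd⟩ := gammaZero_diag hσ
  have hden : ∀ j : ℕ, ‖σ 1 0 * j + σ 1 1‖ = 1 := by
    intro j
    have h4 : ‖σ 1 0 * j‖ < 1 := by
      rw [norm_mul]
      exact mul_lt_one_of_nonneg_of_lt_one_left (norm_nonneg _) hσ.2.2 (norm_nat_le_one j)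
    rw [IsUltrametricDist.norm_add_eq_max_of_norm_ne_norm (by rw [hd]; exact h4.ne), hd,
      max_eq_right h4.le]
  have hex : ∀ j : Fin p, ∃ i : Fin p,
      ‖σ 0 0 * ((j : ℕ) : ℚ_[p]) + σ 0 1 - ((i : ℕ) : ℚ_[p]) * (σ 1 0 * ((j : ℕ) : ℚ_[p]) + σ 1 1)‖
        < 1 := by
    intro j
    have h0 : σ 1 0 * ((j : ℕ) : ℚ_[p]) + σ 1 1 ≠ 0 := norm_ne_zero_iff.1 (by rw [hden]; exact one_ne_zero)
    obtain ⟨i, hi, h⟩ := exists_residue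
      (x := (σ 0 0 * ((j : ℕ) : ℚ_[p]) + σ 0 1) / (σ 1 0 * ((j : ℕ) : ℚ_[p]) + σ 1 1)) (by
        rw [norm_div, hden, div_one]
        exact norm_add_le_one (norm_mul_le_one (hσ.1 _ _) (norm_nat_le_one _)) (hσ.1 _ _))
    refine ⟨⟨i, hi⟩, ?_⟩
    rw [div_sub' h0, norm_div, hden, div_one] at h
    rw [mul_comm (((⟨i, hi⟩ : Fin p) : ℕ) : ℚ_[p])]
    exact h
  choose π hπ using hex
  refine ⟨π, ?_, fun j => ⟨_, alpha_inv_mul_mem hσ.1 hσ.2.1 (hπ j),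
    (mul_inv_cancel_left _ _).symm⟩⟩
  refine Function.Injective.bijective_of_finite fun i j hij => ?_
  have h1 := hπ i
  have h2 := hπ j
  rw [← hij] at h2
  set r : ℚ_[p] := ((π i : ℕ) : ℚ_[p])
  have h3 : ‖(σ 0 0 - r * σ 1 0) * (((i : ℕ) : ℚ_[p]) - ((j : ℕ) : ℚ_[p]))‖ < 1 := by
    have e : (σ 0 0 - r * σ 1 0) * (((i : ℕ) : ℚ_[p]) - ((j : ℕ) : ℚ_[p])) =
      (σ 0 0 * ((i : ℕ) : ℚ_[p]) + σ 0 1 - r * (σ 1 0 * ((i : ℕ) : ℚ_[p]) + σ 1 1)) +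
      -(σ 0 0 * ((j : ℕ) : ℚ_[p]) + σ 0 1 - r * (σ 1 0 * ((j : ℕ) : ℚ_[p]) + σ 1 1)) := by ring
    rw [e]
    exact (IsUltrametricDist.norm_add_le_max _ _).trans_lt (max_lt h1 (by rwa [norm_neg]))
  -- This coefficient of the difference of the two congruences is a unit because `p` divides the
  -- lower left entry; hence `i ≡ j`.
  have h4 : ‖σ 0 0 - r * σ 1 0‖ = 1 := by
    have h5 : ‖r * σ 1 0‖ < 1 := by
      rw [norm_mul]
      exact mul_lt_one_of_nonneg_of_lt_one_right (norm_nat_le_one _) (norm_nonneg _) hσ.2.2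
    rw [sub_eq_add_neg, IsUltrametricDist.norm_add_eq_max_of_norm_ne_norm
      (by rw [ha, norm_neg]; exact h5.ne'), ha, norm_neg, max_eq_left h5.le]
  rw [norm_mul, h4, one_mul] at h3
  exact Fin.ext (eq_of_norm_sub_lt_one j.2 i.2 h3)

/-! ### The eigenform lifting the cocycle -/

/-- A bounded rigid analytic form fixed by `Ũ_p` that lifts the cocycle `c`. -/
structure IsEigenLift (k : ℕ) (c : Edge p → Vk p k) (Φ : GL2 p → Dist p) : Prop where
  scalar : ∀ (u : ℚ_[p]ˣ) (g : GL2 p), Φ (scalarGL u * g) = Φ g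
  equiv : ∀ (g σ : GL2 p) (hσ : σ ∈ gammaZero p) (f : Tate p),
    Φ (g * σ) f = Φ g (tateAct k ⟨σ, gammaZero_subset hσ⟩ f)
  fixed : ∀ g f, Φ g f = ∑ j ∈ Finset.range p,
    Φ (g * alpha p j) (tateAct k ⟨(alpha p j)⁻¹, alpha_inv_mem j⟩ f)
  bound : ∀ g n, ‖Φ g (tateX n)‖ ≤ 1
  lift : specialize k Φ = cocycleForm k c

/-- Right translation by `σ` permutes the summands: `σ α_j = α_{π j} σ'` moves the matrix past
`α_j`, and the equivariance of `Φ` under `σ'` restores the summand. -/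
theorem upTilde_equiv {k : ℕ} (hk : Even k) {Φ : GL2 p → Dist p}
    (h : ∀ (g σ : GL2 p) (hσ : σ ∈ gammaZero p) (f : Tate p),
      Φ (g * σ) f = Φ g (tateAct k ⟨σ, gammaZero_subset hσ⟩ f))
    (g σ : GL2 p) (hσ : σ ∈ gammaZero p) (f : Tate p) :
    upTilde k Φ (g * σ) f = upTilde k Φ g (tateAct k ⟨σ, gammaZero_subset hσ⟩ f) := by
  obtain ⟨π, hπ, h1⟩ := gammaZero_alpha hσ
  rw [upTilde_apply, upTilde_apply, Finset.sum_range, Finset.sum_range,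
    ← hπ.sum_comp fun j : Fin p => Φ (g * alpha p j)
      (tateAct k ⟨(alpha p j)⁻¹, alpha_inv_mem j⟩ (tateAct k ⟨σ, gammaZero_subset hσ⟩ f))]
  refine Finset.sum_congr rfl fun j _ => ?_
  obtain ⟨σ', hσ', h2⟩ := h1 j
  rw [mul_assoc, h2, ← mul_assoc, h _ σ' hσ']
  have h3 : σ' * (alpha p j)⁻¹ = (alpha p (π j))⁻¹ * σ := by
    rw [mul_inv_eq_iff_eq_mul, mul_assoc, h2, inv_mul_cancel_left]
  exact congrArg (Φ (g * alpha p (π j))) (tateAct_tateAct_eq hk (τ₁ := ⟨σ', gammaZero_subset hσ'⟩)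
    (τ₂ := ⟨(alpha p j)⁻¹, alpha_inv_mem j⟩) (τ₃ := ⟨(alpha p (π j))⁻¹, alpha_inv_mem _⟩)
    (τ₄ := ⟨σ, gammaZero_subset hσ⟩) h3 f)

theorem tendsto_dist_apply {ω : ℕ → Dist p} {ω' : Dist p} (h : Tendsto ω atTop (𝓝 ω'))
    (f : Tate p) : Tendsto (fun n => ω n f) atTop (𝓝 (ω' f)) :=
  ((ContinuousLinearMap.apply ℚ_[p] ℚ_[p] f).continuous.tendsto ω').comp h

/-- All iterates lift `φ_c`, so consecutive differences vanish in degrees at most `k` and shrink by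
`|p|` at each step. The limit inherits every property of `IsEigenLift` that the iterates have, and
the eigenvalue equation follows by shifting the sequence. -/
theorem exists_eigenLift {k : ℕ} (hk : Even k) {Γ : Subgroup (GL2 p)} {c : Edge p → Vk p k}
    (hc : IsHarmonicCocycle k Γ c) {Φ₀ : GL2 p → Dist p} (hΦ₀ : Φ₀ ∈ formsInt' Γ k)
    (hlift : specialize k Φ₀ = cocycleForm k c) :
    ∃ Φ : GL2 p → Dist p, IsEigenLift k c Φ ∧ ∀ n g m,
      ‖((upTilde k)^[n] Φ₀) g (tateX m) - Φ g (tateX m)‖ ≤ ‖(p : ℚ_[p])‖ ^ n := by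
  set Ψ : ℕ → GL2 p → Dist p := fun n => (upTilde k)^[n] Φ₀ with hΨ
  have hs : ∀ n, Ψ (n + 1) = upTilde k (Ψ n) := fun n => Function.iterate_succ_apply' _ _ _
  have hsp : ∀ n, specialize k (Ψ n) = cocycleForm k c := by
    intro n
    induction n with
    | zero => exact hlift
    | succ n ih => rw [hs]; exact specialize_upTilde hk hc ih
  -- The case `n = 0` is the integrality of both `Φ₀` and `Ũ_p Φ₀`; each further iteration
  -- contributes a factor `|p|`.
  have hdiff : ∀ n g m, ‖Ψ n g (tateX m) - Ψ (n + 1) g (tateX m)‖ ≤ ‖(p : ℚ_[p])‖ ^ n := by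
    intro n
    induction n with
    | zero =>
      intro g m
      rw [pow_zero, hs]
      refine norm_sub_le_one ?_ (upTilde_norm_le_one hk hΦ₀ g m)
      simpa [hΨ] using norm_le_of_inPow (hΦ₀.2.2 g m)
    | succ n ih =>
      intro g m
      rw [hs (n + 1), hs n, pow_succ]
      exact upTilde_sub_norm_le hk (by rw [← hs, hsp, hsp]) (by rw [← hs]; exact ih) g m
  have hcauchy : ∀ g, CauchySeq fun n => Ψ n g := by
    intro g
    refine cauchySeq_of_le_geometric (α := Dist p) (f := fun n => Ψ n g) ‖(p : ℚ_[p])‖ 1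
      norm_p_lt_one fun n => ?_
    refine (dist_eq_norm (Ψ n g) (Ψ (n + 1) g)).trans_le ?_
    rw [one_mul]
    refine ContinuousLinearMap.opNorm_le_bound _ (by positivity) fun f => ?_
    exact dist_norm_le_of_tateX (hdiff n g) f
  choose Φ hΦ using fun g => cauchySeq_tendsto_of_complete (hcauchy g)
  have hlim : ∀ g f, Tendsto (fun n => Ψ n g f) atTop (𝓝 (Φ g f)) := fun g f =>
    tendsto_dist_apply (hΦ g) f
  -- Telescoping costs nothing in an ultrametric space, so the error of the limit is again `|p|^n`,
  -- without a constant.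
  have hfar : ∀ n g m l, ‖Ψ n g (tateX m) - Ψ (n + l) g (tateX m)‖ ≤ ‖(p : ℚ_[p])‖ ^ n := by
    intro n g m l
    induction l with
    | zero => simp
    | succ l ih =>
      rw [← sub_add_sub_cancel _ (Ψ (n + l) g (tateX m))]
      refine (IsUltrametricDist.norm_add_le_max _ _).trans (max_le ih ?_)
      exact (hdiff (n + l) g m).trans
        (pow_le_pow_of_le_one norm_p_pos.le norm_p_lt_one.le (Nat.le_add_right _ _))
  have happrox : ∀ n g m, ‖Ψ n g (tateX m) - Φ g (tateX m)‖ ≤ ‖(p : ℚ_[p])‖ ^ n := by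
    intro n g m
    have h1 : Tendsto (fun l => ‖Ψ n g (tateX m) - Ψ (n + l) g (tateX m)‖) atTop
        (𝓝 ‖Ψ n g (tateX m) - Φ g (tateX m)‖) := by
      refine (tendsto_const_nhds.sub ?_).norm
      have := (tendsto_add_atTop_iff_nat n).2 (hlim g (tateX m))
      simpa only [add_comm] using this
    exact le_of_tendsto h1 (Eventually.of_forall fun l => hfar n g m l)
  refine ⟨Φ, ⟨?_, ?_, ?_, ?_, ?_⟩, happrox⟩
  · intro u g
    have h : ∀ n (g : GL2 p), Ψ n (scalarGL u * g) = Ψ n g := by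
      intro n
      induction n with
      | zero =>
        intro g
        simpa [hΨ] using hΦ₀.2.1.left_inv u 1 (one_mem _) g
      | succ n ih =>
        intro g
        ext1 f
        rw [hs, upTilde_apply, upTilde_apply]
        simp only [mul_assoc, ih]
    refine tendsto_nhds_unique (hΦ _) ?_
    simpa only [h] using hΦ g
  · intro g σ hσ f
    have h : ∀ n (g σ : GL2 p) (hσ : σ ∈ gammaZero p) (f : Tate p),
        Ψ n (g * σ) f = Ψ n g (tateAct k ⟨σ, gammaZero_subset hσ⟩ f) := by
      intro n
      induction n with
      | zero =>
        intro g σ hσ f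
        exact DFunLike.congr_fun (hΦ₀.2.1.right_equiv g ⟨σ, hσ⟩) f
      | succ n ih => rw [hs]; exact upTilde_equiv hk ih
    refine tendsto_nhds_unique (hlim _ _) ?_
    simpa only [h _ g σ hσ f] using hlim g _
  · intro g f
    refine tendsto_nhds_unique ((tendsto_add_atTop_iff_nat 1).2 (hlim g f)) ?_
    simp only [hs, upTilde_apply]
    exact tendsto_finsetSum _ fun j _ => hlim _ _
  · intro g n
    have h1 := norm_sub_le_one (norm_le_of_inPow (hΦ₀.2.2 g n))
      ((happrox 0 g n).trans (pow_zero _).le)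
    simpa [hΨ] using h1
  · funext g
    ext P : 1
    refine tendsto_nhds_unique (hlim g _) ?_
    have : ∀ n, Ψ n g (polyToTate (P : ℚ_[p][X])) = cocycleForm k c g P := fun n => by
      rw [← specialize_apply, hsp]
    simp only [LinearMap.comp_apply, Submodule.subtype_apply, this]
    exact tendsto_const_nhds

/-! ### Expansions of locally analytic functions on balls -/

/-- `F` is the expansion of `f ·ₖ g` on `ℤ_p`, up to finitely many points. -/
def Represents (k : ℕ) (f : ℚ_[p] → ℚ_[p]) (g : GL2 p) (F : Tate p) : Prop :=
  {x | ‖x‖ ≤ 1 ∧ tateEval F x ≠ slash k f g x}.Finite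

theorem moebius_injective (g : GL2 p) {x y : ℚ_[p]} (hx : g 1 0 * x + g 1 1 ≠ 0)
    (hy : g 1 0 * y + g 1 1 ≠ 0) (h : (g 0 0 * x + g 0 1) / (g 1 0 * x + g 1 1)
      = (g 0 0 * y + g 0 1) / (g 1 0 * y + g 1 1)) : x = y := by
  rw [div_eq_div_iff hx hy] at h
  refine mul_left_cancel₀ (gl_det_ne_zero g) ?_
  linear_combination h

/-- Precomposition with the Möbius map of `τ⁻¹` carries exceptional points to exceptional points
injectively, so finiteness persists. -/
theorem Represents.act {k : ℕ} (hk : Even k) {f : ℚ_[p] → ℚ_[p]} {g : GL2 p} {F : Tate p}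
    (h : Represents k f g F) (τ : scaledSigmaZero p) :
    Represents k f (g * (τ.1)⁻¹) (tateAct k τ F) := by
  refine Set.Finite.of_injOn
    (f := fun x => ((τ.1)⁻¹ 0 0 * x + (τ.1)⁻¹ 0 1) / ((τ.1)⁻¹ 1 0 * x + (τ.1)⁻¹ 1 1)) ?_ ?_ h
  · rintro x ⟨hx, hne⟩
    refine ⟨inv_moebius_norm_le τ.2 hx, fun h1 => hne ?_⟩
    rw [tateEval_tateAct hk _ _ hx, ← slash_slash k _ _ _ (inv_denom τ.2 hx)]
    exact slash_congr k _ h1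
  · rintro x ⟨hx, -⟩ y ⟨hy, -⟩ hxy
    exact moebius_injective _ (inv_denom τ.2 hx) (inv_denom τ.2 hy) hxy

theorem Represents.mul_alpha {k : ℕ} (hk : Even k) {f : ℚ_[p] → ℚ_[p]} {g : GL2 p} {F : Tate p}
    (h : Represents k f g F) (j : ℕ) :
    Represents k f (g * alpha p j) (tateAct k ⟨(alpha p j)⁻¹, alpha_inv_mem j⟩ F) := by
  simpa only [inv_inv] using h.act hk ⟨(alpha p j)⁻¹, alpha_inv_mem j⟩

theorem Represents.unique {k : ℕ} {f : ℚ_[p] → ℚ_[p]} {g : GL2 p} {F F' : Tate p}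
    (h : Represents k f g F) (h' : Represents k f g F') : F = F' := by
  rw [← sub_eq_zero]
  refine tate_eq_zero_of_finite ((h.union h').subset ?_)
  rintro x ⟨hx, hne⟩
  by_contra hn
  simp only [Set.mem_union, Set.mem_ofPred_eq, hx, true_and, not_or, not_not] at hn
  rw [tateEval_sub _ _ hx, hn.1, hn.2, sub_self] at hne
  exact hne rfl

theorem Represents.add {k : ℕ} {f f' : ℚ_[p] → ℚ_[p]} {g : GL2 p} {F F' : Tate p}
    (h : Represents k f g F) (h' : Represents k f' g F') : Represents k (f + f') g (F + F') := by
  refine (h.union h').subset ?_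
  rintro x ⟨hx, hne⟩
  by_contra hn
  simp only [Set.mem_union, Set.mem_ofPred_eq, hx, true_and, not_or, not_not] at hn
  rw [tateEval_add _ _ hx, slash_add, Pi.add_apply, hn.1, hn.2] at hne
  exact hne rfl

theorem Represents.smul {k : ℕ} {f : ℚ_[p] → ℚ_[p]} {g : GL2 p} {F : Tate p} (r : ℚ_[p])
    (h : Represents k f g F) : Represents k (r • f) g (r • F) := by
  refine h.subset ?_
  rintro x ⟨hx, hne⟩
  refine ⟨hx, fun h1 => hne ?_⟩
  rw [tateEval_smul, slash_smul, Pi.smul_apply, smul_eq_mul, h1]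

theorem moebius_mem_ball (g : GL2 p) {x : ℚ_[p]} (hx : ‖x‖ ≤ 1) (h0 : g 1 0 * x + g 1 1 ≠ 0) :
    (g 0 0 * x + g 0 1) / (g 1 0 * x + g 1 1) ∈ affinePart (ball g) := by
  classical
  refine ⟨((x : ℚ_[p]) : OnePoint ℚ_[p]), ⟨⟨x, hx⟩, Set.mem_univ _, rfl⟩, ?_⟩
  have h1 := OnePoint.smul_some_eq_ite (g := g) (k := x)
  rw [if_neg h0] at h1
  convert h1

theorem represents_of_forall {k : ℕ} {f : ℚ_[p] → ℚ_[p]} {g : GL2 p} {F : Tate p}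
    (h : ∀ x : ℚ_[p], ‖x‖ ≤ 1 → g 1 0 * x + g 1 1 ≠ 0 → slash k f g x = tateEval F x) :
    Represents k f g F := by
  refine (finite_denom g).subset ?_
  rintro x ⟨hx, hne⟩
  by_contra h0
  exact hne (h x hx h0).symm

theorem represents_zero {k : ℕ} {f : ℚ_[p] → ℚ_[p]} {g : GL2 p}
    (h : ∀ x ∈ affinePart (ball g), f x = 0) : Represents k f g 0 := by
  refine represents_of_forall fun x hx h0 => ?_
  rw [tateEval_zero, slash, h _ (moebius_mem_ball g hx h0), mul_zero]

open Classical in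
/-- The expansion of `f ·ₖ g` on `ℤ_p`. -/
noncomputable def tatePart (k : ℕ) (f : ℚ_[p] → ℚ_[p]) (g : GL2 p) : Tate p :=
  if h : ∃ F, Represents k f g F then h.choose else 0

theorem tatePart_eq {k : ℕ} {f : ℚ_[p] → ℚ_[p]} {g : GL2 p} {F : Tate p}
    (h : Represents k f g F) : tatePart k f g = F := by
  have h1 : ∃ F, Represents k f g F := ⟨F, h⟩
  rw [tatePart, dif_pos h1]
  exact h1.choose_spec.unique h

theorem tatePart_of_not {k : ℕ} {f : ℚ_[p] → ℚ_[p]} {g : GL2 p}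
    (h : ¬ ∃ F, Represents k f g F) : tatePart k f g = 0 := dif_neg h

/-! ### Analyticity at a given level -/

/-- `f` is analytic on the balls `g (a + p^N ℤ_p)`. -/
def AnalyticLevel (k N : ℕ) (g : GL2 p) (f : ℚ_[p] → ℚ_[p]) : Prop :=
  ∀ a : ℚ_[p], ‖a‖ ≤ 1 → ∃ F, Represents k f (g * aff (pU p ^ N) a) F

theorem aff_one_zero : aff (1 : ℚ_[p]ˣ) 0 = 1 := by
  apply gl_ext <;> simp [aff_apply]

theorem norm_pU_pow_le (N : ℕ) : ‖((pU p ^ N : ℚ_[p]ˣ) : ℚ_[p])‖ ≤ 1 := by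
  rw [Units.val_pow_eq_pow_val, pU_val, norm_pow]
  exact pow_le_one₀ (norm_nonneg _) norm_p_lt_one.le

theorem Represents.mul_aff {k : ℕ} (hk : Even k) {f : ℚ_[p] → ℚ_[p]} {g : GL2 p} {F : Tate p}
    (h : Represents k f g F) {s : ℚ_[p]ˣ} {t : ℚ_[p]} (hs : ‖(s : ℚ_[p])‖ ≤ 1) (ht : ‖t‖ ≤ 1) :
    ∃ F', Represents k f (g * aff s t) F' := by
  refine ⟨tateAct k ⟨_, aff_inv_mem hs ht⟩ F, ?_⟩
  simpa only [inv_inv] using h.act hk ⟨_, aff_inv_mem hs ht⟩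

theorem analyticLevel_zero {k : ℕ} {g : GL2 p} {f : ℚ_[p] → ℚ_[p]} (h : AnalyticLevel k 0 g f) :
    ∃ F, Represents k f g F := by
  have := h 0 (by simp)
  rwa [pow_zero, aff_one_zero, mul_one] at this

theorem Represents.analyticLevel {k : ℕ} (hk : Even k) {f : ℚ_[p] → ℚ_[p]} {g : GL2 p} {F : Tate p}
    (h : Represents k f g F) : AnalyticLevel k 0 g f := fun _ ha =>
  h.mul_aff hk (norm_pU_pow_le 0) ha

theorem AnalyticLevel.mono {k : ℕ} (hk : Even k) {N M : ℕ} {g : GL2 p} {f : ℚ_[p] → ℚ_[p]}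
    (h : AnalyticLevel k N g f) (hNM : N ≤ M) : AnalyticLevel k M g f := by
  intro a ha
  obtain ⟨l, rfl⟩ := Nat.exists_eq_add_of_le hNM
  obtain ⟨F, hF⟩ := h a ha
  obtain ⟨F', hF'⟩ := hF.mul_aff hk (norm_pU_pow_le l) (t := 0) (by simp)
  rw [mul_assoc, aff_mul, ← pow_add, mul_zero, zero_add] at hF'
  exact ⟨F', hF'⟩

theorem AnalyticLevel.child {k N : ℕ} {g : GL2 p} {f : ℚ_[p] → ℚ_[p]}
    (h : AnalyticLevel k (N + 1) g f) (j : ℕ) : AnalyticLevel k N (g * alpha p j) f := by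
  intro a ha
  rw [mul_assoc, alpha_eq, aff_mul, ← pow_succ', pU_val]
  exact h _ (norm_add_le_one (norm_p_mul_lt_one ha).le (norm_nat_le_one j))

theorem AnalyticLevel.add {k N : ℕ} {g : GL2 p} {f f' : ℚ_[p] → ℚ_[p]}
    (h : AnalyticLevel k N g f) (h' : AnalyticLevel k N g f') : AnalyticLevel k N g (f + f') := by
  intro a ha
  obtain ⟨F, hF⟩ := h a ha
  obtain ⟨F', hF'⟩ := h' a ha
  exact ⟨_, hF.add hF'⟩

theorem AnalyticLevel.smul {k N : ℕ} {g : GL2 p} {f : ℚ_[p] → ℚ_[p]} (r : ℚ_[p])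
    (h : AnalyticLevel k N g f) : AnalyticLevel k N g (r • f) := by
  intro a ha
  obtain ⟨F, hF⟩ := h a ha
  exact ⟨_, hF.smul r⟩

/-- At a pole of `g` the image point is `∞`; there the expansion of `x^k f(1/x)` is used, and the
factor `(cx + d)^k` cancels the pole of order at most `k`. The agreement is on a punctured
neighbourhood because `f` carries no value at `∞`. -/
theorem exists_analytic_slash {k : ℕ} {f : ℚ_[p] → ℚ_[p]} (hf : f ∈ locAnalytic p k) (g : GL2 p)
    (x₀ : ℚ_[p]) : ∃ H : ℚ_[p] → ℚ_[p], AnalyticAt ℚ_[p] H x₀ ∧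
      ∀ᶠ x in 𝓝[≠] x₀, H x = slash k f g x := by
  have hl : ∀ r s : ℚ_[p], AnalyticAt ℚ_[p] (fun x => r * x + s) x₀ := fun r s =>
    (analyticAt_const.mul analyticAt_id).add analyticAt_const
  obtain ⟨hf1, h, hh, hfh⟩ := hf
  by_cases h0 : g 1 0 * x₀ + g 1 1 = 0
  · have hN : g 0 0 * x₀ + g 0 1 ≠ 0 := by
      intro hN
      refine gl_det_ne_zero g ?_
      by_cases hc : g 1 0 = 0
      · rw [hc] at h0 ⊢
        linear_combination g 0 0 * h0
      · refine mul_left_cancel₀ hc ?_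
        linear_combination (g 1 0 * g 0 0) * h0 - g 1 0 ^ 2 * hN
    have hw : AnalyticAt ℚ_[p] (fun x => (g 1 0 * x + g 1 1) / (g 0 0 * x + g 0 1)) x₀ :=
      (hl _ _).div (hl _ _) hN
    have hw0 : (g 1 0 * x₀ + g 1 1) / (g 0 0 * x₀ + g 0 1) = 0 := by rw [h0, zero_div]
    refine ⟨fun x => (g.1.det ^ (k / 2))⁻¹ * (g 0 0 * x + g 0 1) ^ k *
      h ((g 1 0 * x + g 1 1) / (g 0 0 * x + g 0 1)),
      (analyticAt_const.mul ((hl _ _).pow k)).mul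
        (AnalyticAt.fun_comp (g := h) (by rw [hw0]; exact hh) hw), ?_⟩
    have h1 : ∀ᶠ x in 𝓝[≠] x₀, g 1 0 * x + g 1 1 ≠ 0 := by
      filter_upwards [self_mem_nhdsWithin] with x hx h2
      have hx : x ≠ x₀ := hx
      refine hx (mul_left_cancel₀ (a := g 1 0) ?_ (by linear_combination h2 - h0))
      intro hc
      refine gl_det_ne_zero g ?_
      rw [hc] at h0 ⊢
      linear_combination g 0 0 * h0
    have h2 : ∀ᶠ x in 𝓝[≠] x₀, g 0 0 * x + g 0 1 ≠ 0 :=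
      ((hl _ _).continuousAt.eventually_ne hN).filter_mono nhdsWithin_le_nhds
    have h3 : Tendsto (fun x => (g 1 0 * x + g 1 1) / (g 0 0 * x + g 0 1)) (𝓝[≠] x₀) (𝓝[≠] 0) := by
      refine tendsto_nhdsWithin_iff.2 ⟨?_, ?_⟩
      · rw [← hw0]
        exact hw.continuousAt.tendsto.mono_left nhdsWithin_le_nhds
      · filter_upwards [h1, h2] with x hx1 hx2
        exact div_ne_zero hx1 hx2
    filter_upwards [h3.eventually hfh, h1, h2] with x hx hx1 hx2
    rw [hx, slash, inv_div, div_pow]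
    generalize f _ = y
    generalize g 1 0 * x + g 1 1 = A at *
    generalize g 0 0 * x + g 0 1 = B at *
    field_simp
  · refine ⟨slash k f g, ?_, Eventually.of_forall fun _ => rfl⟩
    exact (analyticAt_const.mul ((hl _ _).pow k)).mul
      (AnalyticAt.fun_comp (g := f) (hf1 _) ((hl _ _).div (hl _ _) h0))

/-- A power series with positive radius of convergence becomes an element of the Tate algebra after
the variable is scaled by a high enough power of `p`. -/
theorem exists_represents {k : ℕ} {f : ℚ_[p] → ℚ_[p]} (hf : f ∈ locAnalytic p k) (g : GL2 p)
    (x₀ : ℚ_[p]) : ∃ m : ℕ, ∃ F, Represents k f (g * aff (pU p ^ m) x₀) F := by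
  obtain ⟨H, ⟨P, hP⟩, hH⟩ := exists_analytic_slash hf g x₀
  rw [hasFPowerSeriesAt_iff] at hP
  have h1 : ∀ᶠ y in 𝓝 (0 : ℚ_[p]), y ≠ 0 → H (x₀ + y) = slash k f g (x₀ + y) := by
    have h2 : Tendsto (fun y : ℚ_[p] => x₀ + y) (𝓝 0) (𝓝 x₀) := by
      have h3 : Continuous fun y : ℚ_[p] => x₀ + y := by fun_prop
      simpa using h3.tendsto 0
    rw [eventually_nhdsWithin_iff] at hH
    filter_upwards [h2.eventually hH] with y hy hy0
    exact hy (by simpa using hy0)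
  obtain ⟨ε, hε, hball⟩ := Metric.eventually_nhds_iff.1 (hP.and h1)
  obtain ⟨m, hm⟩ := exists_pow_lt_of_lt_one hε (norm_p_lt_one (p := p))
  have hy : ∀ x : ℚ_[p], ‖x‖ ≤ 1 → dist ((p : ℚ_[p]) ^ m * x) 0 < ε := by
    intro x hx
    rw [dist_zero_right, norm_mul, norm_pow]
    exact (mul_le_of_le_one_right (by positivity) hx).trans_lt hm
  have hlim : Tendsto (fun n => P.coeff n * ((p : ℚ_[p]) ^ m) ^ n) atTop (𝓝 0) := by
    have h2 := (hball (hy 1 (by simp))).1.summable.tendsto_atTop_zero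
    simpa [mul_comm] using h2
  refine ⟨m, (((p : ℚ_[p]) ^ m) ^ (k / 2))⁻¹ • tateMk _ hlim, ?_⟩
  -- Only the centre can be exceptional: it may be the pole of `g`, where the function itself has no
  -- meaningful value.
  refine (Set.finite_singleton (0 : ℚ_[p])).subset ?_
  rintro x ⟨hx, hne⟩
  by_contra h0
  refine hne ?_
  obtain ⟨h2, h3⟩ := hball (hy x hx)
  have h3 := h3 (mul_ne_zero (pow_ne_zero _ p_ne_zero) h0)
  obtain ⟨a1, a2, a3, a4⟩ := aff_apply (pU p ^ m) x₀
  have h4 : tateEval (tateMk _ hlim) x = H (x₀ + (p : ℚ_[p]) ^ m * x) := by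
    rw [← h2.tsum_eq]
    refine tsum_congr fun n => ?_
    rw [smul_eq_mul, mul_pow]
    change P.coeff n * _ * x ^ n = _
    ring
  rw [tateEval_smul, ← slash_slash _ _ _ _ (by rw [a3, a4]; simp), slash, aff_det, a1, a2, a3, a4,
    h4, h3]
  simp [pU_val, add_comm]

/-- Compactness of `ℤ_p` makes the local radii of convergence uniform; smaller balls inherit an
expansion from larger ones. -/
theorem exists_analyticLevel {k : ℕ} (hk : Even k) {f : ℚ_[p] → ℚ_[p]} (hf : f ∈ locAnalytic p k)
    (g : GL2 p) : ∃ N, AnalyticLevel k N g f := by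
  have key : ∃ m : ℕ, ∀ N ≥ m, ∀ a ∈ Metric.closedBall (0 : ℚ_[p]) 1,
      ∃ F, Represents k f (g * aff (pU p ^ N) a) F := by
    refine (isCompact_closedBall (0 : ℚ_[p]) 1).induction_on
      (p := fun s => ∃ m : ℕ, ∀ N ≥ m, ∀ a ∈ s, ∃ F, Represents k f (g * aff (pU p ^ N) a) F)
      ⟨0, by simp⟩ ?_ ?_ ?_
    · rintro s t hst ⟨m, hm⟩
      exact ⟨m, fun N hN a ha => hm N hN a (hst ha)⟩
    · rintro s t ⟨m, hm⟩ ⟨m', hm'⟩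
      refine ⟨max m m', fun N hN a ha => ?_⟩
      rcases ha with ha | ha
      · exact hm N (le_of_max_le_left hN) a ha
      · exact hm' N (le_of_max_le_right hN) a ha
    · intro x₀ _
      obtain ⟨m, F, hF⟩ := exists_represents hf g x₀
      have hpm : 0 < ‖(p : ℚ_[p])‖ ^ m := pow_pos norm_p_pos m
      refine ⟨Metric.closedBall x₀ (‖(p : ℚ_[p])‖ ^ m),
        mem_nhdsWithin_of_mem_nhds (Metric.closedBall_mem_nhds _ hpm), m, fun N hN a ha => ?_⟩
      obtain ⟨l, rfl⟩ := Nat.exists_eq_add_of_le hN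
      have hpne : (p : ℚ_[p]) ^ m ≠ 0 := pow_ne_zero _ p_ne_zero
      have ht : ‖(a - x₀) / (p : ℚ_[p]) ^ m‖ ≤ 1 := by
        rw [norm_div, norm_pow, div_le_one hpm, ← dist_eq_norm]
        exact ha
      obtain ⟨F', hF'⟩ := hF.mul_aff hk (norm_pU_pow_le l) ht
      rw [mul_assoc, aff_mul, ← pow_add, Units.val_pow_eq_pow_val, pU_val, mul_div_cancel₀ _ hpne,
        sub_add_cancel] at hF'
      exact ⟨F', hF'⟩
  obtain ⟨m, hm⟩ := key
  exact ⟨m, fun a ha => hm m le_rfl a (by simpa using ha)⟩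

/-! ### Integrals over balls -/

/-- The integral of `f` over `g ℤ_p` with respect to `Φ`, for `f` analytic on the balls
`g (a + p^N ℤ_p)`. -/
noncomputable def levelInt (k : ℕ) (Φ : GL2 p → Dist p) : ℕ → GL2 p → (ℚ_[p] → ℚ_[p]) → ℚ_[p]
  | 0, g, f => Φ g (tatePart k f g)
  | N + 1, g, f => ∑ j ∈ Finset.range p, levelInt k Φ N (g * alpha p j) f

section

variable {k : ℕ} {c : Edge p → Vk p k} {Φ : GL2 p → Dist p}

/-- Splitting a ball on which `f` already has an expansion `F` replaces `Φ(g)(F)` by the right hand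
side of the equation `Ũ_p Φ = Φ`. -/
theorem levelInt_succ (hk : Even k) (hΦ : IsEigenLift k c Φ) {N : ℕ} {g : GL2 p}
    {f : ℚ_[p] → ℚ_[p]} (h : AnalyticLevel k N g f) :
    levelInt k Φ (N + 1) g f = levelInt k Φ N g f := by
  induction N generalizing g with
  | zero =>
    obtain ⟨F, hF⟩ := analyticLevel_zero h
    rw [levelInt, levelInt, tatePart_eq hF, hΦ.fixed g F]
    refine Finset.sum_congr rfl fun j _ => ?_
    rw [levelInt, tatePart_eq (hF.mul_alpha hk j)]
  | succ N ih =>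
    rw [levelInt, levelInt]
    exact Finset.sum_congr rfl fun j _ => ih (h.child j)

theorem levelInt_of_le (hk : Even k) (hΦ : IsEigenLift k c Φ) {N M : ℕ} (hNM : N ≤ M) {g : GL2 p}
    {f : ℚ_[p] → ℚ_[p]} (h : AnalyticLevel k N g f) :
    levelInt k Φ M g f = levelInt k Φ N g f := by
  induction M, hNM using Nat.le_induction with
  | base => rfl
  | succ M hM ih => rw [levelInt_succ hk hΦ (h.mono hk hM), ih]

theorem levelInt_add {N : ℕ} {g : GL2 p} {f f' : ℚ_[p] → ℚ_[p]} (h : AnalyticLevel k N g f)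
    (h' : AnalyticLevel k N g f') :
    levelInt k Φ N g (f + f') = levelInt k Φ N g f + levelInt k Φ N g f' := by
  induction N generalizing g with
  | zero =>
    obtain ⟨F, hF⟩ := analyticLevel_zero h
    obtain ⟨F', hF'⟩ := analyticLevel_zero h'
    rw [levelInt, levelInt, levelInt, tatePart_eq hF, tatePart_eq hF', tatePart_eq (hF.add hF'),
      map_add]
  | succ N ih =>
    rw [levelInt, levelInt, levelInt, ← Finset.sum_add_distrib]
    exact Finset.sum_congr rfl fun j _ => ih (h.child j) (h'.child j)

theorem levelInt_smul {N : ℕ} {g : GL2 p} {f : ℚ_[p] → ℚ_[p]} (r : ℚ_[p])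
    (h : AnalyticLevel k N g f) : levelInt k Φ N g (r • f) = r * levelInt k Φ N g f := by
  induction N generalizing g with
  | zero =>
    obtain ⟨F, hF⟩ := analyticLevel_zero h
    rw [levelInt, levelInt, tatePart_eq hF, tatePart_eq (hF.smul r), map_smul, smul_eq_mul]
  | succ N ih =>
    rw [levelInt, levelInt, Finset.mul_sum]
    exact Finset.sum_congr rfl fun j _ => ih (h.child j)

theorem levelInt_scalar (hk : Even k) (hΦ : IsEigenLift k c Φ) (u : ℚ_[p]ˣ) (N : ℕ) (g : GL2 p)
    (f : ℚ_[p] → ℚ_[p]) : levelInt k Φ N (scalarGL u * g) f = levelInt k Φ N g f := by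
  induction N generalizing g with
  | zero =>
    have e : Represents k f (scalarGL u * g) = Represents k f g := by
      funext F
      rw [Represents, Represents, slash_scalar hk]
    rw [levelInt, levelInt, hΦ.scalar]
    by_cases h : ∃ F, Represents k f g F
    · obtain ⟨F, hF⟩ := h
      rw [tatePart_eq hF, tatePart_eq (e ▸ hF)]
    · rw [tatePart_of_not h, tatePart_of_not (e ▸ h)]
  | succ N ih =>
    rw [levelInt, levelInt]
    exact Finset.sum_congr rfl fun j _ => by rw [mul_assoc, ih]

theorem gammaZero_inv {σ : GL2 p} (hσ : σ ∈ gammaZero p) : σ⁻¹ ∈ gammaZero p := by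
  obtain ⟨h1, h2, h3⟩ := hσ
  obtain ⟨e1, e2, e3, e4⟩ := gl_inv_apply σ
  refine ⟨?_, by rw [gl_inv_det, norm_inv, h2, inv_one], ?_⟩
  · intro i j
    fin_cases i <;> fin_cases j <;> simp [-Matrix.coe_units_inv, e1, e2, e3, e4, h2, h1]
  · rw [e3, norm_neg, norm_mul, norm_inv, h2, inv_one, one_mul]
    exact h3

/-- On a single ball this is the equivariance of `Φ`; at higher level `Γ₀(p)` only permutes the
balls of the subdivision. Thus the integral depends on the ball `g ℤ_p` and not on the
representative `g`. -/
theorem levelInt_gammaZero (hk : Even k) (hΦ : IsEigenLift k c Φ) (N : ℕ) (g : GL2 p) {σ : GL2 p}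
    (hσ : σ ∈ gammaZero p) (f : ℚ_[p] → ℚ_[p]) :
    levelInt k Φ N (g * σ) f = levelInt k Φ N g f := by
  induction N generalizing g σ with
  | zero =>
    rw [levelInt, levelInt]
    by_cases h : ∃ F, Represents k f (g * σ) F
    · obtain ⟨F, hF⟩ := h
      have h1 := hF.act hk ⟨σ, gammaZero_subset hσ⟩
      rw [mul_inv_cancel_right] at h1
      rw [tatePart_eq hF, tatePart_eq h1, hΦ.equiv _ _ hσ]
    -- Existence of an expansion is itself `Γ₀(p)`-invariant, so the default value `0` occurs on
    -- both sides simultaneously.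
    · rw [tatePart_of_not h, tatePart_of_not, map_zero, map_zero]
      rintro ⟨F, hF⟩
      have h1 := hF.act hk ⟨σ⁻¹, gammaZero_subset (gammaZero_inv hσ)⟩
      rw [inv_inv] at h1
      exact h ⟨_, h1⟩
  | succ N ih =>
    obtain ⟨π, hπ, h1⟩ := gammaZero_alpha hσ
    rw [levelInt, levelInt, Finset.sum_range, Finset.sum_range,
      ← hπ.sum_comp fun j : Fin p => levelInt k Φ N (g * alpha p j) f]
    refine Finset.sum_congr rfl fun j _ => ?_
    obtain ⟨σ', hσ', h2⟩ := h1 j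
    rw [mul_assoc, h2, ← mul_assoc, ih _ hσ']

open Classical in
/-- The integral of the locally analytic function `f` over `g ℤ_p` with respect to `Φ`. -/
noncomputable def ballInt (k : ℕ) (Φ : GL2 p → Dist p) (g : GL2 p) (f : ℚ_[p] → ℚ_[p]) : ℚ_[p] :=
  if h : ∃ N, AnalyticLevel k N g f then levelInt k Φ h.choose g f else 0

/-- The level chosen in the definition is irrelevant: any two admissible levels are compared with
their maximum. -/
theorem ballInt_eq (hk : Even k) (hΦ : IsEigenLift k c Φ) {N : ℕ} {g : GL2 p} {f : ℚ_[p] → ℚ_[p]}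
    (h : AnalyticLevel k N g f) : ballInt k Φ g f = levelInt k Φ N g f := by
  have h1 : ∃ N, AnalyticLevel k N g f := ⟨N, h⟩
  rw [ballInt, dif_pos h1, ← levelInt_of_le hk hΦ (le_max_left _ N) h1.choose_spec,
    levelInt_of_le hk hΦ (le_max_right _ N) h]

theorem ballInt_of_represents (hk : Even k) (hΦ : IsEigenLift k c Φ) {g : GL2 p}
    {f : ℚ_[p] → ℚ_[p]} {F : Tate p} (h : Represents k f g F) : ballInt k Φ g f = Φ g F := by
  rw [ballInt_eq hk hΦ (h.analyticLevel hk), levelInt, tatePart_eq h]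

theorem ballInt_sum (hk : Even k) (hΦ : IsEigenLift k c Φ) {f : ℚ_[p] → ℚ_[p]}
    (hf : f ∈ locAnalytic p k) (g : GL2 p) :
    ballInt k Φ g f = ∑ j ∈ Finset.range p, ballInt k Φ (g * alpha p j) f := by
  obtain ⟨N, hN⟩ := exists_analyticLevel hk hf g
  have h1 := hN.mono hk N.le_succ
  rw [ballInt_eq hk hΦ h1, levelInt]
  exact Finset.sum_congr rfl fun j _ => (ballInt_eq hk hΦ (h1.child j)).symm

theorem ballInt_add (hk : Even k) (hΦ : IsEigenLift k c Φ) {f f' : ℚ_[p] → ℚ_[p]}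
    (hf : f ∈ locAnalytic p k) (hf' : f' ∈ locAnalytic p k) (g : GL2 p) :
    ballInt k Φ g (f + f') = ballInt k Φ g f + ballInt k Φ g f' := by
  obtain ⟨N, hN⟩ := exists_analyticLevel hk hf g
  obtain ⟨M, hM⟩ := exists_analyticLevel hk hf' g
  have h1 := hN.mono hk (le_max_left N M)
  have h2 := hM.mono hk (le_max_right N M)
  rw [ballInt_eq hk hΦ h1, ballInt_eq hk hΦ h2, ballInt_eq hk hΦ (h1.add h2), levelInt_add h1 h2]

theorem ballInt_smul (hk : Even k) (hΦ : IsEigenLift k c Φ) {f : ℚ_[p] → ℚ_[p]}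
    (hf : f ∈ locAnalytic p k) (r : ℚ_[p]) (g : GL2 p) :
    ballInt k Φ g (r • f) = r * ballInt k Φ g f := by
  obtain ⟨N, hN⟩ := exists_analyticLevel hk hf g
  rw [ballInt_eq hk hΦ hN, ballInt_eq hk hΦ (hN.smul r), levelInt_smul r hN]

theorem ballInt_scalar (hk : Even k) (hΦ : IsEigenLift k c Φ) {f : ℚ_[p] → ℚ_[p]}
    (hf : f ∈ locAnalytic p k) (u : ℚ_[p]ˣ) (g : GL2 p) :
    ballInt k Φ (scalarGL u * g) f = ballInt k Φ g f := by
  obtain ⟨N, hN⟩ := exists_analyticLevel hk hf g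
  obtain ⟨M, hM⟩ := exists_analyticLevel hk hf (scalarGL u * g)
  rw [ballInt_eq hk hΦ (hN.mono hk (le_max_left N M)),
    ballInt_eq hk hΦ (hM.mono hk (le_max_right N M)), levelInt_scalar hk hΦ]

theorem ballInt_gammaZero (hk : Even k) (hΦ : IsEigenLift k c Φ) {f : ℚ_[p] → ℚ_[p]}
    (hf : f ∈ locAnalytic p k) (g : GL2 p) {σ : GL2 p} (hσ : σ ∈ gammaZero p) :
    ballInt k Φ (g * σ) f = ballInt k Φ g f := by
  obtain ⟨N, hN⟩ := exists_analyticLevel hk hf g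
  obtain ⟨M, hM⟩ := exists_analyticLevel hk hf (g * σ)
  rw [ballInt_eq hk hΦ (hN.mono hk (le_max_left N M)),
    ballInt_eq hk hΦ (hM.mono hk (le_max_right N M)), levelInt_gammaZero hk hΦ _ _ hσ]

end

/-! ### Decomposition and generation of `GL₂(ℚ_p)` -/

/-- The lower triangular unipotent matrix `(1 0; y 1)`. -/
noncomputable def lowU (y : ℚ_[p]) : GL2 p :=
  Matrix.GeneralLinearGroup.mkOfDetNeZero !![1, 0; y, 1] (by simp)

theorem lowU_apply (y : ℚ_[p]) : lowU y 0 0 = 1 ∧ lowU y 0 1 = 0 ∧ lowU y 1 0 = y ∧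
    lowU y 1 1 = 1 := by
  simp [lowU]

theorem lowU_mem {y : ℚ_[p]} (hy : ‖y‖ < 1) : lowU y ∈ gammaZero p := by
  obtain ⟨h1, h2, h3, h4⟩ := lowU_apply y
  refine ⟨?_, by rw [gl_det, h1, h2, h3, h4]; simp, by rwa [h3]⟩
  intro i j
  fin_cases i <;> fin_cases j <;> simp [h1, h2, h3, h4, hy.le]

theorem aff_mem {s : ℚ_[p]ˣ} {t : ℚ_[p]} (hs : ‖(s : ℚ_[p])‖ = 1) (ht : ‖t‖ ≤ 1) :
    aff s t ∈ gammaZero p := by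
  obtain ⟨h1, h2, h3, h4⟩ := aff_apply s t
  refine ⟨?_, by rw [aff_det, hs], by rw [h3]; simp⟩
  intro i j
  fin_cases i <;> fin_cases j <;> simp [h1, h2, h3, h4, hs, ht]

theorem affZ_apply (s : ℚ_[p]ˣ) (t : ℚ_[p]) : (aff s t * gZero p) 0 0 = p * t ∧
    (aff s t * gZero p) 0 1 = s ∧ (aff s t * gZero p) 1 0 = p ∧ (aff s t * gZero p) 1 1 = 0 := by
  obtain ⟨a1, a2, a3, a4⟩ := aff_apply s t
  obtain ⟨b1, b2, b3, b4⟩ := gZero_apply (p := p)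
  simp only [gl_mul_apply, a1, a2, a3, a4, b1, b2, b3, b4]
  refine ⟨?_, ?_, ?_, ?_⟩ <;> ring

/-- If `|c| < |d|`, the denominator has no zero on `ℤ_p` and the ball is a disc in `ℚ_p`; otherwise
the ball contains `∞` and is the complement of such a disc. The two normal forms correspond to the
two clauses of the growth condition. -/
theorem exists_decomposition (g : GL2 p) : ∃ (u s : ℚ_[p]ˣ) (t : ℚ_[p]) (σ : GL2 p),
    σ ∈ gammaZero p ∧ (g = scalarGL u * (aff s t * σ) ∨
      g = scalarGL u * (aff s t * gZero p * σ)) := by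
  have hdet := gl_det_ne_zero g
  rcases lt_or_ge ‖g 1 0‖ ‖g 1 1‖ with h | h
  · have hd : g 1 1 ≠ 0 := norm_pos_iff.1 ((norm_nonneg _).trans_lt h)
    refine ⟨Units.mk0 _ hd, Units.mk0 _ (div_ne_zero hdet (pow_ne_zero 2 hd)), g 0 1 / g 1 1,
      lowU (g 1 0 / g 1 1), lowU_mem ?_, Or.inl ?_⟩
    · rw [norm_div, div_lt_one (norm_pos_iff.2 hd)]; exact h
    · obtain ⟨h1, h2, h3, h4⟩ := lowU_apply (g 1 0 / g 1 1)
      apply gl_ext <;> rw [scalarGL_mul_apply, gl_mul_apply] <;>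
        simp only [h1, h2, h3, h4, aff_apply, Units.val_mk0] <;> field_simp <;> ring
  · have hc : g 1 0 ≠ 0 := by
      intro hc
      rw [hc, norm_zero] at h
      have hd : g 1 1 = 0 := norm_le_zero_iff.1 h
      exact hdet (by rw [hc, hd]; ring)
    have hp := p_ne_zero (p := p)
    refine ⟨Units.mk0 _ (div_ne_zero hc hp),
      Units.mk0 _ (div_ne_zero (neg_ne_zero.2 (mul_ne_zero hp hdet)) (pow_ne_zero 2 hc)),
      g 0 0 / g 1 0, aff 1 (g 1 1 / g 1 0), aff_mem (by simp) ?_, Or.inr ?_⟩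
    · rw [norm_div, div_le_one (norm_pos_iff.2 hc)]; exact h
    · obtain ⟨h1, h2, h3, h4⟩ := aff_apply 1 (g 1 1 / g 1 0)
      apply gl_ext <;> rw [scalarGL_mul_apply, gl_mul_apply] <;>
        simp only [h1, h2, h3, h4, affZ_apply, Units.val_mk0, Units.val_one] <;> field_simp <;> ring

/-- The homomorphism `s ↦ (s 0; 0 1)`. -/
noncomputable def diagHom (p : ℕ) [Fact p.Prime] : ℚ_[p]ˣ →* GL2 p where
  toFun s := aff s 0
  map_one' := aff_one_zero
  map_mul' s s' := by rw [aff_mul, mul_zero, add_zero]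

theorem diagHom_apply (s : ℚ_[p]ˣ) : diagHom p s = aff s 0 := rfl

/-- `GL₂(ℚ_p)` is generated by the scalars, `Γ₀(p)`, `α_0` and `g₀`. -/
theorem mem_of_generators {H : Subgroup (GL2 p)} (h1 : ∀ u, scalarGL u ∈ H)
    (h2 : gammaZero p ⊆ H) (h3 : alpha p 0 ∈ H) (h4 : gZero p ∈ H) (g : GL2 p) : g ∈ H := by
  have hp : diagHom p (pU p) ∈ H := by
    rw [diagHom_apply]
    rw [alpha_eq, Nat.cast_zero] at h3
    exact h3
  have hdiag : ∀ s, diagHom p s ∈ H := by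
    intro s
    -- A power of `p` times a unit; the unit part lies in `Γ₀(p)`.
    have hs : s = pU p ^ (s : ℚ_[p]).valuation * (pU p ^ (-(s : ℚ_[p]).valuation) * s) := by
      rw [← mul_assoc, ← zpow_add, add_neg_cancel, zpow_zero, one_mul]
    rw [hs, map_mul, map_zpow]
    refine mul_mem (zpow_mem hp _) (h2 (aff_mem ?_ (by simp)))
    rw [Units.val_mul, Units.val_zpow_eq_zpow_val, norm_mul, norm_zpow, pU_val,
      Padic.norm_eq_zpow_neg_valuation s.ne_zero, Padic.norm_p, inv_zpow, ← zpow_neg, neg_neg,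
      ← zpow_add₀ (by exact_mod_cast (Fact.out : p.Prime).ne_zero), add_neg_cancel, zpow_zero]
  have haff : ∀ s t, aff s t ∈ H := by
    intro s t
    obtain ⟨N, hN⟩ : ∃ N : ℕ, ‖(p : ℚ_[p]) ^ N * t‖ ≤ 1 := by
      have h5 : Tendsto (fun N : ℕ => ‖(p : ℚ_[p])‖ ^ N * ‖t‖) atTop (𝓝 0) := by
        simpa using (tendsto_pow_atTop_nhds_zero_of_lt_one (norm_nonneg _)
          (norm_p_lt_one (p := p))).mul_const ‖t‖
      obtain ⟨N, hN⟩ := (h5.eventually (gt_mem_nhds one_pos)).exists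
      exact ⟨N, by rw [norm_mul, norm_pow]; exact hN.le⟩
    -- Conjugation by a large power of `diag(p, 1)` makes the translation integral.
    have e : aff s t = (diagHom p (pU p ^ N))⁻¹ *
        (aff 1 ((p : ℚ_[p]) ^ N * t) * diagHom p (pU p ^ N * s)) := by
      rw [eq_inv_mul_iff_mul_eq, diagHom_apply, diagHom_apply, aff_mul, aff_mul]
      simp [pU_val]
    rw [e]
    exact mul_mem (inv_mem (hdiag _)) (mul_mem (h2 (aff_mem (by simp) hN)) (hdiag _))
  obtain ⟨u, s, t, σ, hσ, rfl | rfl⟩ := exists_decomposition g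
  · exact mul_mem (h1 u) (mul_mem (haff _ _) (h2 hσ))
  · exact mul_mem (h1 u) (mul_mem (mul_mem (haff _ _) h4) (h2 hσ))

/-! ### The measure attached to an eigenform -/

/-- The Atkin–Lehner element `g₀` normalizes `Γ₀(p)`: it exchanges the diagonal entries, and sends
the off-diagonal entries `b, c` to `c/p, pb`. -/
theorem gZero_conj_mem {σ : GL2 p} (hσ : σ ∈ gammaZero p) :
    (gZero p)⁻¹ * (σ * gZero p) ∈ gammaZero p := by
  obtain ⟨h1, h2, h3⟩ := hσ
  obtain ⟨b1, b2, b3, b4⟩ := gZero_apply (p := p)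
  obtain ⟨c1, c2, c3, c4⟩ := gl_inv_apply (gZero p)
  have hdet : (gZero p).1.det = -p := by rw [gl_det, b1, b2, b3, b4]; ring
  have hp := p_ne_zero (p := p)
  obtain ⟨y, hy, hy2⟩ := exists_eq_p_mul h3
  rw [hdet, b4, mul_zero] at c1
  rw [hdet, b2] at c2
  rw [hdet, b3] at c3
  rw [hdet, b1, mul_zero] at c4
  have e00 : ((gZero p)⁻¹ * (σ * gZero p)) 0 0 = σ 1 1 := by
    simp only [gl_mul_apply, b1, b3, c1, c2]
    field_simp
    ring
  have e01 : ((gZero p)⁻¹ * (σ * gZero p)) 0 1 = y := by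
    simp only [gl_mul_apply, b2, b4, c1, c2, hy2]
    field_simp
    ring
  have e10 : ((gZero p)⁻¹ * (σ * gZero p)) 1 0 = p * σ 0 1 := by
    simp only [gl_mul_apply, b1, b3, c3, c4]
    field_simp
    ring
  have e11 : ((gZero p)⁻¹ * (σ * gZero p)) 1 1 = σ 0 0 := by
    simp only [gl_mul_apply, b2, b4, c3, c4]
    field_simp
    ring
  refine ⟨?_, ?_, ?_⟩
  · intro r s
    fin_cases r <;> fin_cases s
    · exact e00 ▸ h1 1 1
    · exact e01 ▸ hy
    · exact e10 ▸ (norm_p_mul_lt_one (h1 _ _)).le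
    · exact e11 ▸ h1 0 0
  · rw [gl_det_mul, gl_det_mul, gl_inv_det, mul_comm, mul_assoc,
      mul_inv_cancel₀ (gZero p).det_ne_zero, mul_one, h2]
  · rw [e10]
    exact norm_p_mul_lt_one (h1 _ _)

theorem gZero_mul_gZero : gZero p * gZero p = scalarGL (pU p) := by
  obtain ⟨b1, b2, b3, b4⟩ := gZero_apply (p := p)
  rw [← mul_one (scalarGL (pU p))]
  apply gl_ext <;> rw [gl_mul_apply, scalarGL_mul_apply] <;> simp [b1, b2, b3, b4, pU_val]

/-- The matrix `(0 1; 1 0)`. -/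
noncomputable def swapGL (p : ℕ) [Fact p.Prime] : GL2 p :=
  Matrix.GeneralLinearGroup.mkOfDetNeZero !![0, 1; 1, 0] (by simp)

theorem swapGL_apply : swapGL p 0 0 = 0 ∧ swapGL p 0 1 = 1 ∧ swapGL p 1 0 = 1 ∧
    swapGL p 1 1 = 0 := by
  simp [swapGL]

theorem alpha_zero_mul_gZero : alpha p 0 * gZero p = scalarGL (pU p) * swapGL p := by
  obtain ⟨a1, a2, a3, a4⟩ := alpha_apply (p := p) 0
  obtain ⟨b1, b2, b3, b4⟩ := gZero_apply (p := p)
  obtain ⟨c1, c2, c3, c4⟩ := swapGL_apply (p := p)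
  apply gl_ext <;> rw [gl_mul_apply, scalarGL_mul_apply] <;>
    simp [a1, a2, a3, a4, b1, b2, b3, b4, c1, c2, c3, c4, pU_val]

theorem swapGL_mul_alpha_zero : swapGL p * alpha p 0 = gZero p := by
  obtain ⟨a1, a2, a3, a4⟩ := alpha_apply (p := p) 0
  obtain ⟨b1, b2, b3, b4⟩ := gZero_apply (p := p)
  obtain ⟨c1, c2, c3, c4⟩ := swapGL_apply (p := p)
  apply gl_ext <;> rw [gl_mul_apply] <;> simp [a1, a2, a3, a4, b1, b2, b3, b4, c1, c2, c3, c4]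

theorem norm_nat_eq_one {j : ℕ} (hj : j < p) (hj0 : j ≠ 0) : ‖(j : ℚ_[p])‖ = 1 := by
  refine le_antisymm (norm_nat_le_one j) ?_
  by_contra! h
  exact hj0 (eq_of_norm_sub_lt_one (Fact.out : p.Prime).pos hj (by simpa using h))

/-- Modulo `Γ₀(p)`, the matrices `(0 1; 1 0) α_j` for `j ≠ 0` are a permutation of the `α_j`
for `j ≠ 0`. -/
theorem sum_swapGL {M : Type*} [AddCommMonoid M] {F : GL2 p → M}
    (hF : ∀ g, ∀ σ ∈ gammaZero p, F (g * σ) = F g) (g : GL2 p) :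
    ∑ j ∈ (Finset.range p).erase 0, F (g * (swapGL p * alpha p j))
      = ∑ j ∈ (Finset.range p).erase 0, F (g * alpha p j) := by
  -- The matrix `(0 1; 1 0)` acts by inversion, so `i` is the inverse of `j` modulo `p`.
  have hex : ∀ j, ∃ i, j ∈ (Finset.range p).erase 0 →
      i ∈ (Finset.range p).erase 0 ∧ ‖1 - (i : ℚ_[p]) * j‖ < 1 := by
    intro j
    by_cases hj : j ∈ (Finset.range p).erase 0
    · rw [Finset.mem_erase, Finset.mem_range] at hj
      have hj1 := norm_nat_eq_one hj.2 hj.1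
      have hj0 : (j : ℚ_[p]) ≠ 0 := norm_ne_zero_iff.1 (by rw [hj1]; exact one_ne_zero)
      obtain ⟨i, hi, h⟩ := exists_residue (x := (j : ℚ_[p])⁻¹) (by rw [norm_inv, hj1, inv_one])
      refine ⟨i, fun _ => ⟨Finset.mem_erase.2 ⟨?_, Finset.mem_range.2 hi⟩, ?_⟩⟩
      · rintro rfl
        rw [Nat.cast_zero, sub_zero, norm_inv, hj1, inv_one] at h
        exact lt_irrefl _ h
      · have e : 1 - (i : ℚ_[p]) * j = ((j : ℚ_[p])⁻¹ - i) * j := by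
          rw [sub_mul, inv_mul_cancel₀ hj0]
        rw [e, norm_mul, hj1, mul_one]
        exact h
    · exact ⟨0, fun h => absurd h hj⟩
  choose π hπ using hex
  have hinj : Set.InjOn π ((Finset.range p).erase 0) := by
    intro i hi j hj hij
    have h1 := (hπ i hi).2
    have h2 := (hπ j hj).2
    rw [← hij] at h2
    have h3 := (hπ i hi).1
    rw [Finset.mem_erase, Finset.mem_range] at h3
    have h4 := norm_nat_eq_one h3.2 h3.1
    have h5 : ‖(π i : ℚ_[p]) * ((i : ℚ_[p]) - j)‖ < 1 := by
      have e : (π i : ℚ_[p]) * ((i : ℚ_[p]) - j) = (1 - (π i : ℚ_[p]) * j) +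
        -(1 - (π i : ℚ_[p]) * i) := by ring
      rw [e]
      exact (IsUltrametricDist.norm_add_le_max _ _).trans_lt (max_lt h2 (by rwa [norm_neg]))
    rw [norm_mul, h4, one_mul] at h5
    have hi := Finset.mem_range.1 (Finset.mem_of_mem_erase hi)
    have hj := Finset.mem_range.1 (Finset.mem_of_mem_erase hj)
    exact eq_of_norm_sub_lt_one hj hi h5
  have hmaps : Set.MapsTo π ((Finset.range p).erase 0) ((Finset.range p).erase 0) :=
    fun j hj => (hπ j hj).1
  refine Finset.sum_nbij π (fun j hj => (hπ j hj).1) hinj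
    (Finset.surjOn_of_injOn_of_card_le π hmaps hinj le_rfl) fun j hj => ?_
  obtain ⟨c1, c2, c3, c4⟩ := swapGL_apply (p := p)
  have hmem : (alpha p (π j))⁻¹ * (swapGL p * alpha p j) ∈ gammaZero p := by
    refine alpha_inv_mul_mem ?_ ?_ ?_
    · intro r s
      fin_cases r <;> fin_cases s <;> simp [c1, c2, c3, c4]
    · rw [gl_det, c1, c2, c3, c4]; simp
    · rw [c1, c2, c3, c4]
      simpa using (hπ j hj).2
  rw [← hF (g * alpha p (π j)) _ hmem, mul_assoc, mul_inv_cancel_left]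

/-- Write `g⁻¹ x = N/D`. The first ball requires `|N| ≤ |D|`, the second `|D| ≤ |p||N|` with `N ≠
0`. -/
theorem ball_disjoint (g : GL2 p) {x : ℚ_[p]} (h1 : x ∈ affinePart (ball g))
    (h2 : x ∈ affinePart (ball (g * gZero p))) : False := by
  rw [mem_affinePart_ball] at h1 h2
  obtain ⟨b1, b2, b3, b4⟩ := gZero_apply (p := p)
  obtain ⟨c1, c2, c3, c4⟩ := gl_inv_apply (gZero p)
  have hdet : (gZero p).1.det = -p := by rw [gl_det, b1, b2, b3, b4]; ring
  have hp := p_ne_zero (p := p)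
  rw [hdet, b4, mul_zero] at c1
  rw [hdet, b2, mul_one, inv_neg, neg_neg] at c2
  rw [hdet, b3, inv_neg, neg_mul, neg_neg, inv_mul_cancel₀ hp] at c3
  rw [hdet, b1, mul_zero] at c4
  rw [mul_inv_rev] at h2
  simp only [gl_mul_apply, c1, c2, c3, c4, zero_mul, zero_add, one_mul, add_zero, mul_assoc,
    ← mul_add] at h1 h2
  set N := g⁻¹ 0 0 * x + g⁻¹ 0 1
  set D := g⁻¹ 1 0 * x + g⁻¹ 1 1
  obtain ⟨hD, h1⟩ := h1
  obtain ⟨hN, h2⟩ := h2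
  have hD' := norm_pos_iff.2 hD
  have hN' := norm_pos_iff.2 hN
  rw [norm_div, div_le_one hD'] at h1
  rw [norm_div, div_le_one hN', norm_mul, norm_inv, inv_mul_le_iff₀ norm_p_pos] at h2
  have h3 : ‖(p : ℚ_[p])‖ * ‖N‖ < ‖N‖ := mul_lt_of_lt_one_left hN' norm_p_lt_one
  linarith

section

variable {k : ℕ} {c : Edge p → Vk p k} {Φ : GL2 p → Dist p}

/-- The sum of the integrals over `g ℤ_p` and over its complement does not depend on `g`. -/
theorem ballInt_add_compl (hk : Even k) (hΦ : IsEigenLift k c Φ) {f : ℚ_[p] → ℚ_[p]}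
    (hf : f ∈ locAnalytic p k) (g : GL2 p) :
    ballInt k Φ g f + ballInt k Φ (g * gZero p) f
      = ballInt k Φ 1 f + ballInt k Φ (1 * gZero p) f := by
  set J : GL2 p → ℚ_[p] := fun g => ballInt k Φ g f + ballInt k Φ (g * gZero p) f with hJ
  -- The right translations that preserve `J` form a subgroup, so invariance need only be tested on
  -- generators.
  let H : Subgroup (GL2 p) :=
    { carrier := {h | ∀ g, J (g * h) = J g}
      mul_mem' := fun {a b} ha hb g => by rw [← mul_assoc, hb, ha]
      one_mem' := fun g => by rw [mul_one]
      inv_mem' := fun {a} ha g => by rw [← ha (g * a⁻¹), inv_mul_cancel_right] }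
  have hH : ∀ g, g ∈ H := by
    refine mem_of_generators ?_ ?_ ?_ ?_
    · intro u g
      rw [← Matrix.GeneralLinearGroup.scalar_commute]
      simp only [hJ]
      rw [mul_assoc, ballInt_scalar hk hΦ hf, ballInt_scalar hk hΦ hf]
    · intro σ hσ g
      simp only [hJ]
      have e : g * σ * gZero p = g * gZero p * ((gZero p)⁻¹ * (σ * gZero p)) := by group
      rw [e, ballInt_gammaZero hk hΦ hf _ hσ, ballInt_gammaZero hk hΦ hf _ (gZero_conj_mem hσ)]
    -- For `α_0`, both totals are integrals over the same `p + 1` balls. The complement of `g α_0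
    -- ℤ_p` is `g (0 1; 1 0) ℤ_p`; its child at `j = 0` is `g g₀ ℤ_p`, and its other children are
    -- the `g α_j ℤ_p` with `j ≠ 0`.
    · intro g
      simp only [hJ]
      have h0 : 0 ∈ Finset.range p := Finset.mem_range.2 (Fact.out : p.Prime).pos
      rw [mul_assoc, alpha_zero_mul_gZero, ← mul_assoc, ← Matrix.GeneralLinearGroup.scalar_commute,
        mul_assoc, ballInt_scalar hk hΦ hf, ballInt_sum hk hΦ hf (g * swapGL p),
        ballInt_sum hk hΦ hf g, ← Finset.add_sum_erase _ _ h0, ← Finset.add_sum_erase _ _ h0]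
      simp only [mul_assoc]
      rw [sum_swapGL (F := fun g => ballInt k Φ g f)
        (fun g σ hσ => ballInt_gammaZero hk hΦ hf g hσ), swapGL_mul_alpha_zero]
      ring
    · intro g
      simp only [hJ]
      rw [mul_assoc, gZero_mul_gZero, ← Matrix.GeneralLinearGroup.scalar_commute,
        ballInt_scalar hk hΦ hf, add_comm]
  have := hH g 1
  rwa [one_mul] at this

/-- The measure on `ℙ¹(ℚ_p)` attached to an eigenform. -/
noncomputable def eigenMeasure (hk : Even k) (hΦ : IsEigenLift k c Φ) :
    locAnalytic p k →ₗ[ℚ_[p]] ℚ_[p] where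
  toFun f := ballInt k Φ 1 f + ballInt k Φ (1 * gZero p) f
  map_add' f f' := by
    rw [Submodule.coe_add, ballInt_add hk hΦ f.2 f'.2, ballInt_add hk hΦ f.2 f'.2]
    ring
  map_smul' r f := by
    rw [Submodule.coe_smul, ballInt_smul hk hΦ f.2, ballInt_smul hk hΦ f.2, RingHom.id_apply,
      smul_eq_mul]
    ring

/-- The total may be computed with the pair given by `g`, and on the complementary ball the
expansion of `f` is zero. -/
theorem eigenMeasure_apply_of_support (hk : Even k) (hΦ : IsEigenLift k c Φ)
    (f : locAnalytic p k) (g : GL2 p) (h : ∀ x ∉ affinePart (ball g), f.1 x = 0) :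
    eigenMeasure hk hΦ f = ballInt k Φ g f := by
  change ballInt k Φ 1 f + ballInt k Φ (1 * gZero p) f = _
  have h0 : Represents k f.1 (g * gZero p) 0 :=
    represents_zero fun x hx => h x fun hx' => ball_disjoint g hx' hx
  rw [← ballInt_add_compl hk hΦ f.2 g, ballInt_of_represents hk hΦ h0, map_zero, add_zero]

end

/-! ### Functions on balls -/

/-- For `x` in the ball `g ℤ_p`, the point `y = g⁻¹ x` of `ℤ_p`. -/
theorem ball_preimage {g : GL2 p} {x : ℚ_[p]} (hx : x ∈ affinePart (ball g)) :
    g⁻¹ 1 0 * x + g⁻¹ 1 1 ≠ 0 ∧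
      ‖(g⁻¹ 0 0 * x + g⁻¹ 0 1) / (g⁻¹ 1 0 * x + g⁻¹ 1 1)‖ ≤ 1 ∧
      g 1 0 * ((g⁻¹ 0 0 * x + g⁻¹ 0 1) / (g⁻¹ 1 0 * x + g⁻¹ 1 1)) + g 1 1 ≠ 0 := by
  obtain ⟨h1, h2⟩ := (mem_affinePart_ball g x).1 hx
  refine ⟨h1, h2, ?_⟩
  have e10 : g 1 0 * g⁻¹ 0 0 + g 1 1 * g⁻¹ 1 0 = 0 := by
    rw [← gl_mul_apply, mul_inv_cancel]; simp
  have e11 : g 1 0 * g⁻¹ 0 1 + g 1 1 * g⁻¹ 1 1 = 1 := by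
    rw [← gl_mul_apply, mul_inv_cancel]; simp
  have : g 1 0 * ((g⁻¹ 0 0 * x + g⁻¹ 0 1) / (g⁻¹ 1 0 * x + g⁻¹ 1 1)) + g 1 1
      = (g⁻¹ 1 0 * x + g⁻¹ 1 1)⁻¹ := by
    refine eq_inv_of_mul_eq_one_left ?_
    rw [add_mul, mul_assoc, div_mul_cancel₀ _ h1]
    linear_combination x * e10 + e11
  rw [this]
  exact inv_ne_zero h1

/-- The closed unit disc is also open, so extending `φ` by zero keeps it analytic; near a pole of
`g⁻¹` the Möbius image leaves the disc and the function vanishes identically. -/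
theorem slash_indicator_mem (k : ℕ) {φ : ℚ_[p] → ℚ_[p]}
    (hφ : ∀ y : ℚ_[p], ‖y‖ ≤ 1 → AnalyticAt ℚ_[p] φ y) (g : GL2 p) :
    (affinePart (ball g)).indicator (slash k φ g⁻¹) ∈ locAnalytic p k := by
  classical
  set f : ℚ_[p] → ℚ_[p] := (Metric.closedBall 0 1).indicator φ with hfdef
  have hf : ∀ y, AnalyticAt ℚ_[p] f y := by
    intro y
    by_cases hy : y ∈ Metric.closedBall (0 : ℚ_[p]) 1
    · refine (hφ y (by simpa using hy)).congr ?_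
      filter_upwards [(IsUltrametricDist.isOpen_closedBall (0:ℚ_[p]) one_ne_zero).mem_nhds hy]
        with z hz
      simp [hfdef, Set.indicator_of_mem hz]
    · refine (analyticAt_const (v := 0)).congr ?_
      filter_upwards [Metric.isClosed_closedBall.isOpen_compl.mem_nhds hy] with z hz
      simp [hfdef, Set.indicator_of_notMem hz]
  have hf0 : ∀ y, 1 < ‖y‖ → f y = 0 := by
    intro y hy
    exact Set.indicator_of_notMem (by simpa using hy) _
  have hdet : g⁻¹ 0 0 * g⁻¹ 1 1 - g⁻¹ 0 1 * g⁻¹ 1 0 ≠ 0 := gl_det_ne_zero g⁻¹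
  have heq : ∀ x, (affinePart (ball g)).indicator (slash k φ g⁻¹) x
      = ((g⁻¹).1.det ^ (k/2))⁻¹ * (if g⁻¹ 1 0 * x + g⁻¹ 1 1 ≠ 0 then (g⁻¹ 1 0 * x + g⁻¹ 1 1) ^ k *
        f ((g⁻¹ 0 0 * x + g⁻¹ 0 1) / (g⁻¹ 1 0 * x + g⁻¹ 1 1)) else 0) := by
    intro x
    by_cases hx : x ∈ affinePart (ball g)
    · rw [Set.indicator_of_mem hx]
      obtain ⟨h1, h2⟩ := (mem_affinePart_ball g x).1 hx
      rw [if_pos h1, hfdef, Set.indicator_of_mem (by simpa using h2), slash, mul_assoc]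
    · rw [Set.indicator_of_notMem hx]
      rw [mem_affinePart_ball] at hx
      split_ifs with h1
      · rw [hf0, mul_zero, mul_zero]
        by_contra! h
        exact hx ⟨h1, h⟩
      · simp
  rw [show (affinePart (ball g)).indicator (slash k φ g⁻¹) = _ from funext heq]
  -- At `∞`, the substitution `x ↦ 1/x` exchanges the columns of the matrix and its factor `x^k`
  -- absorbs the denominators, so the same analyticity statement applies.
  refine ⟨fun a => analyticAt_const.mul (analyticAt_slash_aux k f hf hf0 _ _ _ _ hdet a), _,
    (analyticAt_const (v := ((g⁻¹).1.det ^ (k / 2))⁻¹)).mul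
    (analyticAt_slash_aux k f hf hf0 (g⁻¹ 0 1) (g⁻¹ 0 0) (g⁻¹ 1 1) (g⁻¹ 1 0)
      (by intro h; apply hdet; linear_combination -h) 0), ?_⟩
  filter_upwards [self_mem_nhdsWithin] with x hx
  have hx : x ≠ 0 := hx
  have e : ∀ r s : ℚ_[p], r * x⁻¹ + s = (s * x + r) / x := by intro r s; field_simp; ring
  simp only [e, Pi.mul_apply]
  generalize (g⁻¹).1 0 0 = a, (g⁻¹).1 0 1 = b, (g⁻¹).1 1 0 = c', (g⁻¹).1 1 1 = d,
    ((g⁻¹).1.det ^ (k / 2))⁻¹ = D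
  by_cases h : d * x + c' = 0
  · simp only [h, zero_div, ne_eq, not_true_eq_false, if_false, mul_zero]
  · rw [if_pos h, if_pos (div_ne_zero h hx), div_div_div_cancel_right₀ hx, div_pow]
    field_simp

/-- On `g ℤ_p`, the function `f` is `F ·ₖ g⁻¹`. -/
def ExpandsTo (k : ℕ) (f : ℚ_[p] → ℚ_[p]) (g : GL2 p) (F : Tate p) : Prop :=
  ∀ x : ℚ_[p], ‖x‖ ≤ 1 → g 1 0 * x + g 1 1 ≠ 0 → slash k f g x = tateEval F x

theorem ExpandsTo.indicator_eq {k : ℕ} {f : ℚ_[p] → ℚ_[p]} {g : GL2 p} {F : Tate p}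
    (h : ExpandsTo k f g F) : (affinePart (ball g)).indicator f =
      (affinePart (ball g)).indicator (slash k (tateEval F) g⁻¹) := by
  funext x
  by_cases hx : x ∈ affinePart (ball g)
  · obtain ⟨h1, h2, h3⟩ := ball_preimage hx
    rw [Set.indicator_of_mem hx, Set.indicator_of_mem hx, ← slash_congr k g⁻¹ (h _ h2 h3),
      slash_slash k _ _ _ h1, mul_inv_cancel, slash_one]
  · rw [Set.indicator_of_notMem hx, Set.indicator_of_notMem hx]

theorem ExpandsTo.mem {k : ℕ} {f : ℚ_[p] → ℚ_[p]} {g : GL2 p} {F : Tate p}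
    (h : ExpandsTo k f g F) : (affinePart (ball g)).indicator f ∈ locAnalytic p k := by
  rw [h.indicator_eq]
  exact slash_indicator_mem k (fun y hy => analyticAt_tateEval F hy) g

theorem expandsTo_slash (k : ℕ) (g : GL2 p) (F : Tate p) :
    ExpandsTo k (slash k (tateEval F) g⁻¹) g F := fun x _ h0 => by
  rw [slash_slash k _ _ _ h0, inv_mul_cancel, slash_one]

theorem expandsTo_poly {k : ℕ} (g : GL2 p) (P : PolyLE p k) :
    ExpandsTo k (fun x => (P : ℚ_[p][X]).eval x) g (polyToTate (polySlash k g P : ℚ_[p][X])) :=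
  fun x _ h0 => by rw [tateEval_polyToTate, polySlash_eval k _ _ h0]

theorem ExpandsTo.represents {k : ℕ} {f : ℚ_[p] → ℚ_[p]} {g : GL2 p} {F : Tate p}
    (h : ExpandsTo k f g F) : Represents k ((affinePart (ball g)).indicator f) g F :=
  represents_of_forall fun x hx h0 => by
    rw [← h x hx h0]
    exact slash_congr k g (Set.indicator_of_mem (moebius_mem_ball g hx h0) f)

theorem polySlash_one (k : ℕ) (P : PolyLE p k) : polySlash k (1 : GL2 p) P = P := by
  refine Subtype.ext (Polynomial.funext fun x => ?_)
  rw [polySlash_eval k _ _ (by simp), slash_one]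

/-! ### Balls and their normal forms -/

section

open scoped Classical

theorem gammaZero_denom {σ : GL2 p} (hσ : σ ∈ gammaZero p) {x : ℚ_[p]} (hx : ‖x‖ ≤ 1) :
    σ 1 0 * x + σ 1 1 ≠ 0 ∧ ‖(σ 0 0 * x + σ 0 1) / (σ 1 0 * x + σ 1 1)‖ ≤ 1 := by
  have h1 := inv_denom (gammaZero_subset (gammaZero_inv hσ)) hx
  have h2 := inv_moebius_norm_le (gammaZero_subset (gammaZero_inv hσ)) hx
  rw [inv_inv] at h1 h2
  exact ⟨h1, h2⟩

theorem mem_ball {g : GL2 p} {z : OnePoint ℚ_[p]} :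
    z ∈ ball g ↔ ∃ x : ℚ_[p], ‖x‖ ≤ 1 ∧ z = g • (x : OnePoint ℚ_[p]) := by
  constructor
  · rintro ⟨_, ⟨x, -, rfl⟩, rfl⟩
    exact ⟨x, x.2, by congr!⟩
  · rintro ⟨x, hx, rfl⟩
    exact ⟨_, ⟨⟨x, hx⟩, Set.mem_univ _, rfl⟩, by congr!⟩

theorem smul_coe {g : GL2 p} {x : ℚ_[p]} (h : g 1 0 * x + g 1 1 ≠ 0) :
    g • (x : OnePoint ℚ_[p])
      = (((g 0 0 * x + g 0 1) / (g 1 0 * x + g 1 1) : ℚ_[p]) : OnePoint ℚ_[p]) := by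
  rw [OnePoint.smul_some_eq_ite, if_neg h]

theorem smul_coe_eq_infty {g : GL2 p} {x : ℚ_[p]} (h : g 1 0 * x + g 1 1 = 0) :
    g • (x : OnePoint ℚ_[p]) = OnePoint.infty := by
  rw [OnePoint.smul_some_eq_ite, if_pos h]

/-- Both `σ` and its inverse map `ℤ_p` into itself. -/
theorem ball_mul_gammaZero (g : GL2 p) {σ : GL2 p} (hσ : σ ∈ gammaZero p) :
    ball (g * σ) = ball g := by
  have key : ∀ (g : GL2 p) {σ : GL2 p}, σ ∈ gammaZero p → ball (g * σ) ⊆ ball g := by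
    intro g σ hσ z hz
    obtain ⟨x, hx, rfl⟩ := mem_ball.1 hz
    obtain ⟨h1, h2⟩ := gammaZero_denom hσ hx
    refine mem_ball.2 ⟨_, h2, ?_⟩
    rw [mul_smul, smul_coe h1]
  refine Set.Subset.antisymm (key g hσ) ?_
  have := key (g * σ) (gammaZero_inv hσ)
  rwa [mul_inv_cancel_right] at this

theorem ball_scalar_mul (u : ℚ_[p]ˣ) (g : GL2 p) : ball (scalarGL u * g) = ball g := by
  have h : ∀ x : ℚ_[p], scalarGL u • (x : OnePoint ℚ_[p]) = x := by
    intro x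
    have e : ∀ i j, scalarGL u i j = u * (1 : GL2 p) i j := fun i j => by
      rw [← mul_one (scalarGL u), scalarGL_mul_apply]
    rw [smul_coe] <;> simp only [e] <;> simp
  ext z
  rw [mem_ball, mem_ball, Matrix.GeneralLinearGroup.scalar_commute]
  simp only [mul_smul, h]

theorem infty_notMem_ball_aff (s : ℚ_[p]ˣ) (t : ℚ_[p]) : OnePoint.infty ∉ ball (aff s t) := by
  rw [mem_ball]
  rintro ⟨x, -, hx⟩
  obtain ⟨h1, h2, h3, h4⟩ := aff_apply s t
  rw [smul_coe (by rw [h3, h4]; simp)] at hx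
  exact OnePoint.infty_ne_coe _ hx

theorem infty_mem_ball_affZ (s : ℚ_[p]ˣ) (t : ℚ_[p]) :
    OnePoint.infty ∈ ball (aff s t * gZero p) := by
  obtain ⟨h1, h2, h3, h4⟩ := affZ_apply s t
  exact mem_ball.2 ⟨0, by simp, (smul_coe_eq_infty (x := 0) (by rw [h3, h4]; simp)).symm⟩

theorem mem_ball_aff {s : ℚ_[p]ˣ} {t x : ℚ_[p]} :
    x ∈ affinePart (ball (aff s t)) ↔ ‖x - t‖ ≤ ‖(s : ℚ_[p])‖ := by
  obtain ⟨h1, h2, h3, h4⟩ := aff_apply s t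
  obtain ⟨e1, e2, e3, e4⟩ := gl_inv_apply (aff s t)
  rw [mem_affinePart_ball, e1, e2, e3, e4, aff_det, h1, h2, h3, h4]
  have e : ((s : ℚ_[p])⁻¹ * 1 * x + -((s : ℚ_[p])⁻¹ * t)) /
      (-((s : ℚ_[p])⁻¹ * 0) * x + (s : ℚ_[p])⁻¹ * s) = (x - t) / s := by
    have hs : (s : ℚ_[p]) ≠ 0 := s.ne_zero
    field_simp
    ring
  rw [e, norm_div, div_le_one (norm_pos_iff.2 s.ne_zero)]
  simp

theorem ball_aff_eq {s : ℚ_[p]ˣ} {t a : ℚ_[p]} (ha : a ∈ affinePart (ball (aff s t))) :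
    ball (aff s t) = ball (aff s a) := by
  rw [mem_ball_aff] at ha
  have hs : (s : ℚ_[p]) ≠ 0 := s.ne_zero
  have h1 : ‖(a - t) / (s : ℚ_[p])‖ ≤ 1 := by
    rwa [norm_div, div_le_one (norm_pos_iff.2 hs)]
  have e : aff s a = aff s t * aff 1 ((a - t) / (s : ℚ_[p])) := by
    rw [aff_mul, mul_one, mul_div_cancel₀ _ hs, sub_add_cancel]
  rw [e, ball_mul_gammaZero _ (aff_mem (by simp) h1)]

/-- The ball is a closed disc of radius `|s|`, and the distance `|s|` is attained between `t` and `t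
+ s`. -/
theorem diam_ball_aff (s : ℚ_[p]ˣ) (t : ℚ_[p]) :
    Metric.diam (affinePart (ball (aff s t))) = ‖(s : ℚ_[p])‖ := by
  have h : affinePart (ball (aff s t)) = Metric.closedBall t ‖(s : ℚ_[p])‖ := by
    ext x
    rw [mem_ball_aff, Metric.mem_closedBall, dist_eq_norm]
  rw [h]
  refine le_antisymm (Metric.diam_le_of_forall_dist_le (norm_nonneg _) fun x hx y hy => ?_) ?_
  · rw [Metric.mem_closedBall] at hx hy
    rw [dist_comm] at hy
    exact (IsUltrametricDist.dist_triangle_max x t y).trans (max_le hx hy)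
  · have h1 : (t + s) ∈ Metric.closedBall t ‖(s : ℚ_[p])‖ := by simp
    have h2 : t ∈ Metric.closedBall t ‖(s : ℚ_[p])‖ := by simp
    simpa using Metric.dist_le_diam_of_mem Metric.isBounded_closedBall h1 h2

/-- The preimage of `0` is `-s/(pt)`; that it is not integral means `|pt/s| < 1`, and then the
translation is absorbed by a lower unipotent matrix in `Γ₀(p)`. -/
theorem affZ_eq_mul_gammaZero {s : ℚ_[p]ˣ} {t : ℚ_[p]}
    (h : ((0 : ℚ_[p]) : OnePoint ℚ_[p]) ∉ ball (aff s t * gZero p)) :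
    ∃ σ ∈ gammaZero p, aff s t * gZero p = aff s 0 * gZero p * σ := by
  have hs : (s : ℚ_[p]) ≠ 0 := s.ne_zero
  have hp := p_ne_zero (p := p)
  have h1 : ‖(p : ℚ_[p]) * t / s‖ < 1 := by
    by_contra! h1
    have ht : (p : ℚ_[p]) * t ≠ 0 := by
      intro ht
      rw [ht] at h1
      simp at h1
      linarith
    have ht' : t ≠ 0 := right_ne_zero_of_mul ht
    refine h ?_
    have h2 : ‖-(s : ℚ_[p]) / ((p : ℚ_[p]) * t)‖ ≤ 1 := by
      rw [neg_div, norm_neg, ← inv_div, norm_inv]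
      exact inv_le_one_of_one_le₀ h1
    obtain ⟨e1, e2, e3, e4⟩ := affZ_apply s t
    have h3 := moebius_mem_ball (aff s t * gZero p) h2 (by
      rw [e3, e4, add_zero]
      exact mul_ne_zero hp (div_ne_zero (neg_ne_zero.2 hs) ht))
    rw [e1, e2, mul_div_cancel₀ _ ht, neg_add_cancel, zero_div] at h3
    exact h3
  refine ⟨lowU ((p : ℚ_[p]) * t / (s : ℚ_[p])), lowU_mem h1, ?_⟩
  obtain ⟨e1, e2, e3, e4⟩ := affZ_apply s t
  obtain ⟨f1, f2, f3, f4⟩ := affZ_apply s 0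
  obtain ⟨l1, l2, l3, l4⟩ := lowU_apply ((p : ℚ_[p]) * t / (s : ℚ_[p]))
  refine gl_ext ?_ ?_ ?_ ?_
  · rw [e1, gl_mul_apply, f1, f2, l1, l3]; field_simp; ring
  · rw [e2, gl_mul_apply, f1, f2, l2, l4]; ring
  · rw [e3, gl_mul_apply, f3, f4, l1, l3]; ring
  · rw [e4, gl_mul_apply, f3, f4, l2, l4]; ring

theorem ball_affZ_eq {s : ℚ_[p]ˣ} {t : ℚ_[p]}
    (h : ((0 : ℚ_[p]) : OnePoint ℚ_[p]) ∉ ball (aff s t * gZero p)) :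
    ball (aff s t * gZero p) = ball (aff s 0 * gZero p) := by
  obtain ⟨σ, hσ, e⟩ := affZ_eq_mul_gammaZero h
  rw [e, ball_mul_gammaZero _ hσ]

theorem zero_notMem_ball_affZ (s : ℚ_[p]ˣ) :
    ((0 : ℚ_[p]) : OnePoint ℚ_[p]) ∉ ball (aff s 0 * gZero p) := by
  rw [mem_ball]
  rintro ⟨x, -, hx⟩
  obtain ⟨e1, e2, e3, e4⟩ := affZ_apply s 0
  by_cases h : (p : ℚ_[p]) * x = 0
  · rw [smul_coe_eq_infty (by rw [e3, e4, h, add_zero])] at hx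
    exact OnePoint.coe_ne_infty _ hx
  · rw [smul_coe (by rw [e3, e4, add_zero]; exact h), e1, e2, e3, e4, OnePoint.coe_eq_coe] at hx
    have hs : (s : ℚ_[p]) ≠ 0 := s.ne_zero
    rw [mul_zero, zero_mul, zero_add, add_zero, eq_comm] at hx
    exact div_ne_zero hs h hx

theorem affZ_det (s : ℚ_[p]ˣ) (t : ℚ_[p]) : (aff s t * gZero p).1.det = -(p * s) := by
  obtain ⟨e1, e2, e3, e4⟩ := affZ_apply s t
  rw [gl_det, e1, e2, e3, e4]
  ring

/-- The ball consists of `∞` and the points `z` with `|z| ≥ |s/p|`; the supremum is attained at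
`s/p`. -/
theorem sSup_ball_affZ (s : ℚ_[p]ˣ) :
    sSup ((fun z : ℚ_[p] => ‖z⁻¹‖) '' affinePart (ball (aff s 0 * gZero p)))
      = ‖(p : ℚ_[p]) / s‖ := by
  have hs : (s : ℚ_[p]) ≠ 0 := s.ne_zero
  have hp := p_ne_zero (p := p)
  obtain ⟨e1, e2, e3, e4⟩ := affZ_apply s 0
  refine IsGreatest.csSup_eq ⟨⟨s / p, ?_, by simp⟩, ?_⟩
  · have h := moebius_mem_ball (aff s 0 * gZero p) (x := 1) (by simp)
      (by rw [e3, e4]; simpa using hp)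
    rw [e1, e2, e3, e4] at h
    simpa using h
  · rintro _ ⟨z, hz, rfl⟩
    obtain ⟨h1, h2, -⟩ := ball_preimage hz
    obtain ⟨f1, f2, f3, f4⟩ := gl_inv_apply (aff s 0 * gZero p)
    rw [f3, f4, affZ_det, e3, e1] at h1
    rw [f1, f2, f3, f4, affZ_det, e1, e2, e3, e4] at h2
    have hz0 : z ≠ 0 := by
      rintro rfl
      simp at h1
    have e : ((-((p : ℚ_[p]) * s))⁻¹ * 0 * z + -((-((p : ℚ_[p]) * s))⁻¹ * s)) /
        (-((-((p : ℚ_[p]) * s))⁻¹ * p) * z + (-((p : ℚ_[p]) * s))⁻¹ * (p * 0)) = s / p * z⁻¹ := by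
      rw [mul_zero, mul_zero, mul_zero, add_zero, zero_mul, zero_add]
      field_simp
    rw [e, norm_mul, norm_div] at h2
    have hs' := norm_pos_iff.2 hs
    rw [norm_div, le_div_iff₀ hs']
    rw [div_mul_eq_mul_div, div_le_one (norm_pos_iff.2 hp)] at h2
    linarith

end

/-! ### Expansions of powers on balls -/

theorem expandsTo_pow_aff {k : ℕ} (s : ℚ_[p]ˣ) (a : ℚ_[p]) (n : ℕ) :
    ExpandsTo k (fun x => (x - a) ^ n) (aff s a)
      (((s : ℚ_[p]) ^ n / (s : ℚ_[p]) ^ (k / 2)) • tateX n) := by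
  intro x _ _
  obtain ⟨h1, h2, h3, h4⟩ := aff_apply s a
  rw [tateEval_smul, tateEval_tateX, slash, aff_det, h1, h2, h3, h4]
  simp only [zero_mul, zero_add, div_one, add_sub_cancel_right, one_pow, mul_one, mul_pow]
  ring

/-- In the coordinate of this ball the point at infinity is `x = 0`, and the function `x^n` becomes
a multiple of the monomial of degree `k - n`. The bound `n ≤ k` is what makes this exponent
nonnegative. -/
theorem expandsTo_zpow_affZ {k : ℕ} (s : ℚ_[p]ˣ) {n : ℤ} {m : ℕ} (hm : n + m = k) :
    ExpandsTo k (fun x => x ^ n) (aff s 0 * gZero p)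
      ((((-((p : ℚ_[p]) * s)) ^ (k / 2))⁻¹ * p ^ k * ((s : ℚ_[p]) / p) ^ n) • tateX m) := by
  intro x _ h0
  obtain ⟨e1, e2, e3, e4⟩ := affZ_apply s 0
  rw [e3, e4, add_zero] at h0
  have hx : x ≠ 0 := right_ne_zero_of_mul h0
  rw [tateEval_smul, tateEval_tateX, slash, affZ_det, e1, e2, e3, e4]
  have e : (p * 0 * x + (s : ℚ_[p])) / (p * x + 0) = s / p * x⁻¹ := by
    have hp := p_ne_zero (p := p)
    field_simp
    ring
  rw [e, add_zero, mul_pow, mul_zpow, inv_zpow, ← zpow_neg]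
  have e' : x ^ k * x ^ (-n) = x ^ m := by
    rw [← zpow_natCast, ← zpow_natCast, ← zpow_add₀ hx]
    congr 1
    omega
  rw [← e']
  ring

theorem norm_coeff_aff {k : ℕ} (s : ℚ_[p]ˣ) (n : ℕ) :
    ‖(s : ℚ_[p]) ^ n / (s : ℚ_[p]) ^ (k / 2)‖ = ‖(s : ℚ_[p])‖ ^ ((n : ℤ) - (k / 2 : ℕ)) := by
  rw [zpow_sub₀ (norm_ne_zero_iff.2 s.ne_zero), norm_div, norm_pow, norm_pow, zpow_natCast,
    zpow_natCast]

/-- The norm of the normalizing constant is the power of `ρ` in the growth condition, so that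
condition is a uniform bound on moments; likewise `norm_coeff_aff` for discs. -/
theorem norm_coeff_affZ {k : ℕ} (hk : Even k) (s : ℚ_[p]ˣ) (n : ℤ) :
    ‖((-((p : ℚ_[p]) * s)) ^ (k / 2))⁻¹ * p ^ k * ((s : ℚ_[p]) / p) ^ n‖
      = ‖(p : ℚ_[p]) / s‖ ^ (-n + (k / 2 : ℕ)) := by
  obtain ⟨l, rfl⟩ := hk
  have hl : (l + l) / 2 = l := by omega
  have hs : ‖(s : ℚ_[p])‖ ≠ 0 := norm_ne_zero_iff.2 s.ne_zero
  have hp : ‖(p : ℚ_[p])‖ ≠ 0 := norm_p_pos.ne'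
  rw [hl, norm_mul, norm_mul, norm_inv, norm_pow, norm_neg, norm_pow, norm_mul, norm_zpow,
    norm_div, norm_div, zpow_add₀ (div_ne_zero hp hs), zpow_neg, ← inv_zpow, inv_div, zpow_natCast,
    pow_add, div_pow, mul_pow]
  field_simp

/-! ### The measure attached to the cocycle -/

section

variable {k : ℕ} {c : Edge p → Vk p k} {Φ : GL2 p → Dist p}

theorem integralOn_of_mem {μ : locAnalytic p k →ₗ[ℚ_[p]] ℚ_[p]} {U : Set (OnePoint ℚ_[p])}
    {f : ℚ_[p] → ℚ_[p]} (h : (affinePart U).indicator f ∈ locAnalytic p k) :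
    integralOn μ U f = μ ⟨_, h⟩ := by
  rw [integralOn]
  convert dif_pos h

theorem integralOn_eigenMeasure (hk : Even k) (hΦ : IsEigenLift k c Φ) {f : ℚ_[p] → ℚ_[p]}
    {g : GL2 p} {F : Tate p} (h : ExpandsTo k f g F) :
    integralOn (eigenMeasure hk hΦ) (ball g) f = Φ g F := by
  rw [integralOn_of_mem h.mem, eigenMeasure_apply_of_support hk hΦ _ g
    fun x hx => Set.indicator_of_notMem hx f]
  exact ballInt_of_represents hk hΦ h.represents

theorem moment_eigenMeasure (hk : Even k) (hΦ : IsEigenLift k c Φ) (g : GL2 p) (n : ℕ) :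
    moment (eigenMeasure hk hΦ) g n = Φ g (tateX n) := by
  have h : ExpandsTo k (slash k (fun x => x ^ n) g⁻¹) g (tateX n) := by
    have e : (fun x : ℚ_[p] => x ^ n) = tateEval (tateX n) := by
      funext x
      rw [tateEval_tateX]
    rw [e]
    exact expandsTo_slash k g _
  rw [← integralOn_eigenMeasure hk hΦ h, integralOn_of_mem h.mem]
  rfl

/-- Every integral in the definition is a value of `Φ(g)` on an explicit expansion: continuity is
that of `Φ(g)`, the polynomial values are the lifting property, and growth is `bound` on a scaled
monomial. -/
theorem isCocycleMeasure_eigenMeasure (hk : Even k) (hΦ : IsEigenLift k c Φ) :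
    IsCocycleMeasure c (eigenMeasure hk hΦ) where
  isMeasure g := by
    simp only [integralOn_eigenMeasure hk hΦ (expandsTo_slash k g _)]
    exact (Φ g).continuous
  poly g P := by
    rw [integralOn_eigenMeasure hk hΦ (expandsTo_poly g P), ← specialize_apply, hΦ.lift,
      cocycleForm, vkLeft, LinearMap.comp_apply, polySlash_polySlash, mul_inv_cancel,
      polySlash_one]
  growth := by
    have hbd : ∀ g r m, ‖Φ g (r • tateX m)‖ ≤ ‖r‖ := fun g r m => by
      rw [map_smul, smul_eq_mul, norm_mul]
      exact mul_le_of_le_one_right (norm_nonneg _) (hΦ.bound g m)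
    refine ⟨1, zero_le_one, ?_, ?_⟩
    · intro g h1 h2 n hn
      -- Only the ball enters the claim, so `g` may be replaced by its normal form; the position of
      -- `∞` excludes the other case.
      obtain ⟨u, s, t, σ, hσ, rfl | rfl⟩ := exists_decomposition g
      · rw [ball_scalar_mul, ball_mul_gammaZero _ hσ] at h1
        exact absurd h1 (infty_notMem_ball_aff s t)
      · rw [ball_scalar_mul, ball_mul_gammaZero _ hσ] at h2 ⊢
        rw [ball_affZ_eq h2, sSup_ball_affZ, one_mul, ← norm_coeff_affZ hk,
          integralOn_eigenMeasure hk hΦ (expandsTo_zpow_affZ s (m := (k - n).toNat) (by omega))]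
        exact hbd _ _ _
    · intro g h1 a ha n
      obtain ⟨u, s, t, σ, hσ, rfl | rfl⟩ := exists_decomposition g
      · rw [ball_scalar_mul, ball_mul_gammaZero _ hσ] at ha ⊢
        rw [ball_aff_eq ha, diam_ball_aff, one_mul, ← norm_coeff_aff,
          integralOn_eigenMeasure hk hΦ (expandsTo_pow_aff s a n)]
        exact hbd _ _ _
      · rw [ball_scalar_mul, ball_mul_gammaZero _ hσ] at h1
        exact absurd (infty_mem_ball_affZ s t) h1

end

/-! ### Decomposition of functions along balls -/

theorem ExpandsTo.add {k : ℕ} {f f' : ℚ_[p] → ℚ_[p]} {g : GL2 p} {F F' : Tate p}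
    (h : ExpandsTo k f g F) (h' : ExpandsTo k f' g F') : ExpandsTo k (f + f') g (F + F') :=
  fun x hx h0 => by
    rw [slash_add, Pi.add_apply, h x hx h0, h' x hx h0, tateEval_add _ _ hx]

theorem ExpandsTo.smul {k : ℕ} {f : ℚ_[p] → ℚ_[p]} {g : GL2 p} {F : Tate p} (r : ℚ_[p])
    (h : ExpandsTo k f g F) : ExpandsTo k (r • f) g (r • F) := fun x hx h0 => by
  rw [slash_smul, Pi.smul_apply, h x hx h0, tateEval_smul, smul_eq_mul]

theorem ExpandsTo.act {k : ℕ} (hk : Even k) {f : ℚ_[p] → ℚ_[p]} {g : GL2 p} {F : Tate p}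
    (h : ExpandsTo k f g F) (τ : scaledSigmaZero p) :
    ExpandsTo k f (g * (τ.1)⁻¹) (tateAct k τ F) := fun x hx h0 => by
  have hd := inv_denom τ.2 hx
  rw [← slash_slash k _ _ _ hd, tateEval_tateAct hk _ _ hx]
  refine slash_congr k _ (h _ (inv_moebius_norm_le τ.2 hx) fun h1 => h0 ?_)
  rw [← mul_div_assoc, div_add' _ _ _ hd, div_eq_zero_iff, or_iff_left hd] at h1
  rw [gl_mul_apply, gl_mul_apply]
  linear_combination h1

theorem ExpandsTo.mul_alpha {k : ℕ} (hk : Even k) {f : ℚ_[p] → ℚ_[p]} {g : GL2 p} {F : Tate p}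
    (h : ExpandsTo k f g F) (j : ℕ) :
    ExpandsTo k f (g * alpha p j) (tateAct k ⟨(alpha p j)⁻¹, alpha_inv_mem j⟩ F) := by
  simpa only [inv_inv] using h.act hk ⟨(alpha p j)⁻¹, alpha_inv_mem j⟩

theorem mem_ball_mul_alpha {g : GL2 p} {x : ℚ_[p]} (j : ℕ) :
    x ∈ affinePart (ball (g * alpha p j)) ↔ x ∈ affinePart (ball g) ∧
      ‖(g⁻¹ 0 0 * x + g⁻¹ 0 1) / (g⁻¹ 1 0 * x + g⁻¹ 1 1) - j‖ < 1 := by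
  obtain ⟨a1, a2, a3, a4⟩ := alpha_inv_apply (p := p) j
  have hp := p_ne_zero (p := p)
  rw [mem_affinePart_ball, mem_affinePart_ball, mul_inv_rev]
  simp only [gl_mul_apply, a1, a2, a3, a4, zero_mul, zero_add, one_mul]
  by_cases h0 : g⁻¹ 1 0 * x + g⁻¹ 1 1 = 0
  · rw [h0]
    simp only [ne_eq, not_true_eq_false, false_and]
  · have e : (((p : ℚ_[p])⁻¹ * g⁻¹ 0 0 + -((p : ℚ_[p])⁻¹ * j) * g⁻¹ 1 0) * x +
        ((p : ℚ_[p])⁻¹ * g⁻¹ 0 1 + -((p : ℚ_[p])⁻¹ * j) * g⁻¹ 1 1)) / (g⁻¹ 1 0 * x + g⁻¹ 1 1)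
        = ((g⁻¹ 0 0 * x + g⁻¹ 0 1) / (g⁻¹ 1 0 * x + g⁻¹ 1 1) - j) / p := by
      rw [eq_div_iff hp, div_mul_eq_mul_div, div_sub' h0]
      congr 1
      field_simp
      ring
    rw [e]
    generalize (g⁻¹ 0 0 * x + g⁻¹ 0 1) / (g⁻¹ 1 0 * x + g⁻¹ 1 1) = y
    rw [norm_div, div_le_one norm_p_pos]
    constructor
    · rintro ⟨-, h⟩
      have h1 := h.trans_lt norm_p_lt_one
      refine ⟨⟨h0, ?_⟩, h1⟩
      have := norm_add_le_one h1.le (norm_nat_le_one (p := p) j)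
      rwa [sub_add_cancel] at this
    · rintro ⟨-, h⟩
      exact ⟨h0, norm_le_norm_p h⟩

/-- Each point `g⁻¹ x` of `ℤ_p` has exactly one residue modulo `p`. -/
theorem indicator_ball_eq_sum (g : GL2 p) (f : ℚ_[p] → ℚ_[p]) :
    (affinePart (ball g)).indicator f
      = ∑ j ∈ Finset.range p, (affinePart (ball (g * alpha p j))).indicator f := by
  funext x
  rw [Finset.sum_apply]
  by_cases hx : x ∈ affinePart (ball g)
  · obtain ⟨i, hi, h⟩ := exists_residue (ball_preimage hx).2.1
    rw [Finset.sum_eq_single_of_mem i (Finset.mem_range.2 hi), Set.indicator_of_mem hx,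
      Set.indicator_of_mem ((mem_ball_mul_alpha i).2 ⟨hx, h⟩)]
    intro j hj hji
    refine Set.indicator_of_notMem (fun hx' => hji ?_) f
    have h' := ((mem_ball_mul_alpha j).1 hx').2
    refine eq_of_norm_sub_lt_one hi (Finset.mem_range.1 hj) ?_
    generalize (g⁻¹ 0 0 * x + g⁻¹ 0 1) / (g⁻¹ 1 0 * x + g⁻¹ 1 1) = y at h h'
    have e : (j : ℚ_[p]) - i = (y - i) + -(y - j) := by ring
    rw [e]
    exact (IsUltrametricDist.norm_add_le_max _ _).trans_lt (max_lt h (by rwa [norm_neg]))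
  · rw [Set.indicator_of_notMem hx, Finset.sum_eq_zero]
    exact fun j _ => Set.indicator_of_notMem
      (fun hx' => hx ((mem_ball_mul_alpha j).1 hx').1) f

theorem mul_mem_locAnalytic {k : ℕ} {e f : ℚ_[p] → ℚ_[p]} (he : e ∈ locAnalytic p 0)
    (hf : f ∈ locAnalytic p k) : e * f ∈ locAnalytic p k := by
  obtain ⟨he1, h, hh, he2⟩ := he
  obtain ⟨hf1, h', hh', hf2⟩ := hf
  refine ⟨fun a => (he1 a).mul (hf1 a), h * h', hh.mul hh', ?_⟩
  filter_upwards [he2, hf2] with x h1 h2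
  rw [Pi.mul_apply, Pi.mul_apply, h1, h2, pow_zero]
  ring

/-- The characteristic function of a ball is locally analytic of weight `0`, and multiplication by
weight `0` preserves weight `k`. -/
theorem indicator_ball_mem {k : ℕ} {f : ℚ_[p] → ℚ_[p]} (hf : f ∈ locAnalytic p k) (g : GL2 p) :
    (affinePart (ball g)).indicator f ∈ locAnalytic p k := by
  have h1 := slash_indicator_mem 0 (φ := fun _ : ℚ_[p] => 1) (fun _ _ => analyticAt_const) g
  have h2 := mul_mem_locAnalytic h1 hf
  convert h2 using 1
  funext x
  by_cases hx : x ∈ affinePart (ball g) <;> simp [hx, slash]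

theorem indicator_ball_add_compl (f : ℚ_[p] → ℚ_[p]) :
    f = (affinePart (ball 1)).indicator f + (affinePart (ball (gZero p))).indicator f := by
  funext x
  rw [Pi.add_apply]
  by_cases h : x ∈ affinePart (ball 1)
  · rw [Set.indicator_of_mem h, Set.indicator_of_notMem, add_zero]
    intro h'
    rw [← one_mul (gZero p)] at h'
    exact ball_disjoint 1 h h'
  · rw [Set.indicator_of_notMem h, Set.indicator_of_mem, zero_add]
    rw [mem_affinePart_ball] at h ⊢
    have h1 : 1 < ‖x‖ := by simpa using h
    have hx : x ≠ 0 := fun hx => by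
      rw [hx, norm_zero] at h1
      linarith
    have hp := p_ne_zero (p := p)
    obtain ⟨b1, b2, b3, b4⟩ := gZero_apply (p := p)
    obtain ⟨c1, c2, c3, c4⟩ := gl_inv_apply (gZero p)
    have hdet : (gZero p).1.det = -p := by rw [gl_det, b1, b2, b3, b4]; ring
    rw [hdet, b4, mul_zero] at c1
    rw [hdet, b2, mul_one, inv_neg, neg_neg] at c2
    rw [hdet, b3, inv_neg, neg_mul, neg_neg, inv_mul_cancel₀ hp] at c3
    rw [hdet, b1, mul_zero] at c4
    rw [c1, c2, c3, c4, zero_mul, zero_add, one_mul, add_zero]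
    refine ⟨hx, ?_⟩
    have h2 := norm_le_norm_p (x := x⁻¹) (by rw [norm_inv]; exact inv_lt_one_of_one_lt₀ h1)
    rw [div_eq_mul_inv, norm_mul, norm_inv]
    exact inv_mul_le_one_of_le₀ h2 (norm_nonneg _)

/-- Away from the pole of `g` both sides are continuous, so agreement off a finite set extends to
every point. -/
theorem expandsTo_of_represents {k : ℕ} {f : ℚ_[p] → ℚ_[p]} (hf : f ∈ locAnalytic p k) {g : GL2 p}
    {F : Tate p} (h : Represents k f g F) : ExpandsTo k f g F := by
  intro x hx h0
  have hl : ∀ r s : ℚ_[p], AnalyticAt ℚ_[p] (fun x => r * x + s) x := fun r s =>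
    (analyticAt_const.mul analyticAt_id).add analyticAt_const
  have h1 : ContinuousAt (slash k f g) x := by
    have : AnalyticAt ℚ_[p] (slash k f g) x :=
      (analyticAt_const.mul ((hl _ _).pow k)).mul
        (AnalyticAt.fun_comp (g := f) (hf.1 _) ((hl _ _).div (hl _ _) h0))
    exact this.continuousAt
  have h2 : ContinuousAt (tateEval F) x := (analyticAt_tateEval F hx).continuousAt
  have h3 : ∀ᶠ y in 𝓝[≠] x, ‖y‖ ≤ 1 := by
    have h4 : Metric.closedBall (0 : ℚ_[p]) 1 ∈ 𝓝 x :=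
      (IsUltrametricDist.isOpen_closedBall (0 : ℚ_[p]) one_ne_zero).mem_nhds (by simpa using hx)
    filter_upwards [nhdsWithin_le_nhds h4] with y hy
    simpa using hy
  have h4 : ∀ᶠ y in 𝓝[≠] x, y ∉ {y | ‖y‖ ≤ 1 ∧ tateEval F y ≠ slash k f g y} := by
    have h5 : ({y | ‖y‖ ≤ 1 ∧ tateEval F y ≠ slash k f g y} \ {x})ᶜ ∈ 𝓝 x :=
      (h.subset Set.sdiff_subset).isClosed.isOpen_compl.mem_nhds (by simp)
    filter_upwards [nhdsWithin_le_nhds h5, self_mem_nhdsWithin] with y hy hyx hy'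
    exact hy ⟨hy', hyx⟩
  refine tendsto_nhds_unique (h1.tendsto.mono_left nhdsWithin_le_nhds)
    ((h2.tendsto.mono_left nhdsWithin_le_nhds : Tendsto _ (𝓝[≠] x) _).congr' ?_)
  filter_upwards [h3, h4] with y h5 h6
  by_contra h7
  exact h6 ⟨h5, h7⟩

/-! ### The distributions attached to a measure -/

section

variable {k : ℕ} {μ : locAnalytic p k →ₗ[ℚ_[p]] ℚ_[p]}

theorem integralOn_congr {U : Set (OnePoint ℚ_[p])} {f f' : ℚ_[p] → ℚ_[p]}
    (h : (affinePart U).indicator f = (affinePart U).indicator f') :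
    integralOn μ U f = integralOn μ U f' := by
  by_cases h1 : (affinePart U).indicator f ∈ locAnalytic p k
  · have h2 := h1
    rw [h] at h2
    rw [integralOn_of_mem h1, integralOn_of_mem h2]
    exact congrArg μ (Subtype.ext h)
  · have h2 := h1
    rw [h] at h2
    have e1 : integralOn μ U f = 0 := dif_neg h1
    have e2 : integralOn μ U f' = 0 := dif_neg h2
    rw [e1, e2]

theorem integralOn_add {U : Set (OnePoint ℚ_[p])} {f f' : ℚ_[p] → ℚ_[p]}
    (h : (affinePart U).indicator f ∈ locAnalytic p k)
    (h' : (affinePart U).indicator f' ∈ locAnalytic p k) :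
    integralOn μ U (f + f') = integralOn μ U f + integralOn μ U f' := by
  have e : (affinePart U).indicator (f + f')
      = (affinePart U).indicator f + (affinePart U).indicator f' := Set.indicator_add _ _ _
  have h2 : (affinePart U).indicator (f + f') ∈ locAnalytic p k := by
    rw [e]
    exact add_mem h h'
  rw [integralOn_of_mem h, integralOn_of_mem h', integralOn_of_mem h2, ← map_add]
  exact congrArg μ (Subtype.ext e)

theorem integralOn_smul {U : Set (OnePoint ℚ_[p])} {f : ℚ_[p] → ℚ_[p]} (r : ℚ_[p])
    (h : (affinePart U).indicator f ∈ locAnalytic p k) :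
    integralOn μ U (r • f) = r * integralOn μ U f := by
  have e : (affinePart U).indicator (r • f) = r • (affinePart U).indicator f :=
    Set.indicator_const_smul _ r f
  have h2 : (affinePart U).indicator (r • f) ∈ locAnalytic p k := by
    rw [e]
    exact Submodule.smul_mem _ _ h
  rw [integralOn_of_mem h, integralOn_of_mem h2, ← smul_eq_mul, ← map_smul]
  exact congrArg μ (Subtype.ext e)

theorem integralOn_ball_eq_sum {g : GL2 p} {f : ℚ_[p] → ℚ_[p]}
    (h : ∀ j, (affinePart (ball (g * alpha p j))).indicator f ∈ locAnalytic p k) :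
    integralOn μ (ball g) f = ∑ j ∈ Finset.range p, integralOn μ (ball (g * alpha p j)) f := by
  have h2 : (affinePart (ball g)).indicator f ∈ locAnalytic p k := by
    rw [indicator_ball_eq_sum]
    exact Submodule.sum_mem _ fun j _ => h j
  simp only [integralOn_of_mem h2, fun j => integralOn_of_mem (μ := μ) (h j)]
  rw [← map_sum]
  refine congrArg μ (Subtype.ext ?_)
  rw [Submodule.coe_sum]
  exact indicator_ball_eq_sum g f

/-- The distribution `F ↦ ∫_{g ℤ_p} F ·ₖ g⁻¹ dμ`. -/
noncomputable def measureDist (hμ : IsMeasure μ) (g : GL2 p) : Dist p where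
  toFun F := integralOn μ (ball g) (slash k (tateEval F) g⁻¹)
  map_add' F F' := by
    rw [← integralOn_add (expandsTo_slash k g F).mem (expandsTo_slash k g F').mem]
    exact integralOn_congr
      ((expandsTo_slash k g F).add (expandsTo_slash k g F')).indicator_eq.symm
  map_smul' r F := by
    rw [RingHom.id_apply, smul_eq_mul, ← integralOn_smul r (expandsTo_slash k g F).mem]
    exact integralOn_congr ((expandsTo_slash k g F).smul r).indicator_eq.symm
  cont := hμ g

theorem integralOn_eq_measureDist (hμ : IsMeasure μ) {f : ℚ_[p] → ℚ_[p]} {g : GL2 p} {F : Tate p}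
    (h : ExpandsTo k f g F) : integralOn μ (ball g) f = measureDist hμ g F :=
  integralOn_congr h.indicator_eq

theorem measureDist_apply (hμ : IsMeasure μ) (g : GL2 p) (F : Tate p) :
    measureDist hμ g F = integralOn μ (ball g) (slash k (tateEval F) g⁻¹) := rfl

/-- Additivity over the `p` children: the distributions of any measure satisfy the equation of a
form fixed by `Ũ_p`. -/
theorem measureDist_eq_sum (hk : Even k) (hμ : IsMeasure μ) (g : GL2 p) (F : Tate p) :
    measureDist hμ g F = ∑ j ∈ Finset.range p,
      measureDist hμ (g * alpha p j) (tateAct k ⟨(alpha p j)⁻¹, alpha_inv_mem j⟩ F) := by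
  have h := fun j => (expandsTo_slash k g F).mul_alpha hk j
  rw [measureDist_apply, integralOn_ball_eq_sum fun j => (h j).mem]
  exact Finset.sum_congr rfl fun j _ => integralOn_eq_measureDist hμ (h j)

theorem measureDist_gammaZero (hk : Even k) (hμ : IsMeasure μ) (g : GL2 p) {σ : GL2 p}
    (hσ : σ ∈ gammaZero p) (F : Tate p) :
    measureDist hμ (g * σ) F = measureDist hμ g (tateAct k ⟨σ, gammaZero_subset hσ⟩ F) := by
  have h := (expandsTo_slash k (g * σ) F).act hk ⟨σ, gammaZero_subset hσ⟩
  rw [mul_inv_cancel_right] at h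
  rw [← integralOn_eq_measureDist hμ h, measureDist_apply, ball_mul_gammaZero g hσ]

theorem measureDist_scalar (hk : Even k) (hμ : IsMeasure μ) (u : ℚ_[p]ˣ) (g : GL2 p) :
    measureDist hμ (scalarGL u * g) = measureDist hμ g := by
  ext F
  have h : ExpandsTo k (slash k (tateEval F) (scalarGL u * g)⁻¹) g F := by
    intro x hx h0
    rw [← slash_scalar hk _ u g]
    refine expandsTo_slash k (scalarGL u * g) F x hx fun h1 => h0 ?_
    rw [scalarGL_mul_apply, scalarGL_mul_apply] at h1
    exact mul_left_cancel₀ u.ne_zero (by linear_combination h1)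
  rw [← integralOn_eq_measureDist hμ h, measureDist_apply, ball_scalar_mul]

/-- The moments of degree at most `k` are integrals of polynomials, hence prescribed by `c` and
common to all candidate measures. -/
theorem measureDist_tateX {c : Edge p → Vk p k} (hμ : IsCocycleMeasure c μ) (g : GL2 p) {n : ℕ}
    (hn : n ≤ k) : measureDist hμ.isMeasure g (tateX n)
      = c (g • stdEdge p) (polySlash k g⁻¹ (monoLE k ⟨n, Nat.lt_succ_iff.2 hn⟩)) := by
  rw [← hμ.poly, integralOn_eq_measureDist hμ.isMeasure (expandsTo_poly g _), polySlash_polySlash,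
    inv_mul_cancel, polySlash_one]
  rfl

theorem norm_le_of_norm_smul_le {ω : Dist p} {r : ℚ_[p]} {n : ℕ} {C : ℝ} (hr : r ≠ 0)
    (h : ‖ω (r • tateX n)‖ ≤ C * ‖r‖) : ‖ω (tateX n)‖ ≤ C := by
  rw [map_smul, smul_eq_mul, norm_mul, mul_comm] at h
  exact le_of_mul_le_mul_right h (norm_pos_iff.2 hr)

/-- For discs the growth condition is taken with centre `a = t`, for balls around `∞` with exponent
`k - m`. In both cases the power of the radius cancels against the normalizing constant, leaving a
bound independent of the ball. -/
theorem IsCocycleMeasure.exists_bound (hk : Even k) {c : Edge p → Vk p k}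
    (hμ : IsCocycleMeasure c μ) : ∃ C : ℝ,
      (∀ s t n, ‖measureDist hμ.isMeasure (aff s t) (tateX n)‖ ≤ C) ∧
      ∀ s n, ‖measureDist hμ.isMeasure (aff s 0 * gZero p) (tateX n)‖ ≤ C := by
  obtain ⟨C, -, h1, h2⟩ := hμ.growth
  refine ⟨C, fun s t n => ?_, fun s m => ?_⟩
  · have h := h2 (aff s t) (infty_notMem_ball_aff s t) t (mem_ball_aff.2 (by simp)) n
    rw [diam_ball_aff, ← norm_coeff_aff,
      integralOn_eq_measureDist hμ.isMeasure (expandsTo_pow_aff s t n)] at h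
    exact norm_le_of_norm_smul_le
      (div_ne_zero (pow_ne_zero _ s.ne_zero) (pow_ne_zero _ s.ne_zero)) h
  · have h := h1 (aff s 0 * gZero p) (infty_mem_ball_affZ s 0) (zero_notMem_ball_affZ s)
      ((k : ℤ) - m) (by omega)
    rw [sSup_ball_affZ, ← norm_coeff_affZ hk, integralOn_eq_measureDist hμ.isMeasure
      (expandsTo_zpow_affZ s (m := m) (by omega))] at h
    have hp := p_ne_zero (p := p)
    refine norm_le_of_norm_smul_le (mul_ne_zero (mul_ne_zero (inv_ne_zero (pow_ne_zero _
      (neg_ne_zero.2 (mul_ne_zero hp s.ne_zero)))) (pow_ne_zero _ hp))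
      (zpow_ne_zero _ (div_ne_zero s.ne_zero hp))) h

end

/-! ### Uniqueness -/

/-- Since `X` is stable under passing to nonzero children, the bound `C` can be fed back into
`contraction` indefinitely, giving `C|p|^N` for every `N`. -/
theorem dist_eq_zero_of_contraction {k : ℕ} (hk : Even k) {Ψ : GL2 p → Dist p}
    (hΨ : ∀ g F, Ψ g F = ∑ j ∈ Finset.range p,
      Ψ (g * alpha p j) (tateAct k ⟨(alpha p j)⁻¹, alpha_inv_mem j⟩ F))
    (h0 : ∀ g, ∀ n ≤ k, Ψ g (tateX n) = 0) {X : Set (GL2 p)} {C : ℝ}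
    (hC : ∀ g ∈ X, ∀ n, ‖Ψ g (tateX n)‖ ≤ C)
    (hX : ∀ g ∈ X, ∀ j < p, Ψ (g * alpha p j) = 0 ∨ ∃ g' ∈ X, Ψ (g * alpha p j) = Ψ g')
    {g : GL2 p} (hg : g ∈ X) : Ψ g = 0 := by
  have hC0 : 0 ≤ C := (norm_nonneg _).trans (hC g hg 0)
  have key : ∀ N : ℕ, ∀ g ∈ X, ∀ n, ‖Ψ g (tateX n)‖ ≤ C * ‖(p : ℚ_[p])‖ ^ N := by
    intro N
    induction N with
    | zero => simpa using hC
    | succ N ih =>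
      intro g hg n
      -- The family is extended by zero beyond `p` because `contraction` asks for bounds at every
      -- index.
      set ω : ℕ → Dist p := fun j => if j < p then Ψ (g * alpha p j) else 0 with hω
      have e : Ψ g (tateX n) = ∑ j ∈ Finset.range p,
          ω j (tateAct k ⟨(alpha p j)⁻¹, alpha_inv_mem j⟩ (tateX n)) := by
        rw [hΨ]
        refine Finset.sum_congr rfl fun j hj => ?_
        rw [hω]
        simp only [if_pos (Finset.mem_range.1 hj)]
      have hB : 0 ≤ C * ‖(p : ℚ_[p])‖ ^ N := by positivity
      have h1 : ∀ j n, ‖ω j (tateX n)‖ ≤ C * ‖(p : ℚ_[p])‖ ^ N := by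
        intro j n
        simp only [hω]
        split_ifs with hj
        · rcases hX g hg j hj with h | ⟨g', hg', h⟩
          · rw [h]
            simpa using hB
          · rw [h]
            exact ih g' hg' n
        · simpa using hB
      have h2 : ∀ j, ∀ n ≤ k, ω j (tateX n) = 0 := by
        intro j n hn
        simp only [hω]
        split_ifs
        · exact h0 _ n hn
        · simp
      rw [e]
      refine (contraction hk h1 h2 _).trans ?_
      rw [pow_succ, ← mul_assoc]
      exact mul_le_of_le_one_right (by positivity) (tate_norm_tateX n)
  refine tate_clm_ext fun n => ?_
  have hlim : Tendsto (fun N : ℕ => C * ‖(p : ℚ_[p])‖ ^ N) atTop (𝓝 0) := by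
    simpa using (tendsto_pow_atTop_nhds_zero_of_lt_one (norm_nonneg _)
      (norm_p_lt_one (p := p))).const_mul C
  exact norm_le_zero_iff.1 (ge_of_tendsto' hlim fun N => key N g hg n)

section

variable {k : ℕ} {c : Edge p → Vk p k} {μ μ' : locAnalytic p k →ₗ[ℚ_[p]] ℚ_[p]}

theorem aff_mul_alpha (s : ℚ_[p]ˣ) (t : ℚ_[p]) (j : ℕ) :
    aff s t * alpha p j = aff (s * pU p) (s * j + t) := by
  rw [alpha_eq, aff_mul]

/-- The child of a ball around `∞` that still contains `∞` is again in normal form up to a scalar.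
-/
theorem affZ_mul_alpha_zero (s : ℚ_[p]ˣ) :
    aff s 0 * gZero p * alpha p 0 = scalarGL (pU p) * (aff (s * (pU p)⁻¹) 0 * gZero p) := by
  obtain ⟨a1, a2, a3, a4⟩ := alpha_apply (p := p) 0
  obtain ⟨e1, e2, e3, e4⟩ := affZ_apply s 0
  obtain ⟨f1, f2, f3, f4⟩ := affZ_apply (s * (pU p)⁻¹) 0
  have hp := p_ne_zero (p := p)
  refine gl_ext ?_ ?_ ?_ ?_ <;> rw [gl_mul_apply, scalarGL_mul_apply] <;>
    simp only [a1, a2, a3, a4, e1, e2, e3, e4, f1, f2, f3, f4, pU_val, Units.val_mul,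
      Units.val_inv_eq_inv_val, Nat.cast_zero]
  · ring
  · field_simp
    ring
  · ring
  · ring

theorem infty_notMem_ball_affZ_alpha (s : ℚ_[p]ˣ) {j : ℕ} (hj : j < p) (hj0 : j ≠ 0) :
    OnePoint.infty ∉ ball (aff s 0 * gZero p * alpha p j) := by
  classical
  rw [mem_ball]
  rintro ⟨x, hx, h⟩
  obtain ⟨a1, a2, a3, a4⟩ := alpha_apply (p := p) j
  obtain ⟨e1, e2, e3, e4⟩ := affZ_apply s 0
  have hp := p_ne_zero (p := p)
  have h0 : (aff s 0 * gZero p * alpha p j) 1 0 * x + (aff s 0 * gZero p * alpha p j) 1 1 = 0 := by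
    by_contra h0
    refine OnePoint.infty_ne_coe _ (h.trans (Eq.trans ?_ (smul_coe h0)))
    congr!
  rw [gl_mul_apply (aff s 0 * gZero p), gl_mul_apply (aff s 0 * gZero p), a1, a2, a3, a4, e3, e4]
    at h0
  have h2 : (p : ℚ_[p]) * (p * x + j) = 0 := by linear_combination h0
  have h3 : (j : ℚ_[p]) = -(p * x) := by
    linear_combination (mul_eq_zero.1 h2).resolve_left hp
  have h4 := norm_nat_eq_one hj hj0
  rw [h3, norm_neg] at h4
  exact (norm_p_mul_lt_one hx).ne h4

theorem ball_mul_alpha_subset (g : GL2 p) (j : ℕ) : ball (g * alpha p j) ⊆ ball g := by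
  classical
  intro z hz
  obtain ⟨x, hx, rfl⟩ := mem_ball.1 hz
  obtain ⟨a1, a2, a3, a4⟩ := alpha_apply (p := p) j
  refine mem_ball.2 ⟨p * x + j,
    norm_add_le_one (norm_p_mul_lt_one hx).le (norm_nat_le_one j), ?_⟩
  have h := smul_coe (g := alpha p j) (x := x) (by rw [a3, a4]; simp)
  rw [a1, a2, a3, a4, zero_mul, zero_add, div_one] at h
  rw [mul_smul]
  convert congrArg (g • ·) h

/-- Two measures attached to the same cocycle agree on functions with a convergent expansion on a
ball that does not contain both `0` and `∞`. -/
theorem IsCocycleMeasure.measureDist_eq (hk : Even k) (hμ : IsCocycleMeasure c μ)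
    (hμ' : IsCocycleMeasure c μ') {g : GL2 p}
    (hg : OnePoint.infty ∉ ball g ∨ ((0 : ℚ_[p]) : OnePoint ℚ_[p]) ∉ ball g) :
    measureDist hμ.isMeasure g = measureDist hμ'.isMeasure g := by
  set Ψ : GL2 p → Dist p := fun g => measureDist hμ.isMeasure g - measureDist hμ'.isMeasure g
    with hΨdef
  have hΨ : ∀ g F, Ψ g F = ∑ j ∈ Finset.range p,
      Ψ (g * alpha p j) (tateAct k ⟨(alpha p j)⁻¹, alpha_inv_mem j⟩ F) := by
    intro g F
    simp only [hΨdef, sub_apply, Finset.sum_sub_distrib]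
    rw [← measureDist_eq_sum hk, ← measureDist_eq_sum hk]
  have h0 : ∀ g, ∀ n ≤ k, Ψ g (tateX n) = 0 := by
    intro g n hn
    simp only [hΨdef, sub_apply]
    rw [measureDist_tateX hμ g hn, measureDist_tateX hμ' g hn, sub_self]
  have hscalar : ∀ u g, Ψ (scalarGL u * g) = Ψ g := by
    intro u g
    simp only [hΨdef]
    rw [measureDist_scalar hk, measureDist_scalar hk]
  have hsigma : ∀ g σ, σ ∈ gammaZero p → Ψ g = 0 → Ψ (g * σ) = 0 := by
    intro g σ hσ h
    ext F
    have h1 := DFunLike.congr_fun h (tateAct k ⟨σ, gammaZero_subset hσ⟩ F)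
    simp only [hΨdef, sub_apply] at h1 ⊢
    rw [measureDist_gammaZero hk _ _ hσ, measureDist_gammaZero hk _ _ hσ, h1]
    rfl
  obtain ⟨C, hC1, hC2⟩ := hμ.exists_bound hk
  obtain ⟨C', hC1', hC2'⟩ := hμ'.exists_bound hk
  -- Discs in `ℚ_p` form a family stable under subdivision, with one uniform bound.
  have haff : ∀ s t, Ψ (aff s t) = 0 := by
    intro s t
    refine dist_eq_zero_of_contraction hk hΨ h0 (X := {g | ∃ s t, g = aff s t}) (C := C + C') ?_ ?_
      ⟨s, t, rfl⟩
    · rintro _ ⟨s, t, rfl⟩ n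
      exact (norm_sub_le _ _).trans (add_le_add (hC1 s t n) (hC1' s t n))
    · rintro _ ⟨s, t, rfl⟩ j _
      exact Or.inr ⟨_, ⟨_, _, aff_mul_alpha s t j⟩, rfl⟩
  have hfin : ∀ g, OnePoint.infty ∉ ball g → Ψ g = 0 := by
    intro g hg
    obtain ⟨u, s, t, σ, hσ, rfl | rfl⟩ := exists_decomposition g
    · rw [hscalar]
      exact hsigma _ _ hσ (haff s t)
    · rw [ball_scalar_mul, ball_mul_gammaZero _ hσ] at hg
      exact absurd (infty_mem_ball_affZ s t) hg
  -- For balls around `∞` the children with `j ≠ 0` are discs in `ℚ_p`, already dealt with, so only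
  -- the child with `j = 0` stays in the family.
  have haffZ : ∀ s, Ψ (aff s 0 * gZero p) = 0 := by
    intro s
    refine dist_eq_zero_of_contraction hk hΨ h0 (X := {g | ∃ s, g = aff s 0 * gZero p})
      (C := C + C') ?_ ?_ ⟨s, rfl⟩
    · rintro _ ⟨s, rfl⟩ n
      exact (norm_sub_le _ _).trans (add_le_add (hC2 s n) (hC2' s n))
    · rintro _ ⟨s, rfl⟩ j hj
      rcases eq_or_ne j 0 with rfl | hj0
      · refine Or.inr ⟨_, ⟨s * (pU p)⁻¹, rfl⟩, ?_⟩
        rw [affZ_mul_alpha_zero, hscalar]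
      · exact Or.inl (hfin _ (infty_notMem_ball_affZ_alpha s hj hj0))
  refine sub_eq_zero.1 (?_ : Ψ g = 0)
  obtain ⟨u, s, t, σ, hσ, rfl | rfl⟩ := exists_decomposition g
  · rw [hscalar]
    exact hsigma _ _ hσ (haff s t)
  · rw [ball_scalar_mul, ball_mul_gammaZero _ hσ] at hg
    have h1 := hg.resolve_left (not_not_intro (infty_mem_ball_affZ s t))
    obtain ⟨σ', hσ', e⟩ := affZ_eq_mul_gammaZero h1
    rw [hscalar, e]
    exact hsigma _ _ hσ (hsigma _ _ hσ' (haffZ s))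

/-- After enough subdivisions `f` has an expansion on every piece, and pieces inherit from `g ℤ_p`
the property of omitting `0` or `∞`. -/
theorem IsCocycleMeasure.integralOn_eq (hk : Even k) (hμ : IsCocycleMeasure c μ)
    (hμ' : IsCocycleMeasure c μ') {f : ℚ_[p] → ℚ_[p]} (hf : f ∈ locAnalytic p k) {g : GL2 p}
    (hg : OnePoint.infty ∉ ball g ∨ ((0 : ℚ_[p]) : OnePoint ℚ_[p]) ∉ ball g) :
    integralOn μ (ball g) f = integralOn μ' (ball g) f := by
  obtain ⟨N, hN⟩ := exists_analyticLevel hk hf g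
  induction N generalizing g with
  | zero =>
    obtain ⟨F, hF⟩ := analyticLevel_zero hN
    have h := expandsTo_of_represents hf hF
    rw [integralOn_eq_measureDist hμ.isMeasure h, integralOn_eq_measureDist hμ'.isMeasure h,
      hμ.measureDist_eq hk hμ' hg]
  | succ N ih =>
    have h := fun j => indicator_ball_mem hf (g * alpha p j)
    rw [integralOn_ball_eq_sum h, integralOn_ball_eq_sum h]
    refine Finset.sum_congr rfl fun j _ => ih ?_ (hN.child j)
    exact hg.imp (fun h1 h2 => h1 (ball_mul_alpha_subset g j h2))
      fun h1 h2 => h1 (ball_mul_alpha_subset g j h2)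

/-- The projective line is the disjoint union of `ℤ_p`, which omits `∞`, and `g₀ ℤ_p`, which omits
`0`; the growth conditions control both pieces. -/
theorem IsCocycleMeasure.unique (hk : Even k) (hμ : IsCocycleMeasure c μ)
    (hμ' : IsCocycleMeasure c μ') : μ = μ' := by
  ext f
  have hone : OnePoint.infty ∉ ball (1 : GL2 p) := by
    rw [← aff_one_zero]
    exact infty_notMem_ball_aff _ _
  have hzero : ((0 : ℚ_[p]) : OnePoint ℚ_[p]) ∉ ball (gZero p) := by
    rw [← one_mul (gZero p), ← aff_one_zero]
    exact zero_notMem_ball_affZ 1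
  have key : ∀ ν : locAnalytic p k →ₗ[ℚ_[p]] ℚ_[p],
      ν f = integralOn ν (ball 1) f.1 + integralOn ν (ball (gZero p)) f.1 := by
    intro ν
    rw [integralOn_of_mem (indicator_ball_mem f.2 1),
      integralOn_of_mem (indicator_ball_mem f.2 (gZero p)), ← map_add]
    exact congrArg ν (Subtype.ext (indicator_ball_add_compl f.1))
  rw [key μ, key μ', hμ.integralOn_eq hk hμ' f.2 (Or.inl hone),
    hμ.integralOn_eq hk hμ' f.2 (Or.inr hzero)]

end

end PadicForms

/-! ### Existence and uniqueness of `μ_c`, and the moment congruence. -/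

open scoped TensorProduct in
theorem mainTheorem4 (p : ℕ) [Fact p.Prime]
    {B : Type*} [Ring B] [Algebra ℚ B] (hB : PadicForms.IsDefiniteQuaternionAlgebra B)
    (Nminus Nplus : ℕ) (hdisc : PadicForms.HasDiscriminant B Nminus) (hNminus : Nminus.Coprime p)
    (hNplus : Nplus.Coprime (p * Nminus))
    (R : Subring B) (hR : PadicForms.IsEichlerOrder R Nplus)
    (ι : (ℚ_[p] ⊗[ℚ] B) ≃ₐ[ℚ_[p]] Matrix (Fin 2) (Fin 2) ℚ_[p])
    (hι : PadicForms.IsIntegralSplitting R ι)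
    (k : ℕ) (hk : Even k)
    (c : PadicForms.Edge p → PadicForms.Vk p k)
    (hc : PadicForms.IsHarmonicCocycle k (PadicForms.arithGroup R ι) c)
    (Φ₀ : PadicForms.GL2 p → PadicForms.Dist p)
    (hΦ₀ : Φ₀ ∈ PadicForms.formsInt' (PadicForms.arithGroup R ι) k)
    (hlift : PadicForms.specialize k Φ₀ = PadicForms.cocycleForm k c) :
    (∃! μ : PadicForms.locAnalytic p k →ₗ[ℚ_[p]] ℚ_[p], PadicForms.IsCocycleMeasure c μ) ∧
    ∀ μ : PadicForms.locAnalytic p k →ₗ[ℚ_[p]] ℚ_[p], PadicForms.IsCocycleMeasure c μ →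
      ∀ n : ℕ, 1 ≤ n → ∀ i : ℕ, 1 ≤ i → i ≤ n → ∀ g : PadicForms.GL2 p,
        PadicForms.InPow (n - i + 1)
          (((PadicForms.upTilde k)^[n] Φ₀) g (PadicForms.tateX (k + i))
            - PadicForms.moment μ g (k + i)) := by
  obtain ⟨Φ, hΦ, hconv⟩ := PadicForms.exists_eigenLift hk hc hΦ₀ hlift
  have hμ := PadicForms.isCocycleMeasure_eigenMeasure hk hΦ
  refine ⟨⟨_, hμ, fun μ hμ' => hμ'.unique hk hμ⟩, ?_⟩
  intro μ hμ' n _ i hi hin g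
  rw [hμ'.unique hk hμ, PadicForms.moment_eigenMeasure]
  refine PadicForms.inPow_of_norm_le ((hconv n g (k + i)).trans ?_)
  -- The estimate available is `|p|^n`, and `n - i + 1 ≤ n` since `1 ≤ i ≤ n`.
  exact pow_le_pow_of_le_one (norm_nonneg _) PadicForms.norm_p_lt_one.le (by omega)
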